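/- Consider the parametric knapsack problem with $n\ge 1$ items: item $i$ has an integral weight $w_i\in\mathbb{N}_{>0}$ and the profit function $p_i(\lambda)=a_i+\lambda b_i$ with arbitrary $a_i,b_i\in\mathbb{Z}$, the knapsack has capacity $W\in\mathbb{N}$, and, for $\lambda\in\mathbb{R}$, $$p^*(\lambda)=\max\Big\{\sum_{i=1}^n (a_i+\lambda b_i)x_i \;:\; \sum_{i=1}^n w_ix_i\le W,\ x\in\{0,1\}^n\Big\}.$$ There is an FPTAS for this problem that runs in strongly polynomial time $\mathcal{O}(n^4/\varepsilon^2)$ and outputs $\mathcal{O}(n^2/\varepsilon)$ intervals. That is, there are a single algorithm (a program of a random access machine with unit-cost arithmetic operations $+,-,\cdot,/$ and comparisons on numbers, without rounding), a constant $C$ and a polynomial $P$ such that, for every instance $(n,a,b,w,W)$ with $n\ge1$ and every precision $\varepsilon\in(0,1)$, the algorithm, given the instance and $\varepsilon$, halts after at most $C\,n^4/\varepsilon^2$ elementary steps and outputs breakpoints $\lambda_1<\dots<\lambda_k$ with $k+1\le C\,n^2/\varepsilon$, together with vectors $x^{(0)},\dots,x^{(k)}\in\{0,1\}^n$, such that the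 $k+1$ intervals $(-\infty,\lambda_1],[\lambda_1,\lambda_2],\dots,[\lambda_k,+\infty)$ cover $\mathbb{R}$ (for $k=0$ the only interval is $\mathbb{R}$) and $x^{(j)}$ is a $(1-\varepsilon)$-approximate solution for every $\lambda$ in the $j$-th of these intervals ($j=0,\dots,k$), i.e. $\sum_i w_ix^{(j)}_i\le W$ and $\sum_i (a_i+\lambda b_i)x^{(j)}_i\ge(1-\varepsilon)\,p^*(\lambda)$. Moreover, if $\varepsilon$ is rational, then all numbers produced during the computation are rational with encoding length at most $P(L)$, where $L$ is the encoding length of $(a,b,w,W,\varepsilon)$. -/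

import Mathlib

namespace ParamKnapsack

/-! ## The parametric knapsack problem -/

/-- An instance with `n` items: item `i` has the profit function `t ↦ a i + t * b i` and the positive
integral weight `w i`; the knapsack has capacity `W`. -/
structure Input (n : ℕ) where
  a : Fin n → ℤ
  b : Fin n → ℤ
  w : Fin n → ℕ
  W : ℕ
  w_pos : ∀ i, 0 < w i

/-- `x` is (the incidence vector of) a knapsack solution. -/
def Input.Feasible {n : ℕ} (K : Input n) (x : Fin n → ℕ) : Prop :=
  (∀ i, x i = 0 ∨ x i = 1) ∧ ∑ i, K.w i * x i ≤ K.W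

/-- The profit of `x` at the parameter value `t`. -/
noncomputable def Input.profit {n : ℕ} (K : Input n) (t : ℝ) (x : Fin n → ℕ) : ℝ :=
  ∑ i, ((K.a i : ℝ) + t * (K.b i : ℝ)) * (x i : ℝ)

/-- The optimal profit function `p*`. -/
noncomputable def Input.optProfit {n : ℕ} (K : Input n) (t : ℝ) : ℝ :=
  sSup (K.profit t '' {x | K.Feasible x})

/-- The supremum in the definition of `p*` is a maximum. -/
theorem Input.optProfit_isGreatest {n : ℕ} (K : Input n) (t : ℝ) :
    IsGreatest (K.profit t '' {x | K.Feasible x}) (K.optProfit t) := by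
  have hfin : {x | K.Feasible x}.Finite := by
    refine (Set.Finite.pi' (fun _ : Fin n => Set.finite_Iic 1)).subset ?_
    intro x hx i
    rcases hx.1 i with h | h <;> simp [h]
  have hne : {x | K.Feasible x}.Nonempty := ⟨fun _ => 0, by simp [Input.Feasible]⟩
  exact ⟨(hne.image _).csSup_mem (hfin.image _),
    fun y hy => le_csSup (hfin.image _).bddAbove hy⟩

/-- `x` is a `(1 - ε)`-approximate solution at the parameter value `t`. -/
def Input.IsApprox {n : ℕ} (K : Input n) (ε t : ℝ) (x : Fin n → ℕ) : Prop :=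
  K.Feasible x ∧ (1 - ε) * K.optProfit t ≤ K.profit t x

/-- The `j`-th (`0 ≤ j ≤ k`) of the `k + 1` intervals
`(-∞, c 0], [c 0, c 1], …, [c (k - 2), c (k - 1)], [c (k - 1), ∞)` cut out by `k` breakpoints. -/
def piece (k : ℕ) (c : ℕ → ℝ) (j : ℕ) : Set ℝ :=
  {t | (0 < j → c (j - 1) ≤ t) ∧ (j < k → t ≤ c j)}

/-- The breakpoints `c 0 < … < c (k - 1)` and the solutions `x 0, …, x k` form a
`(1 - ε)`-approximate solution of the parametric problem: the `k + 1` intervals cover the real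
line, and `x j` is `(1 - ε)`-approximate at every point of the `j`-th interval. -/
def Input.IsParametricApprox {n : ℕ} (K : Input n) (ε : ℝ)
    (k : ℕ) (c : ℕ → ℝ) (x : ℕ → Fin n → ℕ) : Prop :=
  (∀ j, j + 1 < k → c j < c (j + 1)) ∧
  (∀ t : ℝ, ∃ j ≤ k, t ∈ piece k c j) ∧
  (∀ j ≤ k, ∀ t ∈ piece k c j, K.IsApprox ε t (x j))

/-! ## Encoding lengths -/

/-- Number of bits of an integer (with its sign). -/
def intSize (z : ℤ) : ℕ := z.natAbs.size + 1

/-- Number of bits of a rational number, written as a reduced fraction. -/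
def ratSize (q : ℚ) : ℕ := intSize q.num + q.den.size

/-- Encoding length of an instance. -/
def Input.size {n : ℕ} (K : Input n) : ℕ :=
  ∑ i, (intSize (K.a i) + intSize (K.b i) + intSize (K.w i)) + intSize K.W

/-- `x` is a rational number of encoding length at most `B`. -/
def FitsIn (B : ℕ) (x : ℝ) : Prop := ∃ q : ℚ, (q : ℝ) = x ∧ ratSize q ≤ B

/-! ## The machine model: a random access machine with unit cost arithmetic

The memory consists of index cells, which hold natural numbers, and number cells, which hold real
numbers. Both kinds are organised in two-dimensional tables; the table names are fixed by the
program, the row and the column are computed. Numbers are combined by the four arithmetic operations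
and compared; there is no rounding and no other passage from numbers to indices. On indices
there are only the successor and the truncated difference, so that an index never exceeds the sum of
the running time, the input indices and the constants of the program. -/

/-- The memory: `idx v i j` and `num v i j` are the entries in row `i` and column `j` of the index
table and the number table with the name `v`. -/
structure Mem where
  idx : ℕ → ℕ → ℕ → ℕ
  num : ℕ → ℕ → ℕ → ℝ

/-- Index expressions. -/
inductive IExp where
  | const (c : ℕ)
  | read (v : ℕ) (i j : IExp)
  | succ (e : IExp)
  | sub (e f : IExp)

/-- Value of an index expression. -/
def IExp.eval (σ : Mem) : IExp → ℕ
  | const c => c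
  | read v i j => σ.idx v (i.eval σ) (j.eval σ)
  | succ e => e.eval σ + 1
  | sub e f => e.eval σ - f.eval σ

/-- Number of operations in an index expression. -/
def IExp.cost : IExp → ℕ
  | const _ => 1
  | read _ i j => i.cost + j.cost + 1
  | succ e => e.cost + 1
  | sub e f => e.cost + f.cost + 1

/-- Number expressions. The only constants are integers; `ofIdx` turns an index into a number. -/
inductive NExp where
  | const (c : ℤ)
  | ofIdx (e : IExp)
  | read (v : ℕ) (i j : IExp)
  | add (e f : NExp)
  | sub (e f : NExp)
  | mul (e f : NExp)
  | div (e f : NExp)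

/-- Value of a number expression. -/
noncomputable def NExp.eval (σ : Mem) : NExp → ℝ
  | const c => (c : ℝ)
  | ofIdx e => (e.eval σ : ℝ)
  | read v i j => σ.num v (i.eval σ) (j.eval σ)
  | add e f => e.eval σ + f.eval σ
  | sub e f => e.eval σ - f.eval σ
  | mul e f => e.eval σ * f.eval σ
  | div e f => e.eval σ / f.eval σ

/-- Number of operations in a number expression. -/
def NExp.cost : NExp → ℕ
  | const _ => 1
  | ofIdx e => e.cost + 1
  | read _ i j => i.cost + j.cost + 1
  | add e f => e.cost + f.cost + 1
  | sub e f => e.cost + f.cost + 1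
  | mul e f => e.cost + f.cost + 1
  | div e f => e.cost + f.cost + 1

/-- The expression is evaluated without a division by zero, and all numbers that are produced in
the course of its evaluation have the property `Q`. -/
def NExp.Ok (Q : ℝ → Prop) (σ : Mem) : NExp → Prop
  | const c => Q (c : ℝ)
  | ofIdx e => Q (e.eval σ : ℝ)
  | read _ _ _ => True
  | add e f => e.Ok Q σ ∧ f.Ok Q σ ∧ Q (e.eval σ + f.eval σ)
  | sub e f => e.Ok Q σ ∧ f.Ok Q σ ∧ Q (e.eval σ - f.eval σ)
  | mul e f => e.Ok Q σ ∧ f.Ok Q σ ∧ Q (e.eval σ * f.eval σ)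
  | div e f => e.Ok Q σ ∧ f.Ok Q σ ∧ f.eval σ ≠ 0 ∧ Q (e.eval σ / f.eval σ)

/-- Tests. -/
inductive Test where
  | idxLt (e f : IExp)
  | numLt (e f : NExp)
  | not (b : Test)
  | and (b c : Test)

/-- The test succeeds. -/
def Test.Holds (σ : Mem) : Test → Prop
  | idxLt e f => e.eval σ < f.eval σ
  | numLt e f => e.eval σ < f.eval σ
  | not b => ¬ b.Holds σ
  | and b c => b.Holds σ ∧ c.Holds σ

/-- Number of operations in a test. -/
def Test.cost : Test → ℕ
  | idxLt e f => e.cost + f.cost + 1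
  | numLt e f => e.cost + f.cost + 1
  | not b => b.cost + 1
  | and b c => b.cost + c.cost + 1

/-- As for expressions: no division by zero, and all numbers produced have the property `Q`. -/
def Test.Ok (Q : ℝ → Prop) (σ : Mem) : Test → Prop
  | idxLt _ _ => True
  | numLt e f => e.Ok Q σ ∧ f.Ok Q σ
  | not b => b.Ok Q σ
  | and b c => b.Ok Q σ ∧ c.Ok Q σ

/-- Programs. -/
inductive Prog where
  | skip
  | setIdx (v : ℕ) (i j : IExp) (e : IExp)
  | setNum (v : ℕ) (i j : IExp) (e : NExp)
  | seq (p q : Prog)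
  | ite (b : Test) (p q : Prog)
  | while (b : Test) (p : Prog)

/-- Overwrite one entry of one table. -/
def writeCell {α : Type} (T : ℕ → ℕ → ℕ → α) (v i j : ℕ) (y : α) : ℕ → ℕ → ℕ → α :=
  fun v' i' j' => if v' = v ∧ i' = i ∧ j' = j then y else T v' i' j'

/-- `Exec Q p σ τ s`: started in the memory `σ`, the program `p` halts in the memory `τ` after `s`
elementary steps, without a division by zero, and all numbers that it produces on the way have the
property `Q`. -/
inductive Exec (Q : ℝ → Prop) : Prog → Mem → Mem → ℕ → Prop where
  | skip (σ : Mem) : Exec Q Prog.skip σ σ 1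
  | setIdx (σ : Mem) (v : ℕ) (i j e : IExp) :
      Exec Q (Prog.setIdx v i j e) σ
        { σ with idx := writeCell σ.idx v (i.eval σ) (j.eval σ) (e.eval σ) }
        (i.cost + j.cost + e.cost + 1)
  | setNum (σ : Mem) (v : ℕ) (i j : IExp) (e : NExp) (he : e.Ok Q σ) :
      Exec Q (Prog.setNum v i j e) σ
        { σ with num := writeCell σ.num v (i.eval σ) (j.eval σ) (e.eval σ) }
        (i.cost + j.cost + e.cost + 1)
  | seq {p q : Prog} {σ τ υ : Mem} {s t : ℕ}
      (hp : Exec Q p σ τ s) (hq : Exec Q q τ υ t) : Exec Q (Prog.seq p q) σ υ (s + t)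
  | iteTrue {b : Test} {p q : Prog} {σ τ : Mem} {s : ℕ} (hok : b.Ok Q σ) (hb : b.Holds σ)
      (hp : Exec Q p σ τ s) : Exec Q (Prog.ite b p q) σ τ (b.cost + s + 1)
  | iteFalse {b : Test} {p q : Prog} {σ τ : Mem} {s : ℕ} (hok : b.Ok Q σ) (hb : ¬ b.Holds σ)
      (hq : Exec Q q σ τ s) : Exec Q (Prog.ite b p q) σ τ (b.cost + s + 1)
  | whileFalse {b : Test} {p : Prog} {σ : Mem} (hok : b.Ok Q σ) (hb : ¬ b.Holds σ) :
      Exec Q (Prog.while b p) σ σ (b.cost + 1)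
  | whileTrue {b : Test} {p : Prog} {σ τ υ : Mem} {s t : ℕ} (hok : b.Ok Q σ) (hb : b.Holds σ)
      (hp : Exec Q p σ τ s) (hw : Exec Q (Prog.while b p) τ υ t) :
      Exec Q (Prog.while b p) σ υ (b.cost + s + t + 1)

/-! ## Input and output conventions -/

/-- The initial memory. Index table `0` holds `n`; the number tables `0`, …, `4` hold the `a i`, the
`b i`, the `w i`, the capacity `W` and the precision `ε`; everything else is `0`. -/
noncomputable def Input.toMem {n : ℕ} (K : Input n) (ε : ℝ) : Mem where
  idx v i j := if v = 0 ∧ i = 0 ∧ j = 0 then n else 0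
  num v i j :=
    if v = 0 ∧ j = 0 then (if h : i < n then (K.a ⟨i, h⟩ : ℝ) else 0)
    else if v = 1 ∧ j = 0 then (if h : i < n then (K.b ⟨i, h⟩ : ℝ) else 0)
    else if v = 2 ∧ j = 0 then (if h : i < n then (K.w ⟨i, h⟩ : ℝ) else 0)
    else if v = 3 ∧ i = 0 ∧ j = 0 then (K.W : ℝ)
    else if v = 4 ∧ i = 0 ∧ j = 0 then ε
    else 0

/-- The number `k` of breakpoints in the output: index table `1`. -/
def Mem.outCount (τ : Mem) : ℕ := τ.idx 1 0 0

/-- The breakpoints in the output: number table `5`. -/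
def Mem.outBreak (τ : Mem) (j : ℕ) : ℝ := τ.num 5 j 0

/-- The knapsack solutions in the output: row `j` of index table `2`. -/
def Mem.outSol (n : ℕ) (τ : Mem) (j : ℕ) : Fin n → ℕ := fun i => τ.idx 2 j i

end ParamKnapsack

/-! Put N = ⌈4n/ε⌉, give profit 0 to the items that do not fit, and let top(t) be the maximum of 0
and all item profits. It is convex and piecewise linear, and it is at most the optimal profit,
because the item attaining it fits on its own. Cut the parameter line where some N·p_i(t) crosses
j·top(t), 0 ≤ j ≤ N. Level j = N records the items that overtake the current top line, level 0 the
sign changes of the profits. Inside a cell every positive profit keeps its place between two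
consecutive levels, so two points of a cell see the same instance up to top/N per item. A solution
that loses a fraction 2n/N of the optimum at one point therefore loses at most 4n/N ≤ ε on the whole
cell (`Data.cell_approx`).

There are few cells: N·p_i − j·top is concave, so it crosses zero at most twice. This gives at most
2n(N+1) = O(n²/ε) breakpoints (`Data.count_events`).

In each cell the problem is solved at the midpoint. A greedy set that overshoots the capacity by at
most one item has a profit U with OPT ≤ U ≤ 2·OPT (`sum_le_sum_greedy`, `GreedySet.bounds`). Profits
are rounded down to multiples of U/N, and a dynamic program over the rounded profits 0, …, N finds
minimal weights (`minWeight`); the loss is at most n·U/N ≤ (2n/N)·OPT (`rounded_approx`). A cell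
costs O(nN) steps, the sweep O((nN)²) = O(n⁴/ε²).

No infinite parameter is needed: every crossing is a quotient of integers with absolute value below
`Data.bound`, so the sweep runs from −bound to bound, and signs persist on the two unbounded ends
(`affine_nonpos`).

Encoding lengths do not accumulate along the sweep. Each breakpoint is computed afresh from input
integers, and all sums of profits at one parameter value share a denominator
(`Data.Sized.small_sum`). Hence every number, apart from the products m·ε used to find N, is a
fraction bounded by Z^20, where Z is polynomial in n, N and the input integers.

Correctness, running time and number sizes are proved together, in a Hoare-style calculus (`Run`)
with a frame rule (`Exec.agree`). -/

namespace ParamKnapsack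

/-! ## Reasoning about programs -/

/-- Overwrite an index cell. -/
def Mem.setI (σ : Mem) (v i j y : ℕ) : Mem := { σ with idx := writeCell σ.idx v i j y }

/-- Overwrite a number cell. -/
def Mem.setN (σ : Mem) (v i j : ℕ) (y : ℝ) : Mem := { σ with num := writeCell σ.num v i j y }

@[simp] theorem Mem.setI_num (σ : Mem) (v i j y : ℕ) : (σ.setI v i j y).num = σ.num := rfl

@[simp] theorem Mem.setN_idx (σ : Mem) (v i j : ℕ) (y : ℝ) : (σ.setN v i j y).idx = σ.idx := rfl

@[simp] theorem Mem.setI_idx (σ : Mem) (v i j y v' i' j' : ℕ) :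
    (σ.setI v i j y).idx v' i' j' =
      if v' = v ∧ i' = i ∧ j' = j then y else σ.idx v' i' j' := rfl

@[simp] theorem Mem.setN_num (σ : Mem) (v i j : ℕ) (y : ℝ) (v' i' j' : ℕ) :
    (σ.setN v i j y).num v' i' j' =
      if v' = v ∧ i' = i ∧ j' = j then y else σ.num v' i' j' := rfl

theorem Mem.setI_idx_ne (σ : Mem) {v v' : ℕ} (h : v' ≠ v) (i j y : ℕ) :
    (σ.setI v i j y).idx v' = σ.idx v' := by
  funext i' j'; simp [h]

theorem Mem.setN_num_ne (σ : Mem) {v v' : ℕ} (h : v' ≠ v) (i j : ℕ) (y : ℝ) :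
    (σ.setN v i j y).num v' = σ.num v' := by
  funext i' j'; simp [h]

/-- The program may write to the index table `u`. -/
def Prog.writesI : Prog → ℕ → Bool
  | .skip, _ => false
  | .setIdx v _ _ _, u => Nat.beq u v
  | .setNum _ _ _ _, _ => false
  | .seq p q, u => p.writesI u || q.writesI u
  | .ite _ p q, u => p.writesI u || q.writesI u
  | .while _ p, u => p.writesI u

/-- The program may write to the number table `u`. -/
def Prog.writesN : Prog → ℕ → Bool
  | .skip, _ => false
  | .setIdx _ _ _ _, _ => false
  | .setNum v _ _ _, u => Nat.beq u v
  | .seq p q, u => p.writesN u || q.writesN u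
  | .ite _ p q, u => p.writesN u || q.writesN u
  | .while _ p, u => p.writesN u

/-- The memories agree on all tables to which the program does not write. -/
def Prog.Agree (p : Prog) (σ τ : Mem) : Prop :=
  (∀ v, p.writesI v = false → τ.idx v = σ.idx v) ∧
  (∀ v, p.writesN v = false → τ.num v = σ.num v)

theorem Prog.Agree.refl (p : Prog) (σ : Mem) : p.Agree σ σ := ⟨fun _ _ => rfl, fun _ _ => rfl⟩

theorem Prog.Agree.trans {p : Prog} {σ τ υ : Mem} (h : p.Agree σ τ) (h' : p.Agree τ υ) :
    p.Agree σ υ :=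
  ⟨fun v hv => (h'.1 v hv).trans (h.1 v hv), fun v hv => (h'.2 v hv).trans (h.2 v hv)⟩

theorem Prog.Agree.mono {p q : Prog} {σ τ : Mem} (h : p.Agree σ τ)
    (hI : ∀ v, q.writesI v = false → p.writesI v = false)
    (hN : ∀ v, q.writesN v = false → p.writesN v = false) : q.Agree σ τ :=
  ⟨fun v hv => h.1 v (hI v hv), fun v hv => h.2 v (hN v hv)⟩

/-- This is the frame rule. Table names are literals in the program, so whether a table can change
is a computation, and later uses discharge the side condition by `rfl`. -/
theorem Exec.agree {Q : ℝ → Prop} {p : Prog} {σ τ : Mem} {s : ℕ} (h : Exec Q p σ τ s) :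
    p.Agree σ τ := by
  induction h with
  | skip σ => exact .refl _ _
  | setIdx σ v i j e =>
    refine ⟨fun u hu => Mem.setI_idx_ne σ ?_ _ _ _, fun _ _ => rfl⟩
    rintro rfl
    simp [Prog.writesI] at hu
  | setNum σ v i j e he =>
    refine ⟨fun _ _ => rfl, fun u hu => Mem.setN_num_ne σ ?_ _ _ _⟩
    rintro rfl
    simp [Prog.writesN] at hu
  | seq hp hq ihp ihq =>
    exact (ihp.mono (by simp +contextual [Prog.writesI]) (by simp +contextual [Prog.writesN])).trans
      (ihq.mono (by simp +contextual [Prog.writesI]) (by simp +contextual [Prog.writesN]))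
  | iteTrue hok hb hp ih =>
    exact ih.mono (by simp +contextual [Prog.writesI]) (by simp +contextual [Prog.writesN])
  | iteFalse hok hb hp ih =>
    exact ih.mono (by simp +contextual [Prog.writesI]) (by simp +contextual [Prog.writesN])
  | whileFalse hok hb => exact .refl _ _
  | whileTrue hok hb hp hw ihp ihw =>
    exact (ihp.mono (fun _ h => h) (fun _ h => h)).trans ihw

/-- Started in `σ`, the program halts after at most `c` steps in a memory with the property `R`, and
all numbers that it produces have the property `Q`. -/
def Run (Q : ℝ → Prop) (p : Prog) (σ : Mem) (c : ℕ) (R : Mem → Prop) : Prop :=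
  ∃ τ s, Exec Q p σ τ s ∧ s ≤ c ∧ R τ

/-! ### Proof rules for runs with a time bound -/

namespace Run

variable {Q : ℝ → Prop} {p q : Prog} {σ : Mem} {c c₁ c₂ : ℕ} {R R' : Mem → Prop} {b : Test}

/-- Consequence rule; the weakening of the postcondition may also use the frame. -/
theorem mono (h : Run Q p σ c₁ R') (hc : c₁ ≤ c) (hR : ∀ τ, p.Agree σ τ → R' τ → R τ) :
    Run Q p σ c R := by
  obtain ⟨τ, s, he, hs, hr⟩ := h
  exact ⟨τ, s, he, hs.trans hc, hR τ he.agree hr⟩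

theorem skip (hc : 1 ≤ c) (h : R σ) : Run Q .skip σ c R := ⟨σ, 1, .skip σ, hc, h⟩

theorem setI {v : ℕ} {i j e : IExp} (hc : i.cost + j.cost + e.cost + 1 ≤ c)
    (h : R (σ.setI v (i.eval σ) (j.eval σ) (e.eval σ))) : Run Q (.setIdx v i j e) σ c R :=
  ⟨_, _, .setIdx σ v i j e, hc, h⟩

theorem setN {v : ℕ} {i j : IExp} {e : NExp} (hc : i.cost + j.cost + e.cost + 1 ≤ c)
    (he : e.Ok Q σ) (h : R (σ.setN v (i.eval σ) (j.eval σ) (e.eval σ))) :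
    Run Q (.setNum v i j e) σ c R :=
  ⟨_, _, .setNum σ v i j e he, hc, h⟩

theorem seq (hc : c₁ + c₂ ≤ c) (hp : Run Q p σ c₁ R')
    (hq : ∀ τ, p.Agree σ τ → R' τ → Run Q q τ c₂ R) : Run Q (.seq p q) σ c R := by
  obtain ⟨τ, s, he, hs, hr⟩ := hp
  obtain ⟨υ, t, he', ht, hr'⟩ := hq τ he.agree hr
  exact ⟨υ, s + t, .seq he he', (Nat.add_le_add hs ht).trans hc, hr'⟩

theorem seq_setI {v : ℕ} {i j e : IExp} (hc : i.cost + j.cost + e.cost + 1 + c₂ ≤ c)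
    (h : Run Q q (σ.setI v (i.eval σ) (j.eval σ) (e.eval σ)) c₂ R) :
    Run Q (.seq (.setIdx v i j e) q) σ c R :=
  seq hc (setI (R := fun τ => τ = σ.setI v (i.eval σ) (j.eval σ) (e.eval σ)) le_rfl rfl)
    (by rintro _ - rfl; exact h)

theorem seq_setN {v : ℕ} {i j : IExp} {e : NExp} (hc : i.cost + j.cost + e.cost + 1 + c₂ ≤ c)
    (he : e.Ok Q σ) (h : Run Q q (σ.setN v (i.eval σ) (j.eval σ) (e.eval σ)) c₂ R) :
    Run Q (.seq (.setNum v i j e) q) σ c R :=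
  seq hc (setN (R := fun τ => τ = σ.setN v (i.eval σ) (j.eval σ) (e.eval σ)) le_rfl he rfl)
    (by rintro _ - rfl; exact h)

theorem ite (hc : b.cost + c₁ + 1 ≤ c) (hok : b.Ok Q σ) (hp : b.Holds σ → Run Q p σ c₁ R)
    (hq : ¬ b.Holds σ → Run Q q σ c₁ R) : Run Q (.ite b p q) σ c R := by
  by_cases hb : b.Holds σ
  · obtain ⟨τ, s, he, hs, hr⟩ := hp hb
    exact ⟨τ, _, .iteTrue hok hb he, by omega, hr⟩
  · obtain ⟨τ, s, he, hs, hr⟩ := hq hb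
    exact ⟨τ, _, .iteFalse hok hb he, by omega, hr⟩

/-- A loop with the invariant `I k` after `k` rounds, of which there are at most `B`. -/
theorem while_count {I : ℕ → Mem → Prop} (B : ℕ) (hok : ∀ k τ, I k τ → b.Ok Q τ)
    (step : ∀ k τ, I k τ → b.Holds τ → k < B ∧ Run Q p τ c (I (k + 1))) (h0 : I 0 σ) :
    Run Q (.while b p) σ (B * (c + b.cost + 1) + b.cost + 1)
      (fun τ => ∃ k, I k τ ∧ ¬ b.Holds τ) := by
  -- Induction on the number d of rounds still allowed; with d = 0 the test must fail, since a
  -- further round would need k < B.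
  suffices H : ∀ d k σ, B ≤ k + d → I k σ →
      Run Q (.while b p) σ (d * (c + b.cost + 1) + b.cost + 1)
        (fun τ => ∃ k, I k τ ∧ ¬ b.Holds τ) from H B 0 σ (by omega) h0
  intro d
  induction d with
  | zero =>
    intro k σ hk hI
    by_cases hb : b.Holds σ
    · have := (step k σ hI hb).1
      omega
    · exact ⟨σ, _, .whileFalse (hok k σ hI) hb, by omega, k, hI, hb⟩
  | succ d ih =>
    intro k σ hk hI
    by_cases hb : b.Holds σ
    · obtain ⟨-, τ, s, he, hs, hr⟩ := step k σ hI hb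
      obtain ⟨υ, t, he', ht, hr'⟩ := ih (k + 1) τ (by omega) hr
      refine ⟨υ, _, .whileTrue (hok k σ hI) hb he he', ?_, hr'⟩
      rw [Nat.succ_mul]
      omega
    · exact ⟨σ, _, .whileFalse (hok k σ hI) hb, by omega, k, hI, hb⟩

end Run

/-- The index variable `v`. -/
abbrev ivar (v : ℕ) : IExp := .read v (.const 0) (.const 0)

/-- The number variable `v`. -/
abbrev nvar (v : ℕ) : NExp := .read v (.const 0) (.const 0)

/-- The number array `v`. -/
abbrev narr (v : ℕ) (i : IExp) : NExp := .read v i (.const 0)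

/-- Assignment to an index variable. -/
abbrev Prog.letI (v : ℕ) (e : IExp) : Prog := .setIdx v (.const 0) (.const 0) e

/-- Assignment to a number variable. -/
abbrev Prog.letN (v : ℕ) (e : NExp) : Prog := .setNum v (.const 0) (.const 0) e

/-- Run the body for `v = 0, …, e - 1`. -/
def Prog.for (v : ℕ) (e : IExp) (p : Prog) : Prog :=
  .seq (.letI v (.const 0))
    (.while (.idxLt (ivar v) e) (.seq p (.letI v (.succ (ivar v)))))

/-- A `for` loop with the invariant `I`. -/
theorem Run.for {Q : ℝ → Prop} {p : Prog} {σ : Mem} {c : ℕ} {v : ℕ} {e : IExp}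
    (I : ℕ → Mem → Prop) (m : ℕ) (hec : e.cost ≤ 4) (hv : p.writesI v = false)
    (he : ∀ τ, (Prog.for v e p).Agree σ τ → e.eval τ = m)
    (hI : ∀ k τ y, I k τ → I k (τ.setI v 0 0 y)) (h0 : I 0 σ)
    (step : ∀ k τ, k < m → (Prog.for v e p).Agree σ τ → τ.idx v 0 0 = k → I k τ →
      Run Q p τ c (I (k + 1))) :
    Run Q (.for v e p) σ (m * (c + 16) + 16) (I m) := by
  set pr := Prog.for v e p with hpr
  have hag : ∀ τ y, pr.Agree σ τ → pr.Agree σ (τ.setI v 0 0 y) := by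
    intro τ y h
    refine h.trans ⟨fun u hu => Mem.setI_idx_ne τ ?_ _ _ _, fun _ _ => rfl⟩
    rintro rfl
    simp [hpr, Prog.for, Prog.writesI] at hu
  -- The invariant carries the frame along, so that the bound e still has the value m in every
  -- round.
  have key := Run.while_count (Q := Q) (b := .idxLt (ivar v) e)
    (p := .seq p (.letI v (.succ (ivar v)))) (σ := σ.setI v 0 0 0) (c := c + 7)
    (I := fun k τ => pr.Agree σ τ ∧ τ.idx v 0 0 = k ∧ k ≤ m ∧ I k τ) m
    (fun _ _ _ => trivial)
    (by
      rintro k τ ⟨hA, hk, hkm, hIk⟩ hb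
      have hlt : k < m := by
        have : (ivar v).eval τ < e.eval τ := hb
        rw [he τ hA] at this
        simpa [IExp.eval, hk] using this
      refine ⟨hlt, Run.seq (c₁ := c) (c₂ := 7) (by omega) (step k τ hlt hA hk hIk) ?_⟩
      intro υ hυ hIυ
      refine Run.setI (by simp [IExp.cost]) ?_
      have hk' : υ.idx v 0 0 = k := by rw [hυ.1 v hv, hk]
      refine ⟨hag _ _ (hA.trans (hυ.mono ?_ ?_)), by simp [IExp.eval, hk'], hlt, hI _ _ _ hIυ⟩
      · intro u hu
        simp only [hpr, Prog.for, Prog.writesI, Bool.or_eq_false_iff] at hu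
        exact hu.2.1
      · intro u hu
        simp only [hpr, Prog.for, Prog.writesN, Bool.or_eq_false_iff] at hu
        exact hu.2.1)
    ⟨hag _ _ (.refl _ _), by simp, Nat.zero_le _, hI _ _ _ h0⟩
  have hcost : Test.cost (.idxLt (ivar v) e) ≤ 8 := by
    simp only [Test.cost, IExp.cost]; omega
  refine Run.seq_setI (c₂ := m * (c + 16) + 12) (by simp only [IExp.cost]; omega) (key.mono ?_ ?_)
  · have : m * (c + 7 + Test.cost (.idxLt (ivar v) e) + 1) ≤ m * (c + 16) :=
      Nat.mul_le_mul_left _ (by omega)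
    omega
  · rintro τ - ⟨k, ⟨hA, hk, hkm, hIk⟩, hb⟩
    have : ¬ (ivar v).eval τ < e.eval τ := hb
    rw [he τ hA] at this
    simp only [IExp.eval, hk] at this
    obtain rfl : k = m := by omega
    exact hIk

open Finset

/-! ## The knapsack problem for fixed profits -/

/-- `S` is a set of items among the first `n` that fits into a knapsack of capacity `W`. -/
def Fits (n : ℕ) (w : ℕ → ℕ) (W : ℕ) (S : Finset ℕ) : Prop :=
  S ⊆ range n ∧ ∑ i ∈ S, w i ≤ W

theorem exists_fits_max (n : ℕ) (w : ℕ → ℕ) (W : ℕ) (p : ℕ → ℝ) :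
    ∃ O, Fits n w W O ∧ ∀ S, Fits n w W S → ∑ i ∈ S, p i ≤ ∑ i ∈ O, p i := by
  classical
  obtain ⟨O, hO, hmax⟩ := exists_max_image
    ((range n).powerset.filter fun S => ∑ i ∈ S, w i ≤ W) (fun S => ∑ i ∈ S, p i) ⟨∅, by simp⟩
  simp only [mem_filter, mem_powerset] at hO hmax
  exact ⟨O, hO, hmax⟩

theorem Fits.empty (n : ℕ) (w : ℕ → ℕ) (W : ℕ) : Fits n w W ∅ := by simp [Fits]

theorem Fits.subset {n : ℕ} {w : ℕ → ℕ} {W : ℕ} {S T : Finset ℕ} (h : Fits n w W S) (hT : T ⊆ S) :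
    Fits n w W T :=
  ⟨hT.trans h.1, (sum_le_sum_of_subset hT).trans h.2⟩

/-- A set of items that is closed under taking items of larger density and does not fit into the
knapsack is worth at least as much as any set that fits. -/
theorem sum_le_sum_greedy {n : ℕ} {w : ℕ → ℕ} {W : ℕ} {p : ℕ → ℝ} {G S : Finset ℕ}
    (hpos : ∀ i ∈ G, 0 < p i)
    (hdens : ∀ i ∈ G, ∀ j < n, j ∉ G → p j * w i ≤ p i * w j)
    (hG : W < ∑ i ∈ G, w i ∨ ∀ j < n, j ∉ G → p j ≤ 0) (hS : Fits n w W S) :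
    ∑ i ∈ S, p i ≤ ∑ i ∈ G, p i := by
  classical
  have e1 : ∑ i ∈ S, p i = ∑ i ∈ S ∩ G, p i + ∑ i ∈ S \ G, p i := by
    rw [add_comm, ← sum_sdiff (inter_subset_left (s₁ := S) (s₂ := G)), sdiff_inter_self_left]
  have e2 : ∑ i ∈ G, p i = ∑ i ∈ S ∩ G, p i + ∑ i ∈ G \ S, p i := by
    rw [add_comm, ← sum_sdiff (inter_subset_right (s₁ := S) (s₂ := G)), inter_comm,
      sdiff_inter_self_left]
  have hnn : 0 ≤ ∑ i ∈ G \ S, p i :=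
    sum_nonneg fun i hi => (hpos i (mem_sdiff.1 hi).1).le
  rw [e1, e2]
  refine add_le_add le_rfl ?_
  rcases hG with hG | hG
  · have f1 : ∑ i ∈ S, w i = ∑ i ∈ S ∩ G, w i + ∑ i ∈ S \ G, w i := by
      rw [add_comm, ← sum_sdiff (inter_subset_left (s₁ := S) (s₂ := G)), sdiff_inter_self_left]
    have f2 : ∑ i ∈ G, w i = ∑ i ∈ S ∩ G, w i + ∑ i ∈ G \ S, w i := by
      rw [add_comm, ← sum_sdiff (inter_subset_right (s₁ := S) (s₂ := G)), inter_comm,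
        sdiff_inter_self_left]
    have hlt : ∑ i ∈ S \ G, w i < ∑ i ∈ G \ S, w i := by
      have := hS.2
      omega
    -- Exchange argument without quotients: every item of G \ S is at least as dense as every item
    -- of S \ G, and the cross-multiplied inequalities are summed over all pairs. Since G \ S is the
    -- heavier set, it is worth at least as much.
    have key : (∑ j ∈ S \ G, p j) * (∑ i ∈ G \ S, (w i : ℝ)) ≤
        (∑ i ∈ G \ S, p i) * (∑ j ∈ S \ G, (w j : ℝ)) := by
      rw [sum_mul_sum, sum_mul_sum, sum_comm]
      refine sum_le_sum fun i hi => sum_le_sum fun j hj => ?_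
      exact hdens i (mem_sdiff.1 hi).1 j (mem_range.1 (hS.1 (mem_sdiff.1 hj).1)) (mem_sdiff.1 hj).2
    have hlt' : ∑ i ∈ S \ G, (w i : ℝ) ≤ ∑ i ∈ G \ S, (w i : ℝ) := by exact_mod_cast hlt.le
    have hpos' : 0 < ∑ i ∈ G \ S, (w i : ℝ) := by
      exact_mod_cast (Nat.zero_le _).trans_lt hlt
    exact le_of_mul_le_mul_right (key.trans (mul_le_mul_of_nonneg_left hlt' hnn)) hpos'
  · refine le_trans (sum_nonpos fun j hj => ?_) hnn
    exact hG j (mem_range.1 (hS.1 (mem_sdiff.1 hj).1)) (mem_sdiff.1 hj).2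

/-- The smallest weight of a set of items among the first `i` of total profit at least `v`, where a
weight that exceeds `W` may be replaced by `W + 1`. -/
def minWeight (w : ℕ → ℕ) (W : ℕ) (π : ℕ → ℕ) : ℕ → ℕ → ℕ
  | 0, v => if v = 0 then 0 else W + 1
  | i + 1, v => min (minWeight w W π i v) (minWeight w W π i (v - π i) + w i)

theorem minWeight_le_bound (w : ℕ → ℕ) (W : ℕ) (π : ℕ → ℕ) (i v : ℕ) :
    minWeight w W π i v ≤ W + 1 := by
  induction i with
  | zero => simp only [minWeight]; split <;> omega
  | succ i ih => exact (min_le_left _ _).trans ih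

/-- Induction on the items, according to whether the last one lies in S. Only this half of the
meaning of the table is needed: that an entry is attained is shown by the backtracking itself. -/
theorem minWeight_le_sum (w : ℕ → ℕ) (W : ℕ) (π : ℕ → ℕ) (i : ℕ) :
    ∀ (v : ℕ) (S : Finset ℕ), S ⊆ range i → v ≤ ∑ k ∈ S, π k →
      minWeight w W π i v ≤ ∑ k ∈ S, w k := by
  induction i with
  | zero =>
    intro v S hS hv
    obtain rfl : S = ∅ := by simpa using hS
    obtain rfl : v = 0 := by simpa using hv
    simp [minWeight]
  | succ i ih =>
    intro v S hS hv
    by_cases hi : i ∈ S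
    · refine (min_le_right _ _).trans ?_
      rw [← sum_erase_add S w hi]
      refine Nat.add_le_add_right (ih _ _ ?_ ?_) _
      · intro k hk
        have h1 := mem_range.1 (hS (mem_of_mem_erase hk))
        have h2 := ne_of_mem_erase hk
        exact mem_range.2 (by omega)
      · rw [← sum_erase_add S π hi] at hv
        omega
    · refine (min_le_left _ _).trans (ih v S ?_ hv)
      intro k hk
      have h1 := mem_range.1 (hS hk)
      have h2 : k ≠ i := fun h => hi (h ▸ hk)
      exact mem_range.2 (by omega)

/-- The profits `p` are rounded down to the multiples `π i` of `U / N`, where `U` lies between the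
optimal profit and twice the optimal profit; a set `S` of rounded profit at least `v`, where `v` is
optimal, is nearly optimal for `p`. -/
theorem rounded_approx {n N W v : ℕ} {w π : ℕ → ℕ} {p : ℕ → ℝ} {U : ℝ} {S S₁ S₂ : Finset ℕ}
    (hnN : 2 * n ≤ N) (hU : ∀ T, Fits n w W T → ∑ i ∈ T, p i ≤ U)
    (h₁ : Fits n w W S₁) (h₂ : Fits n w W S₂) (h₁₂ : U = ∑ i ∈ S₁, p i + ∑ i ∈ S₂, p i)
    (hlow : ∀ i < n, 0 < π i → π i * U ≤ N * p i) (hupp : ∀ i < n, N * p i ≤ (π i + 1) * U)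
    (hSn : S ⊆ range n) (hSπ : ∀ i ∈ S, 0 < π i) (hSv : v ≤ ∑ i ∈ S, π i)
    (hv : ∀ u ≤ N, minWeight w W π n u ≤ W → u ≤ v) {T : Finset ℕ} (hT : Fits n w W T) :
    ((N : ℝ) - 2 * n) * ∑ i ∈ T, p i ≤ N * ∑ i ∈ S, p i := by
  classical
  obtain ⟨O, hO, hmax⟩ := exists_fits_max n w W p
  have hU0 : 0 ≤ U := by simpa using hU ∅ (Fits.empty n w W)
  have hOT := hmax T hT
  -- Rounded profits are natural numbers and cannot follow negative profits, so those items leave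
  -- the optimal set, which does not lower its profit.
  set O' := O.filter fun i => 0 < p i with hO'
  have hO'f : Fits n w W O' := hO.subset (filter_subset _ _)
  have hOO' : ∑ i ∈ O, p i ≤ ∑ i ∈ O', p i := by
    rw [← sum_filter_add_sum_filter_not O (fun i => 0 < p i)]
    have : ∑ i ∈ O with ¬ 0 < p i, p i ≤ 0 :=
      sum_nonpos fun i hi => not_lt.1 (mem_filter.1 hi).2
    linarith
  have hlow' : ∀ i < n, 0 ≤ p i → π i * U ≤ N * p i := by
    intro i hi hp
    rcases Nat.eq_zero_or_pos (π i) with h | h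
    · rw [h]; simp; positivity
    · exact hlow i hi h
  have hSU : (v : ℝ) * U ≤ N * ∑ i ∈ S, p i := by
    calc (v : ℝ) * U ≤ (∑ i ∈ S, (π i : ℝ)) * U :=
          mul_le_mul_of_nonneg_right (by exact_mod_cast hSv) hU0
      _ = ∑ i ∈ S, (π i * U) := by rw [sum_mul]
      _ ≤ ∑ i ∈ S, N * p i :=
          sum_le_sum fun i hi => hlow i (mem_range.1 (hSn hi)) (hSπ i hi)
      _ = _ := by rw [mul_sum]
  have hO'le : ∀ i ∈ O', π i * U ≤ N * p i := fun i hi =>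
    hlow' i (mem_range.1 (hO'f.1 hi)) (mem_filter.1 hi).2.le
  have hmain : (N : ℝ) * ∑ i ∈ O', p i ≤ v * U + n * U := by
    rcases hU0.eq_or_lt with h0 | h0
    · have := hU O' hO'f
      rw [← h0] at this ⊢
      have hN : (0 : ℝ) ≤ N := by positivity
      nlinarith
    -- Since the profit of O' is at most U, its rounded profit is at most N and is one of the values
    -- over which v is maximal.
    have hu : ∑ i ∈ O', π i ≤ v := by
      refine hv _ ?_ ((minWeight_le_sum w W π n _ O' hO'f.1 le_rfl).trans hO'f.2)
      have : (∑ i ∈ O', (π i : ℝ)) * U ≤ N * U := by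
        rw [sum_mul]
        calc ∑ i ∈ O', (π i : ℝ) * U ≤ ∑ i ∈ O', N * p i := sum_le_sum hO'le
          _ = N * ∑ i ∈ O', p i := by rw [mul_sum]
          _ ≤ N * U := mul_le_mul_of_nonneg_left (hU O' hO'f) (by positivity)
      exact_mod_cast le_of_mul_le_mul_right this h0
    have hcard : (O'.card : ℝ) ≤ n := by
      exact_mod_cast (card_le_card hO'f.1).trans (by simp)
    calc (N : ℝ) * ∑ i ∈ O', p i = ∑ i ∈ O', N * p i := by rw [mul_sum]
      _ ≤ ∑ i ∈ O', ((π i : ℝ) + 1) * U :=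
          sum_le_sum fun i hi => hupp i (mem_range.1 (hO'f.1 hi))
      _ = (∑ i ∈ O', (π i : ℝ)) * U + O'.card * U := by
          rw [← sum_mul, sum_add_distrib]; simp; ring
      _ ≤ v * U + n * U := by
          have : (∑ i ∈ O', (π i : ℝ)) ≤ v := by exact_mod_cast hu
          gcongr
  have hU2 : U ≤ 2 * ∑ i ∈ O, p i := by
    have := hmax S₁ h₁
    have := hmax S₂ h₂
    linarith
  have hn : (0 : ℝ) ≤ n := by positivity
  have hN : (0 : ℝ) ≤ N := by positivity
  have hnN' : (2 : ℝ) * n ≤ N := by exact_mod_cast hnN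
  have a1 : (n : ℝ) * U ≤ n * (2 * ∑ i ∈ O, p i) := mul_le_mul_of_nonneg_left hU2 hn
  have a2 : (N : ℝ) * ∑ i ∈ O, p i ≤ N * ∑ i ∈ O', p i := mul_le_mul_of_nonneg_left hOO' hN
  have a3 : ((N : ℝ) - 2 * n) * ∑ i ∈ T, p i ≤ ((N : ℝ) - 2 * n) * ∑ i ∈ O, p i :=
    mul_le_mul_of_nonneg_left hOT (by linarith)
  nlinarith

/-! ## Cells of the parameter line -/

/-- The interval from `l` to `r`, extended to `-∞` if `l = -M` and to `∞` if `r = M`. -/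
def cell (M l r : ℝ) : Set ℝ := {t | (l = -M ∨ l ≤ t) ∧ (r = M ∨ t ≤ r)}

/-- An affine function without a zero inside the cell keeps its sign on the cell. -/
theorem affine_nonpos {M l r α β s t : ℝ} (hl : l < s) (hr : s < r) (ht : t ∈ cell M l r)
    (hroot : ∀ ρ, β ≠ 0 → α + β * ρ = 0 → -M < ρ ∧ ρ < M ∧ ¬ (l < ρ ∧ ρ < r))
    (hs : α + β * s ≤ 0) : α + β * t ≤ 0 := by
  by_contra! h
  have hβ : β ≠ 0 := by
    rintro rfl
    simp at hs h
    linarith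
  obtain ⟨h1, h2, h3⟩ := hroot (-α / β) hβ (by field_simp; ring)
  set ρ := -α / β with hρ
  have hα : α = -β * ρ := by rw [hρ]; field_simp
  have hs' : β * (s - ρ) ≤ 0 := by rw [hα] at hs; linarith
  have ht' : 0 < β * (t - ρ) := by rw [hα] at h; linarith
  apply h3
  -- A sign change between s and t puts the root between them; since the root is also within ±M, it
  -- lies strictly between l and r even when t is on an unbounded end.
  rcases lt_or_gt_of_ne hβ with hneg | hpos
  · have a1 : ρ ≤ s := by by_contra! hh; nlinarith
    have a2 : t < ρ := by by_contra! hh; nlinarith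
    rcases ht.1 with h | h <;> constructor <;> linarith
  · have a1 : s ≤ ρ := by by_contra! hh; nlinarith
    have a2 : ρ < t := by by_contra! hh; nlinarith
    rcases ht.2 with h | h <;> constructor <;> linarith

/-- The data on which the algorithm works after preprocessing: the profits of the items that do not
fit into the knapsack are `0`, and `N` is the number of levels into which profits are divided. -/
structure Data where
  n : ℕ
  N : ℕ
  W : ℕ
  a : ℕ → ℤ
  b : ℕ → ℤ
  w : ℕ → ℕ
  w_pos : ∀ i, 0 < w i
  a_eq_zero : ∀ i, W < w i → a i = 0
  b_eq_zero : ∀ i, W < w i → b i = 0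
  n_pos : 0 < n
  le_N : 4 * n ≤ N

namespace Data

variable (D : Data)

/-- The profit of item `i` at the parameter value `t`. -/
def p (t : ℝ) (i : ℕ) : ℝ := D.a i + t * D.b i

/-- A bound for the absolute values of all breakpoints. -/
def bound : ℤ := 1 + ∑ i ∈ range D.n, 2 * D.N * D.a i ^ 2

/-- `A + t * B` is the zero function or the profit function of an item. -/
def IsLine (A B : ℤ) : Prop := (A = 0 ∧ B = 0) ∨ ∃ i < D.n, A = D.a i ∧ B = D.b i

/-- `A + t * B` is at least as large as `0` and all profits at `t`. -/
def IsTop (A B : ℤ) (t : ℝ) : Prop := 0 ≤ A + t * B ∧ ∀ i < D.n, D.p t i ≤ A + t * B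

/-- The profit of item `i` passes the fraction `j / N` of `A + t * B` at `ρ`. -/
def Crosses (A B : ℤ) (i j : ℕ) (ρ : ℝ) : Prop :=
  (D.N * D.b i - j * B : ℝ) ≠ 0 ∧ D.N * D.p ρ i = j * (A + ρ * B)

/-- Immediately to the right of `l`, the line `A + t * B` is a largest one. -/
def IsGerm (A B : ℤ) (l : ℝ) : Prop :=
  (0 < A + l * B ∨ 0 = A + l * B ∧ 0 ≤ B) ∧
  ∀ i < D.n, D.p l i < A + l * B ∨ D.p l i = A + l * B ∧ D.b i ≤ B

/-- There is no breakpoint between `l` and `r`. -/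
def NoCross (A B : ℤ) (l r : ℝ) : Prop :=
  ∀ i < D.n, ∀ j ≤ D.N, ∀ ρ, l < ρ → ρ < r → ¬ D.Crosses A B i j ρ

variable {D}

theorem N_pos : (0 : ℝ) < D.N := by
  have h1 := D.n_pos
  have h2 := D.le_N
  exact_mod_cast (by omega : 0 < D.N)

theorem bound_pos : 0 < D.bound := by
  have : 0 ≤ ∑ i ∈ range D.n, 2 * (D.N : ℤ) * D.a i ^ 2 := sum_nonneg fun i _ => by positivity
  unfold bound
  omega

/-- Since |a| ≤ a² for integers, each of the two terms is at most half of `bound - 1`. -/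
theorem lt_bound {i j : ℕ} (hi : i < D.n) {A B : ℤ} (hA : D.IsLine A B) (hj : j ≤ D.N) :
    |j * A - D.N * D.a i| < D.bound := by
  have hsum : ∀ k < D.n, 2 * (D.N : ℤ) * |D.a k| ≤ D.bound - 1 := by
    intro k hk
    have h1 : 2 * (D.N : ℤ) * |D.a k| ≤ 2 * (D.N : ℤ) * D.a k ^ 2 := by
      refine mul_le_mul_of_nonneg_left ?_ (by positivity)
      rw [← sq_abs]
      rcases (abs_nonneg (D.a k)).eq_or_lt with h | h
      · rw [← h]; simp
      · nlinarith
    have h2 := single_le_sum (f := fun i => 2 * (D.N : ℤ) * D.a i ^ 2)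
      (fun i _ => by positivity) (mem_range.2 hk)
    unfold bound
    linarith
  have h1 : |(j : ℤ) * A - D.N * D.a i| ≤ |(j : ℤ) * A| + |D.N * D.a i| := abs_sub _ _
  rw [abs_mul, abs_mul, Nat.abs_cast, Nat.abs_cast] at h1
  have hj' : (j : ℤ) ≤ D.N := by exact_mod_cast hj
  have h2 := hsum i hi
  have h3 : 2 * (D.N : ℤ) * |A| ≤ D.bound - 1 := by
    rcases hA with ⟨rfl, -⟩ | ⟨k, hk, rfl, -⟩
    · have := D.bound_pos
      simp; omega
    · exact hsum k hk
  have h4 : (j : ℤ) * |A| ≤ D.N * |A| := mul_le_mul_of_nonneg_right hj' (abs_nonneg _)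
  linarith

theorem Crosses.eq_div {A B : ℤ} {i j : ℕ} {ρ : ℝ} (h : D.Crosses A B i j ρ) :
    ρ = (j * A - D.N * D.a i) / (D.N * D.b i - j * B) := by
  rw [eq_div_iff h.1]
  have := h.2
  unfold p at this
  linarith

/-- A crossing is a quotient whose denominator is a nonzero integer, so it is no larger than its
numerator. -/
theorem Crosses.abs_lt {A B : ℤ} {i j : ℕ} {ρ : ℝ} (h : D.Crosses A B i j ρ) (hi : i < D.n)
    (hj : j ≤ D.N) (hA : D.IsLine A B) : |ρ| < D.bound := by
  rw [h.eq_div, abs_div]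
  have h0 : (D.N * D.b i - j * B : ℤ) ≠ 0 := by
    have := h.1
    exact_mod_cast this
  have h1 : (1 : ℝ) ≤ |(D.N * D.b i - j * B : ℝ)| := by
    exact_mod_cast Int.one_le_abs h0
  have h2 : |(j * A - D.N * D.a i : ℝ)| < D.bound := by
    exact_mod_cast lt_bound hi hA hj
  exact (div_le_self (abs_nonneg _) h1).trans_lt h2

/-- The values of an affine function without zeros to the right of `l`. -/
theorem germ_nonpos {α β l r s : ℝ} (hs : l < s) (hr : s < r)
    (h : α + β * l < 0 ∨ α + β * l = 0 ∧ β ≤ 0)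
    (hroot : ∀ ρ, l < ρ → ρ < r → β ≠ 0 → α + β * ρ ≠ 0) : α + β * s ≤ 0 := by
  by_contra! hc
  rcases h with h | ⟨h, hβ⟩
  · have hβ : 0 < β := by by_contra! hh; nlinarith
    have hα : α = -β * (-α / β) := by field_simp
    refine hroot (-α / β) ?_ ?_ hβ.ne' (by field_simp; ring)
    · by_contra! hh
      nlinarith
    · by_contra! hh
      nlinarith
  · nlinarith

/-! ### Signs and approximate solutions are stable on a cell -/

section Cell

variable {A B : ℤ} {l r s t : ℝ}

/-- The sign of the distance from a level is constant on a cell. -/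
theorem level_nonpos (hA : D.IsLine A B) (hcr : D.NoCross A B l r) (hl : l < s) (hr : s < r)
    (ht : t ∈ cell D.bound l r) {i j : ℕ} (hi : i < D.n) (hj : j ≤ D.N)
    (hs : D.N * D.p s i ≤ j * (A + s * B)) : D.N * D.p t i ≤ j * (A + t * B) := by
  have := affine_nonpos (α := D.N * D.a i - j * A) (β := D.N * D.b i - j * B) hl hr ht
    (by
      intro ρ hβ hρ
      have hc : D.Crosses A B i j ρ := ⟨hβ, by unfold p; linarith⟩
      have := abs_lt.1 (hc.abs_lt hi hj hA)
      exact ⟨this.1, this.2, fun h => hcr i hi j hj ρ h.1 h.2 hc⟩)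
    (by unfold p at hs; linarith)
  unfold p
  linarith

theorem level_nonneg (hA : D.IsLine A B) (hcr : D.NoCross A B l r) (hl : l < s) (hr : s < r)
    (ht : t ∈ cell D.bound l r) {i j : ℕ} (hi : i < D.n) (hj : j ≤ D.N)
    (hs : j * (A + s * B) ≤ D.N * D.p s i) : j * (A + t * B) ≤ D.N * D.p t i := by
  have := affine_nonpos (α := j * A - D.N * D.a i) (β := j * B - D.N * D.b i) hl hr ht
    (by
      intro ρ hβ hρ
      have hc : D.Crosses A B i j ρ :=
        ⟨fun h => hβ (by linarith), by unfold p; linarith⟩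
      have := abs_lt.1 (hc.abs_lt hi hj hA)
      exact ⟨this.1, this.2, fun h => hcr i hi j hj ρ h.1 h.2 hc⟩)
    (by unfold p at hs; linarith)
  unfold p
  linarith

/-- To lose its place, the line would have to meet another item (a crossing at level N) or, being
itself an item, pass zero (a crossing at level 0). Neither happens between l and r, and the level
lemmas extend the conclusion to the whole cell. -/
theorem isTop_of_germ (hA : D.IsLine A B) (hg : D.IsGerm A B l) (hcr : D.NoCross A B l r)
    (hl : l < s) (hr : s < r) (ht : t ∈ cell D.bound l r) : D.IsTop A B t := by
  have hN := D.N_pos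
  constructor
  · rcases hA with ⟨rfl, rfl⟩ | ⟨i, hi, rfl, rfl⟩
    · simp
    · have h1 := germ_nonpos (α := -D.N * D.a i) (β := -D.N * D.b i) hl hr
        (by
          rcases hg.1 with h | ⟨h, hB⟩
          · left; nlinarith
          · right
            have hB' : (0 : ℝ) ≤ D.b i := by exact_mod_cast hB
            exact ⟨by linear_combination (-D.N : ℝ) * h.symm, by nlinarith⟩)
        (by
          intro ρ h1 h2 hβ h0
          refine hcr i hi 0 (Nat.zero_le _) ρ h1 h2 ⟨?_, ?_⟩
          · simpa using hβ
          · unfold p; push_cast; linarith)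
      have h2 := level_nonneg (j := 0) (Or.inr ⟨i, hi, rfl, rfl⟩) hcr hl hr ht hi (Nat.zero_le _)
        (by unfold p; push_cast; linarith)
      have h3 : 0 ≤ D.N * D.p t i := by simpa using h2
      exact nonneg_of_mul_nonneg_right h3 hN
  · intro i hi
    have h1 := germ_nonpos (α := D.N * (D.a i - A)) (β := D.N * (D.b i - B)) hl hr
      (by
        rcases hg.2 i hi with h | ⟨h, hB⟩
        · left; unfold p at h; nlinarith
        · right
          have hB' : (D.b i : ℝ) ≤ B := by exact_mod_cast hB
          unfold p at h
          exact ⟨by linear_combination (D.N : ℝ) * h, by nlinarith⟩)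
      (by
        intro ρ h1 h2 hβ h0
        refine hcr i hi D.N le_rfl ρ h1 h2 ⟨fun h => hβ (by linarith), ?_⟩
        unfold p; linarith)
    have h2 := level_nonpos (j := D.N) hA hcr hl hr ht hi le_rfl (by unfold p; linarith)
    exact le_of_mul_le_mul_left h2 hN

/-- A nearly optimal solution at one point of a cell is nearly optimal on the whole cell. -/
theorem cell_approx (hA : D.IsLine A B) (hg : D.IsGerm A B l) (hcr : D.NoCross A B l r)
    (hl : l < s) (hr : s < r) {S : Finset ℕ} (hSn : S ⊆ range D.n) (hpos : ∀ i ∈ S, 0 < D.p s i)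
    (hS : ∀ T, Fits D.n D.w D.W T →
      ((D.N : ℝ) - 2 * D.n) * ∑ i ∈ T, D.p s i ≤ D.N * ∑ i ∈ S, D.p s i)
    (ht : t ∈ cell D.bound l r) {T : Finset ℕ} (hT : Fits D.n D.w D.W T) :
    ((D.N : ℝ) - 4 * D.n) * ∑ i ∈ T, D.p t i ≤ D.N * ∑ i ∈ S, D.p t i := by
  classical
  have hN := D.N_pos
  have hnN : (4 : ℝ) * D.n ≤ D.N := by exact_mod_cast D.le_N
  have hn0 : (0 : ℝ) ≤ D.n := by positivity
  have hscell : s ∈ cell D.bound l r := ⟨Or.inr hl.le, Or.inr hr.le⟩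
  obtain ⟨hs0, htops⟩ := isTop_of_germ hA hg hcr hl hr hscell
  obtain ⟨ht0, htopt⟩ := isTop_of_germ hA hg hcr hl hr ht
  set P : ℝ := A + s * B with hP
  set P' : ℝ := A + t * B with hP'
  have hneg : ∀ i < D.n, D.p s i ≤ 0 → D.p t i ≤ 0 := by
    intro i hi h
    have := level_nonpos (j := 0) hA hcr hl hr ht hi (Nat.zero_le _) (by push_cast; nlinarith)
    push_cast at this
    nlinarith
  -- The ratios p/P at s and p/P' at t lie between the same levels j/N and (j+1)/N, hence differ by
  -- at most 1/N; denominators are cleared. At j = N the upper level is replaced by the top line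
  -- itself.
  have hnear : ∀ i < D.n, 0 < D.p s i →
      D.N * P' * D.p s i ≤ D.N * P * D.p t i + P * P' ∧
      D.N * P * D.p t i ≤ D.N * P' * D.p s i + P * P' := by
    intro i hi h
    have hP0 : 0 < P := h.trans_le (htops i hi)
    obtain ⟨j, hj1, hj2, hj3⟩ : ∃ j : ℕ, j ≤ D.N ∧ j * P ≤ D.N * D.p s i ∧
        D.N * D.p s i ≤ (j + 1) * P := by
      have hfl : ⌊D.N * D.p s i / P⌋₊ * P ≤ D.N * D.p s i :=
        (le_div_iff₀ hP0).1 (Nat.floor_le (by positivity))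
      refine ⟨⌊D.N * D.p s i / P⌋₊, ?_, hfl, ?_⟩
      · have : (⌊D.N * D.p s i / P⌋₊ : ℝ) ≤ D.N := by
          have := mul_le_mul_of_nonneg_left (htops i hi) hN.le
          exact le_of_mul_le_mul_right (hfl.trans this) hP0
        exact_mod_cast this
      · exact (div_le_iff₀ hP0).1 (Nat.lt_floor_add_one _).le
    have hlow := level_nonneg hA hcr hl hr ht hi hj1 hj2
    have hupp : D.N * D.p t i ≤ (j + 1) * P' := by
      rcases hj1.eq_or_lt with rfl | hlt
      · have := mul_le_mul_of_nonneg_left (htopt i hi) hN.le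
        nlinarith
      · have := level_nonpos (j := j + 1) hA hcr hl hr ht hi hlt (by push_cast; exact hj3)
        push_cast at this
        exact this
    constructor
    · have h1 := mul_le_mul_of_nonneg_left hj3 ht0
      have h2 := mul_le_mul_of_nonneg_left hlow hs0
      nlinarith
    · have h1 := mul_le_mul_of_nonneg_left hupp hs0
      have h2 := mul_le_mul_of_nonneg_left hj2 ht0
      nlinarith
  obtain ⟨O, hO, hmax⟩ := exists_fits_max D.n D.w D.W (D.p t)
  have hO0 : 0 ≤ ∑ i ∈ O, D.p t i := by simpa using hmax ∅ (Fits.empty _ _ _)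
  have hTO := mul_le_mul_of_nonneg_left (hmax T hT) (by linarith : 0 ≤ (D.N : ℝ) - 4 * D.n)
  refine hTO.trans ?_
  set O' := O.filter fun i => 0 < D.p s i with hO'
  have hO'f : Fits D.n D.w D.W O' := hO.subset (filter_subset _ _)
  have hOO' : ∑ i ∈ O, D.p t i ≤ ∑ i ∈ O', D.p t i := by
    rw [← sum_filter_add_sum_filter_not O (fun i => 0 < D.p s i)]
    have : ∑ i ∈ O with ¬ 0 < D.p s i, D.p t i ≤ 0 := sum_nonpos fun i hi =>
      hneg i (mem_range.1 (hO.1 (mem_filter.1 hi).1)) (not_lt.1 (mem_filter.1 hi).2)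
    linarith
  have card_mul_eq : ∀ (X : Finset ℕ) (c : ℝ), X.card * c = ∑ _i ∈ X, c := by simp
  have hcard : ∀ X : Finset ℕ, X ⊆ range D.n → X.card * (P * P') ≤ D.n * (P * P') := by
    intro X hX
    have : (X.card : ℝ) ≤ D.n := by exact_mod_cast (card_le_card hX).trans (by simp)
    exact mul_le_mul_of_nonneg_right this (by positivity)
  -- Either the top item is a feasible solution by itself, or it does not fit and its profit has
  -- been set to 0.
  have hPO : P' ≤ ∑ i ∈ O, D.p t i := by
    rcases hA with ⟨rfl, rfl⟩ | ⟨i, hi, rfl, rfl⟩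
    · simpa [hP'] using hO0
    · by_cases hw : D.w i ≤ D.W
      · have := hmax {i} ⟨by simpa using hi, by simpa using hw⟩
        simpa [p] using this
      · have h1 := D.a_eq_zero i (by omega)
        have h2 := D.b_eq_zero i (by omega)
        simpa [hP', h1, h2] using hO0
  -- If P = 0, no item is profitable at s, hence none at t, and the empty solution is optimal.
  -- Otherwise P can be cancelled below.
  rcases hs0.eq_or_lt with h0 | h0
  · have hS0 : S = ∅ := by
      by_contra hne
      obtain ⟨i, hi⟩ := nonempty_iff_ne_empty.2 hne
      have := htops i (mem_range.1 (hSn hi))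
      have := hpos i hi
      linarith
    have hO'0 : ∑ i ∈ O, D.p t i ≤ 0 := sum_nonpos fun i hi => by
      have hin := mem_range.1 (hO.1 hi)
      exact hneg i hin (by rw [h0]; exact htops i hin)
    rw [hS0]
    simp only [sum_empty, mul_zero]
    exact mul_nonpos_of_nonneg_of_nonpos (by linarith) hO'0
  have e1 : D.N * P' * ∑ i ∈ S, D.p s i ≤ D.N * P * ∑ i ∈ S, D.p t i + D.n * (P * P') := by
    refine le_trans ?_ (add_le_add le_rfl (hcard S hSn))
    rw [mul_sum, mul_sum, card_mul_eq, ← sum_add_distrib]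
    exact sum_le_sum fun i hi => (hnear i (mem_range.1 (hSn hi)) (hpos i hi)).1
  have e2 : D.N * P * ∑ i ∈ O', D.p t i ≤ D.N * P' * ∑ i ∈ O', D.p s i + D.n * (P * P') := by
    refine le_trans ?_ (add_le_add le_rfl (hcard O' hO'f.1))
    rw [mul_sum, mul_sum, card_mul_eq, ← sum_add_distrib]
    exact sum_le_sum fun i hi => (hnear i (mem_range.1 (hO'f.1 hi)) (mem_filter.1 hi).2).2
  have e3 := mul_le_mul_of_nonneg_left (hS O' hO'f) ht0
  set x := ∑ i ∈ S, D.p t i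
  set xs := ∑ i ∈ S, D.p s i
  set y := ∑ i ∈ O', D.p t i
  set ys := ∑ i ∈ O', D.p s i
  set o := ∑ i ∈ O, D.p t i
  have e4 : ((D.N : ℝ) - 2 * D.n) * (D.N * P * y) ≤
      ((D.N : ℝ) - 2 * D.n) * (D.N * P' * ys + D.n * (P * P')) :=
    mul_le_mul_of_nonneg_left e2 (by linarith)
  -- Passing from O' at t to O' at s, then to S at s, then to S at t, costs n·P·P' on each of the
  -- two changes of parameter. Dividing by N·P leaves an error 2n·P', at most 2n times the optimum
  -- at t.
  have e5 : D.N * (P * (((D.N : ℝ) - 2 * D.n) * y)) ≤ D.N * (P * (D.N * x + 2 * D.n * P')) := by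
    have h1 := mul_le_mul_of_nonneg_left e3 hN.le
    have h2 := mul_le_mul_of_nonneg_left e1 hN.le
    have h3 : 0 ≤ (D.n : ℝ) * D.n * (P * P') := by positivity
    nlinarith
  have e6 := le_of_mul_le_mul_left (le_of_mul_le_mul_left e5 hN) h0
  have e7 := mul_le_mul_of_nonneg_left hOO' (by linarith : 0 ≤ (D.N : ℝ) - 2 * D.n)
  have e8 := mul_le_mul_of_nonneg_left hPO hn0
  nlinarith

end Cell

/-- `r` is a breakpoint of the largest line on the interval from `l` to `r`. -/
def IsEvent (D : Data) (l r : ℝ) : Prop :=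
  ∃ i < D.n, ∃ j ≤ D.N, ∃ A B, D.IsLine A B ∧ (∀ t, l ≤ t → t ≤ r → D.IsTop A B t) ∧
    D.Crosses A B i j r

theorem IsTop.le_of_isLine {A B A' B' : ℤ} {t : ℝ} (h : D.IsTop A B t) (h' : D.IsLine A' B') :
    A' + t * B' ≤ A + t * B := by
  rcases h' with ⟨rfl, rfl⟩ | ⟨i, hi, rfl, rfl⟩
  · simpa using h.1
  · exact h.2 i hi

/-- The profit of an item passes a level at most twice. -/
theorem count_events {k : ℕ} {c l : ℕ → ℝ} (hl : ∀ j < k, l j < c j)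
    (hlc : ∀ i j, i < j → j < k → c i ≤ l j) (hev : ∀ j < k, D.IsEvent (l j) (c j)) :
    k ≤ 2 * (D.n * (D.N + 1)) := by
  classical
  have hmono : ∀ i j, i < j → j < k → c i < c j := fun i j hij hj =>
    (hlc i j hij hj).trans_lt (hl j hj)
  choose! f hf g hg A B hline htop hcr using hev
  -- Every event is charged to its pair of item and level; it remains to see that no pair is charged
  -- three times.
  have hmaps : ∀ j ∈ range k, (f j, g j) ∈ range D.n ×ˢ range (D.N + 1) := by
    intro j hj
    have hj := mem_range.1 hj
    exact mem_product.2 ⟨mem_range.2 (hf j hj), mem_range.2 (Nat.lt_succ_of_le (hg j hj))⟩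
  have := card_le_mul_card_image_of_maps_to hmaps 2 ?_
  · simpa [mul_comm, mul_assoc, mul_left_comm] using this
  rintro ⟨i, q⟩ -
  by_contra! hcard
  have key : ∀ x y z, x < y → y < z → z < k → (f x, g x) = (i, q) → (f y, g y) = (i, q) →
      (f z, g z) = (i, q) → False := by
    intro x y z hxy hyz hz ex ey ez
    simp only [Prod.mk.injEq] at ex ey ez
    have hy : y < k := hyz.trans hz
    have hx : x < k := hxy.trans hy
    obtain ⟨-, cx⟩ := hcr x hx
    obtain ⟨sy, cy⟩ := hcr y hy
    obtain ⟨sz, cz⟩ := hcr z hz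
    rw [ex.1, ex.2] at cx
    rw [ey.1, ey.2] at cy sy
    rw [ez.1, ez.2] at cz sz
    have hq : (0 : ℝ) ≤ q := by positivity
    have txy := mul_le_mul_of_nonneg_left
      ((htop x hx (c x) (hl x hx).le le_rfl).le_of_isLine (hline y hy)) hq
    have txz := mul_le_mul_of_nonneg_left
      ((htop x hx (c x) (hl x hx).le le_rfl).le_of_isLine (hline z hz)) hq
    have tzy := mul_le_mul_of_nonneg_left
      ((htop z hz (l z) le_rfl (hl z hz).le).le_of_isLine (hline y hy)) hq
    have o1 := hmono x y hxy hy
    have o2 := hlc y z hyz hz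
    have o3 := hl z hz
    unfold p at cx cy cz
    -- Write f_y, f_z for N·p_i minus q times the top line before the event y, z. Both are
    -- nonnegative at c x, where the top line of x dominates, so both have negative slope. Then
    -- f_z(l z) ≤ f_y(l z) ≤ 0, although f_z decreases to 0 at c z > l z. This is the concavity of
    -- N·p_i − q·top.
    have bz : (D.N * D.b i - q * B z : ℝ) < 0 := by
      refine lt_of_le_of_ne ?_ sz
      by_contra! hh
      nlinarith
    have by' : (D.N * D.b i - q * B y : ℝ) < 0 := by
      refine lt_of_le_of_ne ?_ sy
      by_contra! hh
      nlinarith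
    nlinarith
  obtain ⟨x, hx, y, hy, z, hz, hxy, hxz, hyz⟩ := two_lt_card.1 hcard
  simp only [mem_filter, mem_range] at hx hy hz
  rcases lt_or_gt_of_ne hxy with h1 | h1 <;> rcases lt_or_gt_of_ne hxz with h2 | h2 <;>
    rcases lt_or_gt_of_ne hyz with h3 | h3
  · exact key x y z h1 h3 hz.1 hx.2 hy.2 hz.2
  · exact key x z y h2 h3 hy.1 hx.2 hz.2 hy.2
  · omega
  · exact key z x y h2 h1 hy.1 hz.2 hx.2 hy.2
  · exact key y x z h1 h2 hz.1 hy.2 hx.2 hz.2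
  · omega
  · exact key y z x h3 h2 hx.1 hy.2 hz.2 hx.2
  · exact key z y x h3 h1 hx.1 hz.2 hy.2 hx.2

end Data

/-! ## Sizes of numbers -/

/-- `x` is a fraction with numerator and denominator of absolute value at most `Z ^ k`. -/
def Small (Z k : ℕ) (x : ℝ) : Prop :=
  ∃ (p : ℤ) (q : ℕ), 0 < q ∧ |p| ≤ (Z : ℤ) ^ k ∧ q ≤ Z ^ k ∧ x = p / q

namespace Small

variable {Z k l : ℕ} {x y : ℝ}

theorem of_int (hZ : 1 ≤ Z) {z : ℤ} (h : |z| ≤ (Z : ℤ) ^ k) : Small Z k z :=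
  ⟨z, 1, one_pos, h, Nat.one_le_pow _ _ hZ, by simp⟩

theorem of_nat (hZ : 1 ≤ Z) {m : ℕ} (h : m ≤ Z ^ k) : Small Z k m := by
  have := of_int (k := k) hZ (z := (m : ℤ)) (by rw [Nat.abs_cast]; exact_mod_cast h)
  simpa using this

theorem mono (hZ : 1 ≤ Z) (h : Small Z k x) (hkl : k ≤ l) : Small Z l x := by
  obtain ⟨p, q, hq, hp, hq', rfl⟩ := h
  have h1 : Z ^ k ≤ Z ^ l := Nat.pow_le_pow_right hZ hkl
  exact ⟨p, q, hq, hp.trans (by exact_mod_cast h1), hq'.trans h1, rfl⟩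

theorem mul (hx : Small Z k x) (hy : Small Z l y) : Small Z (k + l) (x * y) := by
  obtain ⟨p, q, hq, hp, hq', rfl⟩ := hx
  obtain ⟨p', q', hr, hp', hr', rfl⟩ := hy
  refine ⟨p * p', q * q', Nat.mul_pos hq hr, ?_, ?_, ?_⟩
  · rw [abs_mul, pow_add]
    exact mul_le_mul hp hp' (abs_nonneg _) (by positivity)
  · rw [pow_add]
    exact Nat.mul_le_mul hq' hr'
  · push_cast
    rw [div_mul_div_comm]

theorem neg (hx : Small Z k x) : Small Z k (-x) := by
  obtain ⟨p, q, hq, hp, hq', rfl⟩ := hx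
  exact ⟨-p, q, hq, by rwa [abs_neg], hq', by push_cast; ring⟩

/-- The extra factor Z absorbs the 2 from the two cross products. -/
theorem add (hZ : 2 ≤ Z) (hx : Small Z k x) (hy : Small Z l y) :
    Small Z (k + l + 1) (x + y) := by
  obtain ⟨p, q, hq, hp, hq', rfl⟩ := hx
  obtain ⟨p', q', hr, hp', hr', rfl⟩ := hy
  have hZ' : (2 : ℤ) ≤ Z := by exact_mod_cast hZ
  have hq1 : (q : ℤ) ≤ (Z : ℤ) ^ k := by exact_mod_cast hq'
  have hr1 : (q' : ℤ) ≤ (Z : ℤ) ^ l := by exact_mod_cast hr'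
  refine ⟨p * q' + q * p', q * q', Nat.mul_pos hq hr, ?_, ?_, ?_⟩
  · have h1 : |p * q'| ≤ (Z : ℤ) ^ k * (Z : ℤ) ^ l := by
      rw [abs_mul, Nat.abs_cast]
      exact mul_le_mul hp hr1 (by positivity) (by positivity)
    have h2 : |q * p'| ≤ (Z : ℤ) ^ k * (Z : ℤ) ^ l := by
      rw [abs_mul, Nat.abs_cast]
      exact mul_le_mul hq1 hp' (abs_nonneg _) (by positivity)
    have h3 := abs_add_le (p * q') (q * p')
    have h4 : (0 : ℤ) ≤ (Z : ℤ) ^ k * (Z : ℤ) ^ l := by positivity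
    rw [pow_succ, pow_add]
    nlinarith
  · have h1 : q * q' ≤ Z ^ k * Z ^ l := Nat.mul_le_mul hq' hr'
    rw [pow_succ, pow_add]
    exact h1.trans (Nat.le_mul_of_pos_right _ (by omega))
  · have h1 : (q : ℝ) ≠ 0 := by exact_mod_cast hq.ne'
    have h2 : (q' : ℝ) ≠ 0 := by exact_mod_cast hr.ne'
    push_cast
    rw [div_add_div _ _ h1 h2]

theorem sub (hZ : 2 ≤ Z) (hx : Small Z k x) (hy : Small Z l y) :
    Small Z (k + l + 1) (x - y) := by
  rw [sub_eq_add_neg]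
  exact hx.add hZ hy.neg

/-- The sign of the denominator moves to the numerator; division by 0 yields 0. -/
theorem int_div (hZ : 1 ≤ Z) {x y : ℤ} (hx : |x| ≤ (Z : ℤ) ^ k) (hy : |y| ≤ (Z : ℤ) ^ k) :
    Small Z k (x / y) := by
  obtain ⟨m, hm⟩ := y.eq_nat_or_neg
  rcases Nat.eq_zero_or_pos m with rfl | hm0
  · obtain rfl : y = 0 := by simpa using hm
    have := of_nat (k := k) hZ (m := 0) (Nat.zero_le _)
    simpa using this
  have hmZ : m ≤ Z ^ k := by
    have : |y| = m := by rcases hm with rfl | rfl <;> simp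
    rw [this] at hy
    exact_mod_cast hy
  rcases hm with rfl | rfl
  · exact ⟨x, m, hm0, hx, hmZ, by push_cast; rfl⟩
  · refine ⟨-x, m, hm0, by rwa [abs_neg], hmZ, ?_⟩
    push_cast
    rw [div_neg, neg_div]

theorem inv (hZ : 1 ≤ Z) (hy : Small Z l y) : Small Z l y⁻¹ := by
  obtain ⟨p, q, hq, hp, hq', rfl⟩ := hy
  rw [inv_div]
  have := int_div hZ (x := q) (by rw [Nat.abs_cast]; exact_mod_cast hq') hp
  simpa using this

theorem div (hZ : 1 ≤ Z) (hx : Small Z k x) (hy : Small Z l y) : Small Z (k + l) (x / y) := by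
  rw [div_eq_mul_inv]
  exact hx.mul (hy.inv hZ)

end Small

/-- The integers in the data are bounded by `Z`. -/
structure Data.Sized (D : Data) (Z : ℕ) : Prop where
  three_le : 3 ≤ Z
  n_le : D.n ≤ Z
  N_lt : D.N < Z
  W_lt : D.W < Z
  a_le : ∀ i, |D.a i| ≤ Z
  b_le : ∀ i, |D.b i| ≤ Z
  w_le : ∀ i, D.w i ≤ Z
  bound_le : D.bound ≤ (Z : ℤ) ^ 4

namespace Data.Sized

variable {D : Data} {Z : ℕ}

theorem one_le (hZ : D.Sized Z) : 1 ≤ Z := by have := hZ.three_le; omega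

theorem two_le (hZ : D.Sized Z) : 2 ≤ Z := by have := hZ.three_le; omega

theorem small_a (hZ : D.Sized Z) (i : ℕ) : Small Z 1 (D.a i) :=
  .of_int hZ.one_le (by simpa using hZ.a_le i)

theorem small_b (hZ : D.Sized Z) (i : ℕ) : Small Z 1 (D.b i) :=
  .of_int hZ.one_le (by simpa using hZ.b_le i)

theorem small_w (hZ : D.Sized Z) (i : ℕ) : Small Z 1 (D.w i) :=
  .of_nat hZ.one_le (by simpa using hZ.w_le i)

theorem small_nat (hZ : D.Sized Z) {m : ℕ} (h : m ≤ Z) : Small Z 1 m :=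
  .of_nat hZ.one_le (by simpa using h)

theorem small_bound (hZ : D.Sized Z) : Small Z 4 D.bound :=
  .of_int hZ.one_le (by rw [abs_of_pos D.bound_pos]; exact hZ.bound_le)

theorem small_line (hZ : D.Sized Z) {A B : ℤ} (h : D.IsLine A B) :
    Small Z 1 A ∧ Small Z 1 B := by
  rcases h with ⟨rfl, rfl⟩ | ⟨i, -, rfl, rfl⟩
  · have := hZ.small_nat (Nat.zero_le Z)
    simpa using this
  · exact ⟨hZ.small_a i, hZ.small_b i⟩

/-- Treating a crossing as one quotient of integers, instead of composing the rules for the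
operations, keeps the exponent at 4, the same as for `bound`, at every step of the sweep. -/
theorem small_crosses (hZ : D.Sized Z) {A B : ℤ} (h : D.IsLine A B) {i j : ℕ} (hj : j ≤ D.N) :
    Small Z 4 ((j * A - D.N * D.a i) / (D.N * D.b i - j * B)) := by
  have hZ3 : (3 : ℤ) ≤ Z := by exact_mod_cast hZ.three_le
  have hAB : |A| ≤ Z ∧ |B| ≤ Z := by
    rcases h with ⟨rfl, rfl⟩ | ⟨i, -, rfl, rfl⟩
    · simp
    · exact ⟨hZ.a_le i, hZ.b_le i⟩
  have hN : (D.N : ℤ) ≤ Z := by exact_mod_cast hZ.N_lt.le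
  have hjZ : (j : ℤ) ≤ Z := by exact_mod_cast hj.trans hZ.N_lt.le
  have hmul : ∀ (m : ℕ) (x : ℤ), (m : ℤ) ≤ Z → |x| ≤ Z → |m * x| ≤ (Z : ℤ) * Z := by
    intro m x hm hx
    rw [abs_mul, Nat.abs_cast]
    exact mul_le_mul hm hx (abs_nonneg _) (by positivity)
  have hpow : (Z : ℤ) * Z + Z * Z ≤ (Z : ℤ) ^ 3 := by nlinarith
  have hnum : |(j : ℤ) * A - D.N * D.a i| ≤ (Z : ℤ) ^ 3 :=
    (abs_sub _ _).trans ((add_le_add (hmul _ _ hjZ hAB.1) (hmul _ _ hN (hZ.a_le i))).trans hpow)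
  have hden : |(D.N : ℤ) * D.b i - j * B| ≤ (Z : ℤ) ^ 3 :=
    (abs_sub _ _).trans ((add_le_add (hmul _ _ hN (hZ.b_le i)) (hmul _ _ hjZ hAB.2)).trans hpow)
  have := (Small.int_div hZ.one_le hnum hden).mono (l := 4) hZ.one_le (by norm_num)
  push_cast at this
  exact this

/-- All sums of profits at a parameter value have a small common denominator. -/
theorem small_sum (hZ : D.Sized Z) {s : ℝ} (hs : Small Z 10 s) {S : Finset ℕ}
    (hS : S ⊆ range D.n) : Small Z 13 (∑ i ∈ S, D.p s i) := by
  obtain ⟨x, q, hq, hx, hq', rfl⟩ := hs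
  have hZ3 : (3 : ℤ) ≤ Z := by exact_mod_cast hZ.three_le
  have hq0 : (q : ℝ) ≠ 0 := by exact_mod_cast hq.ne'
  have hqZ : (q : ℤ) ≤ (Z : ℤ) ^ 10 := by exact_mod_cast hq'
  have hp : ∀ i, |D.a i * q + x * D.b i| ≤ (Z : ℤ) ^ 12 := by
    intro i
    have h1 : |D.a i * q| ≤ (Z : ℤ) * (Z : ℤ) ^ 10 := by
      rw [abs_mul, Nat.abs_cast]
      exact mul_le_mul (hZ.a_le i) hqZ (by positivity) (by positivity)
    have h2 : |x * D.b i| ≤ (Z : ℤ) ^ 10 * Z := by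
      rw [abs_mul]
      exact mul_le_mul hx (hZ.b_le i) (abs_nonneg _) (by positivity)
    refine (abs_add_le _ _).trans ?_
    have h3 : (0 : ℤ) ≤ (Z : ℤ) ^ 10 * Z := by positivity
    have h4 : (Z : ℤ) ^ 12 = (Z : ℤ) ^ 10 * Z * Z := by ring
    rw [h4]
    nlinarith
  -- With s = x/q all profits have the denominator q. A numerator is at most 2·Z^11 ≤ Z^12, and at
  -- most Z of them are added.
  refine ⟨∑ i ∈ S, (D.a i * q + x * D.b i), q, hq, ?_,
    hq'.trans (Nat.pow_le_pow_right hZ.one_le (by norm_num)), ?_⟩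
  · have hc : (S.card : ℤ) ≤ Z := by
      exact_mod_cast ((card_le_card hS).trans (by simp)).trans hZ.n_le
    calc |∑ i ∈ S, (D.a i * q + x * D.b i)| ≤ ∑ i ∈ S, |D.a i * q + x * D.b i| :=
          abs_sum_le_sum_abs _ _
      _ ≤ ∑ _i ∈ S, (Z : ℤ) ^ 12 := sum_le_sum fun i _ => hp i
      _ = S.card * (Z : ℤ) ^ 12 := by simp
      _ ≤ Z * (Z : ℤ) ^ 12 := mul_le_mul_of_nonneg_right hc (by positivity)
      _ = (Z : ℤ) ^ 13 := by ring
  · push_cast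
    rw [sum_div]
    refine sum_congr rfl fun i _ => ?_
    unfold Data.p
    field_simp

end Data.Sized

/-! ## The program: preprocessed memory -/

/-- The memory contains the preprocessed data. -/
structure Ready (D : Data) (σ : Mem) : Prop where
  n : σ.idx 0 0 0 = D.n
  N : σ.idx 3 0 0 = D.N
  w : ∀ i < D.n, σ.num 2 i 0 = D.w i
  W : σ.num 3 0 0 = D.W
  a : ∀ i < D.n, σ.num 6 i 0 = D.a i
  b : ∀ i < D.n, σ.num 7 i 0 = D.b i
  bound : σ.num 12 0 0 = D.bound

/-- The program does not write to the tables with the preprocessed data. -/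
def Prog.keeps (p : Prog) : Bool :=
  !p.writesI 0 && !p.writesI 3 && !p.writesN 2 && !p.writesN 3 && !p.writesN 6 && !p.writesN 7 &&
    !p.writesN 12

theorem Ready.of_agree {D : Data} {σ τ : Mem} {p : Prog} (h : Ready D σ) (hp : p.Agree σ τ)
    (hk : p.keeps = true) : Ready D τ := by
  simp only [Prog.keeps, Bool.and_eq_true, Bool.not_eq_true'] at hk
  obtain ⟨⟨⟨⟨⟨⟨h0, h3⟩, n2⟩, n3⟩, n6⟩, n7⟩, n12⟩ := hk
  obtain ⟨hI, hN⟩ := hp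
  constructor
  · rw [hI 0 h0]; exact h.n
  · rw [hI 3 h3]; exact h.N
  · rw [hN 2 n2]; exact h.w
  · rw [hN 3 n3]; exact h.W
  · rw [hN 6 n6]; exact h.a
  · rw [hN 7 n7]; exact h.b
  · rw [hN 12 n12]; exact h.bound

/-- Disjunction of tests. -/
abbrev Test.or (b c : Test) : Test := .not (.and (.not b) (.not c))

/-- Find the line that is the largest one immediately to the right of the current breakpoint. -/
def progLine : Prog :=
  .seq (.letN 10 (.const 0)) <|
  .seq (.letN 11 (.const 0)) <|
  .for 4 (ivar 0) <|
    .ite (.or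
        (.numLt (.add (nvar 10) (.mul (nvar 8) (nvar 11)))
          (.add (narr 6 (ivar 4)) (.mul (nvar 8) (narr 7 (ivar 4)))))
        (.and
          (.not (.numLt (.add (narr 6 (ivar 4)) (.mul (nvar 8) (narr 7 (ivar 4))))
            (.add (nvar 10) (.mul (nvar 8) (nvar 11)))))
          (.numLt (nvar 11) (narr 7 (ivar 4)))))
      (.seq (.letN 10 (narr 6 (ivar 4))) (.letN 11 (narr 7 (ivar 4))))
      .skip

/-- Find the next breakpoint. -/
def progNext : Prog :=
  .seq (.letN 9 (nvar 12)) <|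
  .for 4 (ivar 0) <|
  .for 5 (.succ (ivar 3)) <|
    .ite (.numLt (.const 0)
        (.mul
          (.sub (.mul (.ofIdx (ivar 3)) (narr 7 (ivar 4))) (.mul (.ofIdx (ivar 5)) (nvar 11)))
          (.sub (.mul (.ofIdx (ivar 3)) (narr 7 (ivar 4))) (.mul (.ofIdx (ivar 5)) (nvar 11)))))
      (.seq
        (.letN 20 (.div
          (.sub (.mul (.ofIdx (ivar 5)) (nvar 10)) (.mul (.ofIdx (ivar 3)) (narr 6 (ivar 4))))
          (.sub (.mul (.ofIdx (ivar 3)) (narr 7 (ivar 4))) (.mul (.ofIdx (ivar 5)) (nvar 11)))))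
        (.ite (.and (.numLt (nvar 8) (nvar 20)) (.numLt (nvar 20) (nvar 9)))
          (.letN 9 (nvar 20)) .skip))
      .skip

/-! ### Correctness of the search for the top line and the next breakpoint -/

section Specs

variable {D : Data} {Z : ℕ} {Q : ℝ → Prop} {σ : Mem}

/-- Immediately to the right of l, lines are ordered lexicographically by value at l and slope; the
loop keeps the maximum of the zero line and the items seen so far. -/
theorem run_progLine (hZ : D.Sized Z) (hQ : ∀ y, Small Z 20 y → Q y) (hσ : Ready D σ)
    (hl : Small Z 4 (σ.num 8 0 0)) :
    Run Q progLine σ (D.n * 120 + 100) (fun τ => ∃ A B : ℤ, τ.num 10 0 0 = A ∧ τ.num 11 0 0 = B ∧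
      D.IsLine A B ∧ D.IsGerm A B (σ.num 8 0 0)) := by
  have h1 := hZ.one_le
  have h2 := hZ.two_le
  have hQ' : ∀ {k : ℕ} {y : ℝ}, Small Z k y → k ≤ 20 → Q y := fun h hk => hQ _ (h.mono h1 hk)
  have hQ0 : Q 0 := by simpa using hQ' (hZ.small_nat (Nat.zero_le Z)) (by norm_num)
  set l := σ.num 8 0 0 with hl_def
  refine Run.seq_setN (c₂ := D.n * 120 + 90) (by simp [IExp.cost, NExp.cost]; omega)
    (by simpa [NExp.Ok] using hQ0) ?_
  refine Run.seq_setN (c₂ := D.n * 120 + 80) (by simp [IExp.cost, NExp.cost]; omega)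
    (by simpa [NExp.Ok] using hQ0) ?_
  refine (Run.for (c := 100) (fun k τ => ∃ A B : ℤ, τ.num 10 0 0 = A ∧ τ.num 11 0 0 = B ∧
      D.IsLine A B ∧ (0 < A + l * B ∨ 0 = A + l * B ∧ 0 ≤ B) ∧
      ∀ i < k, D.p l i < A + l * B ∨ D.p l i = A + l * B ∧ D.b i ≤ B) D.n (by simp [IExp.cost]) rfl
      ?_ ?_ ?_ ?_).mono (by omega) ?_
  · intro τ hA
    have := hA.1 0 rfl
    simp only [IExp.eval, this]
    exact hσ.n
  · intro k τ y h; exact h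
  · refine ⟨0, 0, ?_, ?_, .inl ⟨rfl, rfl⟩, .inr (by simp), by simp⟩ <;>
      simp [NExp.eval, IExp.eval]
  · rintro k τ hk hA hτk ⟨A, B, hA', hB', hline, hg0, hg⟩
    have hτl : τ.num 8 0 0 = l := by rw [hA.2 8 rfl]; simp [hl_def, IExp.eval]
    have hτa : τ.num 6 k 0 = D.a k := by
      rw [hA.2 6 rfl]; simpa [IExp.eval] using hσ.a k hk
    have hτb : τ.num 7 k 0 = D.b k := by
      rw [hA.2 7 rfl]; simpa [IExp.eval] using hσ.b k hk
    obtain ⟨sA, sB⟩ := hZ.small_line hline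
    have q1 := hQ' (hl.mul sB) (by norm_num)
    have q2 := hQ' (sA.add h2 (hl.mul sB)) (by norm_num)
    have q3 := hQ' (hl.mul (hZ.small_b k)) (by norm_num)
    have q4 := hQ' ((hZ.small_a k).add h2 (hl.mul (hZ.small_b k))) (by norm_num)
    refine Run.ite (c₁ := 20) (by simp [Test.cost, NExp.cost, IExp.cost]) ?_ ?_ ?_
    · simp [Test.Ok, NExp.Ok, NExp.eval, IExp.eval, hτk, hτl, hτa, hτb, hA', hB', q1, q2, q3, q4]
    · intro hb
      simp only [Test.Holds, NExp.eval, IExp.eval, hτk, hτl, hτa, hτb, hA', hB'] at hb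
      refine Run.seq_setN (c₂ := 10) (by simp [IExp.cost, NExp.cost]) trivial ?_
      refine Run.setN (by simp [IExp.cost, NExp.cost]) trivial ?_
      -- Disjunction is coded by negation and conjunction, so the lexicographic comparison has to be
      -- decoded.
      have hb' : A + l * B < D.p l k ∨ A + l * B = D.p l k ∧ B ≤ D.b k := by
        unfold Data.p
        by_cases h : (A + l * B : ℝ) < D.a k + l * D.b k
        · exact .inl h
        · right
          by_contra hcon
          apply hb
          refine ⟨h, fun h' => hcon ⟨le_antisymm (not_lt.1 h'.1) (not_lt.1 h), ?_⟩⟩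
          exact_mod_cast h'.2.le
      refine ⟨D.a k, D.b k, by simp [NExp.eval, IExp.eval, hτk, hτa],
        by simp [NExp.eval, IExp.eval, hτk, hτb], .inr ⟨k, hk, rfl, rfl⟩, ?_, ?_⟩
      · change 0 < D.p l k ∨ 0 = D.p l k ∧ 0 ≤ D.b k
        rcases hb' with h | ⟨h, h'⟩ <;> rcases hg0 with g | ⟨g, g'⟩
        · left; linarith
        · left; linarith
        · left; linarith
        · right; exact ⟨by linarith, by omega⟩
      · intro i hi
        change D.p l i < D.p l k ∨ D.p l i = D.p l k ∧ D.b i ≤ D.b k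
        rcases Nat.lt_succ_iff_lt_or_eq.1 hi with hi | rfl
        · rcases hb' with h | ⟨h, h'⟩ <;> rcases hg i hi with g | ⟨g, g'⟩
          · left; linarith
          · left; linarith
          · left; linarith
          · right; exact ⟨by linarith, by omega⟩
        · exact .inr ⟨rfl, le_rfl⟩
    · intro hb
      simp only [Test.Holds, NExp.eval, IExp.eval, hτk, hτl, hτa, hτb, hA', hB', not_not] at hb
      refine Run.skip (by norm_num) ⟨A, B, hA', hB', hline, hg0, fun i hi => ?_⟩
      rcases Nat.lt_succ_iff_lt_or_eq.1 hi with hi | rfl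
      · exact hg i hi
      · unfold Data.p
        obtain ⟨b1, b2⟩ := hb
        rcases (not_lt.1 b1).lt_or_eq with h | h
        · exact .inl h
        · refine .inr ⟨h, ?_⟩
          by_contra! hcon
          exact b2 ⟨by rw [h]; exact lt_irrefl _, by exact_mod_cast hcon⟩
  · rintro τ - ⟨A, B, hA', hB', hline, hg0, hg⟩
    exact ⟨A, B, hA', hB', hline, hg0, hg⟩

/-- The smallest breakpoint greater than `l` among those that have been examined. -/
def NextInv (D : Data) (Z : ℕ) (A B : ℤ) (l : ℝ) (done : ℕ → ℕ → Prop) (r : ℝ) : Prop :=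
  l < r ∧ r ≤ D.bound ∧ Small Z 4 r ∧
  (r = D.bound ∨ ∃ i < D.n, ∃ j ≤ D.N, D.Crosses A B i j r) ∧
  ∀ i j, done i j → ∀ ρ, l < ρ → ρ < r → ¬ D.Crosses A B i j ρ

/-- A running minimum over all pairs (item, level) of their crossings beyond l, starting from
`bound`. -/
theorem run_progNext (hZ : D.Sized Z) (hQ : ∀ y, Small Z 20 y → Q y) (hσ : Ready D σ)
    {A B : ℤ} (hA : σ.num 10 0 0 = A) (hB : σ.num 11 0 0 = B) (hline : D.IsLine A B)
    (hlb : σ.num 8 0 0 < D.bound) :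
    Run Q progNext σ (D.n * ((D.N + 1) * 150 + 100) + 100) (fun τ =>
      NextInv D Z A B (σ.num 8 0 0) (fun i j => i < D.n ∧ j ≤ D.N) (τ.num 9 0 0)) := by
  have h1 := hZ.one_le
  have h2 := hZ.two_le
  have hQ' : ∀ {k : ℕ} {y : ℝ}, Small Z k y → k ≤ 20 → Q y := fun h hk => hQ _ (h.mono h1 hk)
  have hQ0 : Q 0 := by simpa using hQ' (hZ.small_nat (Nat.zero_le Z)) (by norm_num)
  set l := σ.num 8 0 0 with hl_def
  refine Run.seq_setN (c₂ := D.n * ((D.N + 1) * 150 + 100) + 90)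
    (by simp [IExp.cost, NExp.cost]; omega) trivial ?_
  refine (Run.for (c := (D.N + 1) * 150 + 80)
      (fun k τ => NextInv D Z A B l (fun i j => i < k ∧ j ≤ D.N) (τ.num 9 0 0))
      D.n (by simp [IExp.cost]) rfl ?_ ?_ ?_ ?_).mono ?_ (fun τ _ h => h)
  · intro τ hA
    have := hA.1 0 rfl
    simp only [IExp.eval, this]
    exact hσ.n
  · intro k τ y h; exact h
  · have : (σ.setN 9 (IExp.eval σ (.const 0)) (IExp.eval σ (.const 0)) (NExp.eval σ (nvar 12))).num
        9 0 0 = D.bound := by simp [IExp.eval, NExp.eval, hσ.bound]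
    rw [this]
    exact ⟨hlb, le_rfl, hZ.small_bound, .inl rfl, by simp⟩
  · intro k τ hk hAg hτk hI
    refine (Run.for (c := 130)
        (fun m υ => NextInv D Z A B l (fun i j => i < k ∧ j ≤ D.N ∨ i = k ∧ j < m) (υ.num 9 0 0))
        (D.N + 1) (by simp [IExp.cost]) rfl ?_ ?_ ?_ ?_).mono (by omega) ?_
    · intro υ hυ
      have e1 := hυ.1 3 rfl
      have e2 := hAg.1 3 rfl
      simp only [IExp.eval, e1, e2]
      exact congrArg (· + 1) hσ.N
    · intro m υ y h; exact h
    · simpa using hI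
    · intro m υ hm hυ hυm hI
      have hmN : m ≤ D.N := by omega
      have hυk : υ.idx 4 0 0 = k := by rw [hυ.1 4 rfl, hτk]
      have eN : υ.idx 3 0 0 = D.N := by rw [hυ.1 3 rfl, hAg.1 3 rfl]; exact hσ.N
      have ea : υ.num 6 k 0 = D.a k := by
        rw [hυ.2 6 rfl, hAg.2 6 rfl]; simpa [IExp.eval] using hσ.a k hk
      have eb : υ.num 7 k 0 = D.b k := by
        rw [hυ.2 7 rfl, hAg.2 7 rfl]; simpa [IExp.eval] using hσ.b k hk
      have el : υ.num 8 0 0 = l := by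
        rw [hυ.2 8 rfl, hAg.2 8 rfl]; simp [IExp.eval, hl_def]
      have eA : υ.num 10 0 0 = A := by
        rw [hυ.2 10 rfl, hAg.2 10 rfl]; simpa [IExp.eval] using hA
      have eB : υ.num 11 0 0 = B := by
        rw [hυ.2 11 rfl, hAg.2 11 rfl]; simpa [IExp.eval] using hB
      obtain ⟨sA, sB⟩ := hZ.small_line hline
      have sN := hZ.small_nat hZ.N_lt.le
      have sm := hZ.small_nat (hmN.trans hZ.N_lt.le)
      have d1 := sN.mul (hZ.small_b k)
      have d2 := sm.mul sB
      have d3 := d1.sub h2 d2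
      have u1 := sN.mul (hZ.small_a k)
      have u2 := sm.mul sA
      have u3 := u2.sub h2 u1
      have hcand := hZ.small_crosses (i := k) hline hmN
      set d : ℝ := D.N * D.b k - m * B with hd
      obtain ⟨i1, i2, i3, i4, i5⟩ := hI
      set r := υ.num 9 0 0 with hr
      refine Run.ite (c₁ := 75) (by simp [Test.cost, NExp.cost, IExp.cost]) ?_ ?_ ?_
      · simp only [Test.Ok, NExp.Ok, NExp.eval, IExp.eval, hυk, hυm, eN, eb, eB, Int.cast_zero,
          true_and]
        exact ⟨hQ0, ⟨⟨hQ' sN (by norm_num), hQ' d1 (by norm_num)⟩,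
          ⟨hQ' sm (by norm_num), hQ' d2 (by norm_num)⟩, hQ' d3 (by norm_num)⟩,
          ⟨⟨hQ' sN (by norm_num), hQ' d1 (by norm_num)⟩,
          ⟨hQ' sm (by norm_num), hQ' d2 (by norm_num)⟩, hQ' d3 (by norm_num)⟩,
          hQ' (d3.mul d3) (by norm_num)⟩
      · intro hb
        simp only [Test.Holds, NExp.eval, IExp.eval, hυk, hυm, eN, eb, eB, Int.cast_zero] at hb
        -- The test asks whether the square of the denominator is positive, because < is the only
        -- comparison of numbers.
        have hd0 : d ≠ 0 := fun h => by
          rw [← hd, h] at hb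
          simp at hb
        refine Run.seq_setN (c₂ := 28) (by simp [IExp.cost, NExp.cost]) ?_ ?_
        · simp only [NExp.Ok, NExp.eval, IExp.eval, hυk, hυm, eN, ea, eb, eA, eB,
            true_and]
          exact ⟨⟨⟨hQ' sm (by norm_num), hQ' u2 (by norm_num)⟩,
            ⟨hQ' sN (by norm_num), hQ' u1 (by norm_num)⟩, hQ' u3 (by norm_num)⟩,
            ⟨⟨hQ' sN (by norm_num), hQ' d1 (by norm_num)⟩,
            ⟨hQ' sm (by norm_num), hQ' d2 (by norm_num)⟩, hQ' d3 (by norm_num)⟩, hd0,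
            hQ' hcand (by norm_num)⟩
        · set x : ℝ := (m * A - D.N * D.a k) / d with hx
          have hxc : D.Crosses A B k m x := by
            refine ⟨hd0, ?_⟩
            have : x * d = m * A - D.N * D.a k := div_mul_cancel₀ _ hd0
            unfold Data.p
            rw [hd] at this
            linarith
          have heval : NExp.eval υ (.div
              (.sub (.mul (.ofIdx (ivar 5)) (nvar 10)) (.mul (.ofIdx (ivar 3)) (narr 6 (ivar 4))))
              (.sub (.mul (.ofIdx (ivar 3)) (narr 7 (ivar 4)))
                (.mul (.ofIdx (ivar 5)) (nvar 11)))) = x := by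
            simp only [NExp.eval, IExp.eval, hυk, hυm, eN, ea, eb, eA, eB]
            rfl
          rw [heval]
          simp only [IExp.eval]
          refine Run.ite (c₁ := 10) (by simp [Test.cost, NExp.cost, IExp.cost])
            (by simp [Test.Ok, NExp.Ok]) ?_ ?_
          · intro hb
            simp [Test.Holds, NExp.eval, IExp.eval, el] at hb
            refine Run.setN (by simp [IExp.cost, NExp.cost]) trivial ?_
            simp only [NExp.eval, IExp.eval, Mem.setN_num, and_self, ↓reduceIte]
            refine ⟨hb.1, hb.2.le.trans i2, hcand, .inr ⟨k, hk, m, hmN, hxc⟩, ?_⟩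
            rintro i j (hij | ⟨rfl, hj⟩) ρ hρ1 hρ2 hc
            · exact i5 i j (.inl hij) ρ hρ1 (hρ2.trans hb.2) hc
            · rcases Nat.lt_succ_iff_lt_or_eq.1 hj with hj | rfl
              · exact i5 i j (.inr ⟨rfl, hj⟩) ρ hρ1 (hρ2.trans hb.2) hc
              -- A pair crosses at one point only, which is the new r.
              · rw [hc.eq_div] at hρ2
                exact lt_irrefl _ hρ2
          · intro hb
            simp [Test.Holds, NExp.eval, IExp.eval, el] at hb
            refine Run.skip (by norm_num) ?_
            simp only [Mem.setN_num, Nat.reduceEqDiff, false_and, ↓reduceIte]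
            refine ⟨i1, i2, i3, i4, ?_⟩
            rintro i j (hij | ⟨rfl, hj⟩) ρ hρ1 hρ2 hc
            · exact i5 i j (.inl hij) ρ hρ1 hρ2 hc
            · rcases Nat.lt_succ_iff_lt_or_eq.1 hj with hj | rfl
              · exact i5 i j (.inr ⟨rfl, hj⟩) ρ hρ1 hρ2 hc
              · have hρx : ρ = x := hc.eq_div
                rw [hρx] at hρ1 hρ2
                exact absurd (hb hρ1) (not_le.2 hρ2)
      · intro hb
        simp only [Test.Holds, NExp.eval, IExp.eval, hυk, hυm, eN, eb, eB, Int.cast_zero,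
          not_lt] at hb
        refine Run.skip (by norm_num) ⟨i1, i2, i3, i4, ?_⟩
        rintro i j (hij | ⟨rfl, hj⟩) ρ hρ1 hρ2 hc
        · exact i5 i j (.inl hij) ρ hρ1 hρ2 hc
        · rcases Nat.lt_succ_iff_lt_or_eq.1 hj with hj | rfl
          · exact i5 i j (.inr ⟨rfl, hj⟩) ρ hρ1 hρ2 hc
          · have hc1 : d ≠ 0 := hc.1
            have : 0 < d * d := mul_self_pos.2 hc1
            rw [← hd] at hb
            linarith
    · rintro υ - ⟨i1, i2, i3, i4, i5⟩
      refine ⟨i1, i2, i3, i4, fun i j hij => i5 i j ?_⟩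
      omega
  · have : D.n * ((D.N + 1) * 150 + 80 + 16) ≤ D.n * ((D.N + 1) * 150 + 100) :=
      Nat.mul_le_mul_left _ (by omega)
    exact Nat.add_le_add this (by norm_num)

end Specs

/-! ## The program: profits and the greedy bound -/

/-- Compute the profits at the midpoint of the current interval. -/
def progProfits : Prog :=
  .seq (.letN 13 (.div (.add (nvar 8) (nvar 9)) (.const 2))) <|
  .for 4 (ivar 0) <|
    .seq (.setNum 14 (ivar 4) (.const 0)
      (.add (narr 6 (ivar 4)) (.mul (nvar 13) (narr 7 (ivar 4)))))
    (.setIdx 9 (ivar 4) (.const 0) (.const 0))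

/-- Find an unused item of largest density. -/
def progBest : Prog :=
  .for 4 (ivar 0) <|
    .ite (.and (.idxLt (.read 9 (ivar 4) (.const 0)) (.const 1))
        (.numLt (.mul (nvar 18) (narr 2 (ivar 4))) (.mul (narr 14 (ivar 4)) (nvar 19))))
      (.seq (.letI 10 (ivar 4)) <|
        .seq (.letN 18 (narr 14 (ivar 4))) (.letN 19 (narr 2 (ivar 4))))
      .skip

/-- One round of the greedy algorithm. -/
def progRound : Prog :=
  .seq (.letI 10 (ivar 0)) <|
  .seq (.letN 18 (.const 0)) <|
  .seq (.letN 19 (.const 1)) <|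
  .seq progBest <|
    .ite (.idxLt (ivar 10) (ivar 0))
      (.seq (.setIdx 9 (ivar 10) (.const 0) (.const 1)) <|
        .seq (.letN 15 (.add (nvar 15) (nvar 18)))
          (.letN 16 (.add (nvar 16) (nvar 19))))
      .skip

/-- Compute an upper bound for the optimal profit that is at most twice the optimal profit. -/
def progGreedy : Prog :=
  .seq (.letN 15 (.const 0)) <|
  .seq (.letN 16 (.const 0)) <|
  .for 11 (ivar 0) <|
    .ite (.numLt (nvar 3) (nvar 16)) .skip progRound

/-- A set of items of positive profit that is closed under taking items of larger density, and that
fits into the knapsack apart from one item. -/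
structure GreedySet (D : Data) (p : ℕ → ℝ) (G : Finset ℕ) : Prop where
  subset : G ⊆ range D.n
  pos : ∀ i ∈ G, 0 < p i
  dens : ∀ i ∈ G, ∀ j < D.n, j ∉ G → p j * D.w i ≤ p i * D.w j
  split : ∑ i ∈ G, D.w i ≤ D.W ∨ ∃ m ∈ G, ∑ i ∈ G.erase m, D.w i ≤ D.W

theorem GreedySet.empty (D : Data) (p : ℕ → ℝ) : GreedySet D p ∅ :=
  ⟨by simp, by simp, by simp, by simp⟩

theorem GreedySet.insert {D : Data} {p : ℕ → ℝ} {G : Finset ℕ} {m : ℕ} (h : GreedySet D p G)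
    (hm : m < D.n) (hmG : m ∉ G) (hp : 0 < p m)
    (hbest : ∀ j < D.n, j ∉ G → p j * D.w m ≤ p m * D.w j) (hW : ∑ i ∈ G, D.w i ≤ D.W) :
    GreedySet D p (insert m G) := by
  refine ⟨?_, ?_, ?_, .inr ⟨m, mem_insert_self _ _, by rwa [erase_insert hmG]⟩⟩
  · intro i hi
    rcases mem_insert.1 hi with rfl | hi
    · exact mem_range.2 hm
    · exact h.subset hi
  · intro i hi
    rcases mem_insert.1 hi with rfl | hi
    · exact hp
    · exact h.pos i hi
  · intro i hi j hj hjG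
    have hjG' : j ∉ G := fun h => hjG (mem_insert_of_mem h)
    rcases mem_insert.1 hi with rfl | hi
    · exact hbest j hj hjG'
    · exact h.dens i hi j hj hjG'

/-- The upper bound is the exchange argument. For the other half, removing the last item leaves a
feasible set, and that item alone is feasible too. -/
theorem GreedySet.bounds {D : Data} {p : ℕ → ℝ} {G : Finset ℕ} (h : GreedySet D p G)
    (hclean : ∀ i, D.W < D.w i → p i ≤ 0)
    (hdone : G.card = D.n ∨ D.W < ∑ i ∈ G, D.w i ∨ ∀ j < D.n, j ∉ G → p j ≤ 0) :
    (∀ T, Fits D.n D.w D.W T → ∑ i ∈ T, p i ≤ ∑ i ∈ G, p i) ∧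
    ∃ S₁ S₂, Fits D.n D.w D.W S₁ ∧ Fits D.n D.w D.W S₂ ∧
      ∑ i ∈ G, p i = ∑ i ∈ S₁, p i + ∑ i ∈ S₂, p i := by
  constructor
  · intro T hT
    refine sum_le_sum_greedy h.pos h.dens ?_ hT
    rcases hdone with hc | hc
    · right
      have : G = range D.n := eq_of_subset_of_card_le h.subset (by simp [hc])
      intro j hj hjG
      exact absurd (this ▸ mem_range.2 hj) hjG
    · exact hc
  · rcases h.split with hs | ⟨m, hm, hs⟩
    · exact ⟨G, ∅, ⟨h.subset, hs⟩, Fits.empty _ _ _, by simp⟩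
    · refine ⟨G.erase m, {m}, ⟨(erase_subset _ _).trans h.subset, hs⟩,
        ⟨by simpa using h.subset hm, ?_⟩, ?_⟩
      -- An item that does not fit has no positive profit, so it cannot be in the greedy set.
      · by_contra hcon
        have := hclean m (by simpa using hcon)
        exact absurd (h.pos m hm) (not_lt.2 this)
      · rw [sum_singleton, sum_erase_add _ _ hm]

/-! ### Correctness of the greedy bound -/

section Specs

variable {D : Data} {Z : ℕ} {Q : ℝ → Prop} {σ : Mem} {s : ℝ}

theorem run_progProfits (hZ : D.Sized Z) (hQ : ∀ y, Small Z 20 y → Q y) (hσ : Ready D σ)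
    (hl : Small Z 4 (σ.num 8 0 0)) (hr : Small Z 4 (σ.num 9 0 0)) :
    Run Q progProfits σ (D.n * 100 + 100) (fun τ =>
      Small Z 10 ((σ.num 8 0 0 + σ.num 9 0 0) / 2) ∧
      ∀ i < D.n, τ.num 14 i 0 = D.p ((σ.num 8 0 0 + σ.num 9 0 0) / 2) i ∧ τ.idx 9 i 0 = 0) := by
  have h1 := hZ.one_le
  have h2 := hZ.two_le
  have hQ' : ∀ {k : ℕ} {y : ℝ}, Small Z k y → k ≤ 20 → Q y := fun h hk => hQ _ (h.mono h1 hk)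
  have s2 := hZ.small_nat h2
  push_cast at s2
  have slr := hl.add h2 hr
  -- Exponents: 4 + 4 + 1 for the sum and one more for halving, which is the 10 in `small_sum`.
  have ss := slr.div h1 s2
  set s := (σ.num 8 0 0 + σ.num 9 0 0) / 2 with hs
  refine Run.seq_setN (c₂ := D.n * 100 + 60) (by simp [IExp.cost, NExp.cost]; omega) ?_ ?_
  · simp only [NExp.Ok, NExp.eval, IExp.eval, true_and]
    exact ⟨hQ' slr (by norm_num), hQ' (by simpa using s2) (by norm_num), by norm_num,
      hQ' (by simpa using ss) (by norm_num)⟩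
  refine (Run.for (c := 60) (fun k τ => ∀ i < k, τ.num 14 i 0 = D.p s i ∧ τ.idx 9 i 0 = 0) D.n
    (by simp [IExp.cost]) rfl ?_ ?_ ?_ ?_).mono (by omega) (fun τ _ h => ⟨ss, h⟩)
  · intro τ hA
    have := hA.1 0 rfl
    simp only [IExp.eval, this]
    exact hσ.n
  · intro k τ y h; exact h
  · simp
  · intro k τ hk hA hτk hI
    have es : τ.num 13 0 0 = s := by rw [hA.2 13 rfl]; simp [IExp.eval, NExp.eval, hs]
    have ea : τ.num 6 k 0 = D.a k := by
      rw [hA.2 6 rfl]; simpa [IExp.eval] using hσ.a k hk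
    have eb : τ.num 7 k 0 = D.b k := by
      rw [hA.2 7 rfl]; simpa [IExp.eval] using hσ.b k hk
    have q1 := ss.mul (hZ.small_b k)
    have q2 := (hZ.small_a k).add h2 q1
    refine Run.seq_setN (c₂ := 15) (by simp [IExp.cost, NExp.cost]) ?_ ?_
    · simp only [NExp.Ok, NExp.eval, IExp.eval, true_and, hτk, es, ea, eb]
      exact ⟨hQ' q1 (by norm_num), hQ' q2 (by norm_num)⟩
    · refine Run.setI (by simp [IExp.cost]) ?_
      intro i hi
      simp only [NExp.eval, IExp.eval, Mem.setI_num, Mem.setI_idx, Mem.setN_num, Mem.setN_idx, hτk,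
        es, ea, eb, true_and, and_true]
      by_cases hik : i = k
      · simp [hik, Data.p]
      · simp only [hik, ↓reduceIte]
        exact hI i (by omega)

/-- The state of the search for an unused item of largest density. -/
def BestInv (D : Data) (p : ℕ → ℝ) (G : Finset ℕ) (k m : ℕ) (x y : ℝ) : Prop :=
  (m = D.n ∧ x = 0 ∧ y = 1 ∧ ∀ j < k, j ∉ G → p j ≤ 0) ∨
  (m < D.n ∧ m ∉ G ∧ 0 < p m ∧ x = p m ∧ y = D.w m ∧
    ∀ j < k, j ∉ G → p j * D.w m ≤ p m * D.w j)

/-- The initial values 0 and 1 act as a fictitious item of density 0, so both cases give one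
comparison and only items of positive profit can win. -/
theorem BestInv.sign {p : ℕ → ℝ} {G : Finset ℕ} {k m : ℕ} {x y : ℝ}
    (h : BestInv D p G k m x y) : 0 ≤ x ∧ 0 < y ∧ ∀ j < k, j ∉ G → p j * y ≤ x * D.w j := by
  rcases h with ⟨-, rfl, rfl, h⟩ | ⟨-, -, h1, rfl, rfl, h2⟩
  · exact ⟨le_rfl, one_pos, by simpa using h⟩
  · exact ⟨h1.le, by exact_mod_cast D.w_pos m, h2⟩

theorem run_progBest (hZ : D.Sized Z) (hQ : ∀ y, Small Z 20 y → Q y) (hσ : Ready D σ)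
    {p : ℕ → ℝ} (hp : ∀ i < D.n, Small Z 13 (p i)) {G : Finset ℕ}
    (hσp : ∀ i < D.n, σ.num 14 i 0 = p i)
    (hσG : ∀ i < D.n, σ.idx 9 i 0 = if i ∈ G then 1 else 0)
    (hm : σ.idx 10 0 0 = D.n) (hx : σ.num 18 0 0 = 0) (hy : σ.num 19 0 0 = 1) :
    Run Q progBest σ (D.n * 100 + 16) (fun τ =>
      BestInv D p G D.n (τ.idx 10 0 0) (τ.num 18 0 0) (τ.num 19 0 0)) := by
  have h1 := hZ.one_le
  have h2 := hZ.two_le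
  have hQ' : ∀ {k : ℕ} {y : ℝ}, Small Z k y → k ≤ 20 → Q y := fun h hk => hQ _ (h.mono h1 hk)
  refine (Run.for (c := 84)
    (fun k τ => BestInv D p G k (τ.idx 10 0 0) (τ.num 18 0 0) (τ.num 19 0 0)) D.n
    (by simp [IExp.cost]) rfl ?_ ?_ ?_ ?_).mono le_rfl (fun τ _ h => h)
  · intro τ hA
    have := hA.1 0 rfl
    simp only [IExp.eval, this]
    exact hσ.n
  · intro k τ y h; exact h
  · exact .inl ⟨hm, hx, hy, by simp⟩
  · intro k τ hk hA hτk hI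
    have ep : τ.num 14 k 0 = p k := by rw [hA.2 14 rfl]; exact hσp k hk
    have eG : τ.idx 9 k 0 = if k ∈ G then 1 else 0 := by rw [hA.1 9 rfl]; exact hσG k hk
    have ew : τ.num 2 k 0 = D.w k := by rw [hA.2 2 rfl]; exact hσ.w k hk
    have sx : Small Z 13 (τ.num 18 0 0) ∧ Small Z 1 (τ.num 19 0 0) := by
      rcases hI with ⟨-, e1, e2, -⟩ | ⟨e0, -, -, e1, e2, -⟩
      · rw [e1, e2]
        have a1 := (hZ.small_nat (Nat.zero_le Z)).mono (l := 13) h1 (by norm_num)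
        have a2 := hZ.small_nat h1
        push_cast at a1 a2
        exact ⟨a1, a2⟩
      · rw [e1, e2]
        exact ⟨hp _ e0, hZ.small_w _⟩
    have q1 := hQ' (sx.1.mul (hZ.small_w k)) (by norm_num)
    have q2 := hQ' ((hp k hk).mul sx.2) (by norm_num)
    obtain ⟨hx0, hy0, hall⟩ := hI.sign
    have hwk : (0 : ℝ) < D.w k := by exact_mod_cast D.w_pos k
    refine Run.ite (c₁ := 30) (by simp [Test.cost, NExp.cost, IExp.cost]) ?_ ?_ ?_
    · simp [Test.Ok, NExp.Ok, NExp.eval, IExp.eval, hτk, ep, ew, q1, q2]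
    · intro hb
      simp only [Test.Holds, NExp.eval, IExp.eval, hτk, ep, ew, eG] at hb
      obtain ⟨hb1, hb2⟩ := hb
      have hkG : k ∉ G := fun h => by simp [h] at hb1
      have hpk : 0 < p k := by
        have : 0 < p k * τ.num 19 0 0 := (mul_nonneg hx0 hwk.le).trans_lt hb2
        exact pos_of_mul_pos_left this hy0.le
      refine Run.seq_setI (c₂ := 20) (by simp [IExp.cost]) ?_
      refine Run.seq_setN (c₂ := 10) (by simp [IExp.cost, NExp.cost]) trivial ?_
      refine Run.setN (by simp [IExp.cost, NExp.cost]) trivial ?_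
      right
      simp [IExp.eval, NExp.eval, hτk, ep, ew]
      refine ⟨hk, hkG, hpk, ?_⟩
      intro j hj hjG
      rcases Nat.lt_or_eq_of_le hj with hj | rfl
      -- Transitivity of the density order in cross-multiplied form; the positive weight y of the
      -- old candidate is cancelled.
      · have a1 := mul_le_mul_of_nonneg_right (hall j hj hjG) hwk.le
        have a2 := mul_le_mul_of_nonneg_right hb2.le (Nat.cast_nonneg (α := ℝ) (D.w j))
        refine le_of_mul_le_mul_right ?_ hy0
        linarith
      · exact le_rfl
    · intro hb
      simp only [Test.Holds, NExp.eval, IExp.eval, hτk, ep, ew, eG] at hb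
      refine Run.skip (by norm_num) ?_
      have hk' : k ∉ G → p k * τ.num 19 0 0 ≤ τ.num 18 0 0 * D.w k := by
        intro hkG
        by_contra! hcon
        exact hb ⟨by simp [hkG], hcon⟩
      rcases hI with ⟨e0, e1, e2, e3⟩ | ⟨e0, e1, e2, e3, e4, e5⟩
      · refine .inl ⟨e0, e1, e2, fun j hj hjG => ?_⟩
        rcases Nat.lt_succ_iff_lt_or_eq.1 hj with hj | rfl
        · exact e3 j hj hjG
        · simpa [e1, e2] using hk' hjG
      · refine .inr ⟨e0, e1, e2, e3, e4, fun j hj hjG => ?_⟩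
        rcases Nat.lt_succ_iff_lt_or_eq.1 hj with hj | rfl
        · exact e5 j hj hjG
        · simpa [e3, e4] using hk' hjG

/-- The memory represents the greedy set `G`. -/
def GreedyMem (D : Data) (p : ℕ → ℝ) (G : Finset ℕ) (τ : Mem) : Prop :=
  (∀ i < D.n, τ.idx 9 i 0 = if i ∈ G then 1 else 0) ∧
  τ.num 15 0 0 = ∑ i ∈ G, p i ∧ τ.num 16 0 0 = ∑ i ∈ G, (D.w i : ℝ)

theorem Data.Sized.small_weight (hZ : D.Sized Z) {G : Finset ℕ} (hG : G ⊆ range D.n) :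
    Small Z 2 (∑ i ∈ G, (D.w i : ℝ)) := by
  have : ∑ i ∈ G, D.w i ≤ Z ^ 2 := by
    calc ∑ i ∈ G, D.w i ≤ ∑ _i ∈ G, Z := sum_le_sum fun i _ => hZ.w_le i
      _ = G.card * Z := by simp
      _ ≤ Z * Z := Nat.mul_le_mul_right _ (((card_le_card hG).trans (by simp)).trans hZ.n_le)
      _ = Z ^ 2 := (sq Z).symm
  have := Small.of_nat hZ.one_le this
  push_cast at this
  exact this

/-- Repeated search replaces sorting: each round costs O(n), and either the set grows or no
profitable item is left. Hence n rounds suffice for the greedy bound. -/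
theorem run_progRound (hZ : D.Sized Z) (hQ : ∀ y, Small Z 20 y → Q y) (hσ : Ready D σ)
    {p : ℕ → ℝ} (hp : ∀ S ⊆ range D.n, Small Z 13 (∑ i ∈ S, p i)) {G : Finset ℕ}
    (hσp : ∀ i < D.n, σ.num 14 i 0 = p i) (hG : GreedySet D p G) (hGm : GreedyMem D p G σ)
    (hW : ∑ i ∈ G, D.w i ≤ D.W) :
    Run Q progRound σ (D.n * 100 + 100) (fun τ => ∃ G', G ⊆ G' ∧ GreedySet D p G' ∧
      GreedyMem D p G' τ ∧ (G'.card = G.card + 1 ∨ ∀ j < D.n, j ∉ G' → p j ≤ 0)) := by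
  have h1 := hZ.one_le
  have h2 := hZ.two_le
  have hQ' : ∀ {k : ℕ} {y : ℝ}, Small Z k y → k ≤ 20 → Q y := fun h hk => hQ _ (h.mono h1 hk)
  have hQ0 : Q 0 := by simpa using hQ' (hZ.small_nat (Nat.zero_le Z)) (by norm_num)
  have hQ1 : Q 1 := by simpa using hQ' (hZ.small_nat h1) (by norm_num)
  have hp1 : ∀ i < D.n, Small Z 13 (p i) := fun i hi => by
    simpa using hp {i} (by simpa using hi)
  refine Run.seq_setI (c₂ := D.n * 100 + 94) (by simp [IExp.cost]; omega) ?_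
  refine Run.seq_setN (c₂ := D.n * 100 + 88) (by simp [IExp.cost, NExp.cost]; omega)
    (by simpa [NExp.Ok] using hQ0) ?_
  refine Run.seq_setN (c₂ := D.n * 100 + 82) (by simp [IExp.cost, NExp.cost]; omega)
    (by simpa [NExp.Ok] using hQ1) ?_
  refine Run.seq (c₁ := D.n * 100 + 16) (c₂ := 60) (by omega)
    (run_progBest (p := p) (G := G) hZ hQ ?_ hp1 ?_ ?_ ?_ ?_ ?_) ?_
  · exact ⟨hσ.n, hσ.N, hσ.w, hσ.W, hσ.a, hσ.b, hσ.bound⟩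
  · exact hσp
  · exact hGm.1
  · simp [IExp.eval, hσ.n]
  · simp [IExp.eval, NExp.eval]
  · simp [IExp.eval, NExp.eval]
  intro τ hA hI
  have en : τ.idx 0 0 0 = D.n := by rw [hA.1 0 rfl]; exact hσ.n
  have e9 : ∀ i < D.n, τ.idx 9 i 0 = if i ∈ G then 1 else 0 := by rw [hA.1 9 rfl]; exact hGm.1
  have e15 : τ.num 15 0 0 = ∑ i ∈ G, p i := by rw [hA.2 15 rfl]; exact hGm.2.1
  have e16 : τ.num 16 0 0 = ∑ i ∈ G, (D.w i : ℝ) := by rw [hA.2 16 rfl]; exact hGm.2.2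
  refine Run.ite (c₁ := 50) (by simp [Test.cost, IExp.cost]) trivial ?_ ?_
  · intro hb
    simp only [Test.Holds, IExp.eval, en] at hb
    rcases hI with ⟨e0, -⟩ | ⟨m1, m2, m3, m4, m5, m6⟩
    · omega
    set m := τ.idx 10 0 0 with hm
    have hG' := hG.insert m1 m2 m3 m6 hW
    have sp : ∑ i ∈ insert m G, p i = ∑ i ∈ G, p i + p m := by rw [sum_insert m2, add_comm]
    have sw : ∑ i ∈ insert m G, (D.w i : ℝ) = ∑ i ∈ G, (D.w i : ℝ) + D.w m := by
      rw [sum_insert m2, add_comm]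
    refine Run.seq_setI (c₂ := 40) (by simp [IExp.cost]) ?_
    refine Run.seq_setN (c₂ := 20) (by simp [IExp.cost, NExp.cost]) ?_ ?_
    · simp only [NExp.Ok, NExp.eval, IExp.eval, Mem.setI_num, true_and, e15, m4, ← sp]
      exact hQ' (hp _ hG'.subset) (by norm_num)
    refine Run.setN (by simp [IExp.cost, NExp.cost]) ?_ ?_
    · simp [NExp.Ok, NExp.eval, IExp.eval, e16, m5, ← sw]
      exact hQ' (hZ.small_weight hG'.subset) (by norm_num)
    refine ⟨insert m G, subset_insert _ _, hG', ⟨?_, ?_, ?_⟩, .inl (card_insert_of_notMem m2)⟩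
    · intro i hi
      simp only [Mem.setN_idx, IExp.eval, Mem.setI_idx, ← hm, true_and, and_true, mem_insert]
      by_cases him : i = m
      · simp [him]
      · simpa [him] using e9 i hi
    · simp [NExp.eval, IExp.eval, e15, m4, sp]
    · simp [NExp.eval, IExp.eval, e16, m5, sw]
  · intro hb
    simp only [Test.Holds, IExp.eval, en] at hb
    rcases hI with ⟨-, -, -, e0⟩ | ⟨m1, -⟩
    · exact Run.skip (by norm_num) ⟨G, subset_rfl, hG, ⟨e9, e15, e16⟩, .inr e0⟩
    · exact absurd m1 hb

theorem run_progGreedy (hZ : D.Sized Z) (hQ : ∀ y, Small Z 20 y → Q y) (hσ : Ready D σ)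
    {p : ℕ → ℝ} (hp : ∀ S ⊆ range D.n, Small Z 13 (∑ i ∈ S, p i))
    (hclean : ∀ i, D.W < D.w i → p i ≤ 0)
    (hσp : ∀ i < D.n, σ.num 14 i 0 = p i) (hσG : ∀ i < D.n, σ.idx 9 i 0 = 0) :
    Run Q progGreedy σ (D.n * (D.n * 100 + 140) + 100) (fun τ => Small Z 13 (τ.num 15 0 0) ∧
      (∀ T, Fits D.n D.w D.W T → ∑ i ∈ T, p i ≤ τ.num 15 0 0) ∧
      ∃ S₁ S₂, Fits D.n D.w D.W S₁ ∧ Fits D.n D.w D.W S₂ ∧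
        τ.num 15 0 0 = ∑ i ∈ S₁, p i + ∑ i ∈ S₂, p i) := by
  have h1 := hZ.one_le
  have hQ' : ∀ {k : ℕ} {y : ℝ}, Small Z k y → k ≤ 20 → Q y := fun h hk => hQ _ (h.mono h1 hk)
  have hQ0 : Q 0 := by simpa using hQ' (hZ.small_nat (Nat.zero_le Z)) (by norm_num)
  refine Run.seq_setN (c₂ := D.n * (D.n * 100 + 140) + 90) (by simp [IExp.cost, NExp.cost]; omega)
    (by simpa [NExp.Ok] using hQ0) ?_
  refine Run.seq_setN (c₂ := D.n * (D.n * 100 + 140) + 80) (by simp [IExp.cost, NExp.cost]; omega)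
    (by simpa [NExp.Ok] using hQ0) ?_
  refine (Run.for (c := D.n * 100 + 124) (fun k τ => ∃ G, GreedySet D p G ∧ GreedyMem D p G τ ∧
      (G.card = k ∨ D.W < ∑ i ∈ G, D.w i ∨ ∀ j < D.n, j ∉ G → p j ≤ 0)) D.n
      (by simp [IExp.cost]) rfl ?_ ?_ ?_ ?_).mono ?_ ?_
  · intro τ hA
    have := hA.1 0 rfl
    simp only [IExp.eval, this]
    exact hσ.n
  · intro k τ y h; exact h
  · refine ⟨∅, GreedySet.empty _ _, ⟨?_, ?_, ?_⟩, by simp⟩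
    · simpa using hσG
    · simp [NExp.eval, IExp.eval]
    · simp [NExp.eval, IExp.eval]
  · rintro k τ hk hA hτk ⟨G, hG, hGm, hdone⟩
    have hR : Ready D τ := by
      refine Ready.of_agree (p := _) ?_ hA rfl
      exact ⟨hσ.n, hσ.N, hσ.w, hσ.W, hσ.a, hσ.b, hσ.bound⟩
    refine Run.ite (c₁ := D.n * 100 + 100) (by simp [Test.cost, NExp.cost, IExp.cost]; omega)
      (by simp [Test.Ok, NExp.Ok]) ?_ ?_
    · intro hb
      simp only [Test.Holds, NExp.eval, IExp.eval, hR.W, hGm.2.2] at hb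
      exact Run.skip (by omega) ⟨G, hG, hGm, .inr (.inl (by exact_mod_cast hb))⟩
    · intro hb
      simp only [Test.Holds, NExp.eval, IExp.eval, hR.W, hGm.2.2, not_lt] at hb
      have hW : ∑ i ∈ G, D.w i ≤ D.W := by exact_mod_cast hb
      refine (run_progRound hZ hQ hR hp ?_ hG hGm hW).mono le_rfl ?_
      · rw [hA.2 14 rfl]; exact hσp
      · rintro υ - ⟨G', hs, a1, a2, a3⟩
        refine ⟨G', a1, a2, ?_⟩
        rcases a3 with a3 | a3
        · rcases hdone with hd | hd | hd
          · exact .inl (by omega)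
          · omega
          · exact .inr (.inr fun j hj hjG => hd j hj fun h => hjG (hs h))
        · exact .inr (.inr a3)
  · have : D.n * (D.n * 100 + 124 + 16) = D.n * (D.n * 100 + 140) := by ring
    omega
  · rintro τ - ⟨G, hG, hGm, hdone⟩
    have := hG.bounds hclean hdone
    rw [hGm.2.1]
    exact ⟨hp G hG.subset, this.1, this.2⟩

end Specs

/-! ## The program: dynamic programming -/

/-- Round the profits down to multiples of a fraction of the greedy bound. -/
def progScale : Prog :=
  .for 4 (ivar 0) <|
    .seq (.setIdx 7 (ivar 4) (.const 0) (.const 0)) <|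
    .for 5 (ivar 3) <|
      .ite (.numLt
          (.mul (.ofIdx (.succ (.read 7 (ivar 4) (.const 0)))) (nvar 15))
          (.mul (.ofIdx (ivar 3)) (narr 14 (ivar 4))))
        (.setIdx 7 (ivar 4) (.const 0) (.succ (.read 7 (ivar 4) (.const 0))))
        .skip

/-- The smallest weight of a set of the first `i` items, item `i` included. -/
abbrev expTake : NExp :=
  .add (.read 17 (ivar 4) (.sub (ivar 5) (.read 7 (ivar 4) (.const 0)))) (narr 2 (ivar 4))

/-- Fill the table of minimal weights. -/
def progTable : Prog :=
  .seq (.for 5 (.succ (ivar 3)) (.setNum 17 (.const 0) (ivar 5) (.add (nvar 3) (.const 1)))) <|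
  .seq (.setNum 17 (.const 0) (.const 0) (.const 0)) <|
  .for 4 (ivar 0) <|
  .for 5 (.succ (ivar 3)) <|
    .ite (.numLt expTake (.read 17 (ivar 4) (ivar 5)))
      (.setNum 17 (.succ (ivar 4)) (ivar 5) expTake)
      (.setNum 17 (.succ (ivar 4)) (ivar 5) (.read 17 (ivar 4) (ivar 5)))

/-- Find the largest rounded profit that is attained within the capacity. -/
def progOpt : Prog :=
  .seq (.letI 8 (.const 0)) <|
  .for 5 (.succ (ivar 3)) <|
    .ite (.numLt (nvar 3) (.read 17 (ivar 0) (ivar 5))) .skip (.letI 8 (ivar 5))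

/-- Recover a solution from the table. -/
def progBack : Prog :=
  .for 5 (ivar 0) <|
    .seq (.letI 4 (.sub (ivar 0) (.succ (ivar 5)))) <|
    .ite (.numLt (.read 17 (.succ (ivar 4)) (ivar 8)) (.read 17 (ivar 4) (ivar 8)))
      (.seq (.setIdx 2 (ivar 6) (ivar 4) (.const 1))
        (.letI 8 (.sub (ivar 8) (.read 7 (ivar 4) (.const 0)))))
      (.setIdx 2 (ivar 6) (ivar 4) (.const 0))

/-! ### Correctness of rounding, table and backtracking -/

section Specs

variable {D : Data} {Z : ℕ} {Q : ℝ → Prop} {σ : Mem}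

/-- The machine has no floor operation, so the level of each profit is found by counting up through
N comparisons. The strict inequality ensures that an item of positive level has positive profit,
even if U = 0. -/
theorem run_progScale (hZ : D.Sized Z) (hQ : ∀ y, Small Z 20 y → Q y) (hσ : Ready D σ)
    {p : ℕ → ℝ} {U : ℝ} (hp : ∀ i < D.n, Small Z 13 (p i)) (hU : Small Z 13 U) (hU0 : 0 ≤ U)
    (hpU : ∀ i < D.n, p i ≤ U) (hσp : ∀ i < D.n, σ.num 14 i 0 = p i) (hσU : σ.num 15 0 0 = U) :
    Run Q progScale σ (D.n * (D.N * 80 + 100) + 16) (fun τ => ∀ i < D.n,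
      (0 < τ.idx 7 i 0 → τ.idx 7 i 0 * U < D.N * p i) ∧ D.N * p i ≤ (τ.idx 7 i 0 + 1) * U) := by
  have h1 := hZ.one_le
  have hQ' : ∀ {k : ℕ} {y : ℝ}, Small Z k y → k ≤ 20 → Q y := fun h hk => hQ _ (h.mono h1 hk)
  have sN := hZ.small_nat hZ.N_lt.le
  have hN := D.N_pos
  refine (Run.for (c := D.N * 80 + 84) (fun k τ => ∀ i < k,
      (0 < τ.idx 7 i 0 → τ.idx 7 i 0 * U < D.N * p i) ∧ D.N * p i ≤ (τ.idx 7 i 0 + 1) * U)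
      D.n (by simp [IExp.cost]) rfl ?_ ?_ ?_ ?_).mono le_rfl (fun τ _ h => h)
  · intro τ hA
    have := hA.1 0 rfl
    simp only [IExp.eval, this]
    exact hσ.n
  · intro k τ y h; exact h
  · simp
  · intro k τ hk hA hτk hI
    refine Run.seq_setI (c₂ := D.N * 80 + 74) (by simp [IExp.cost]; omega) ?_
    simp only [IExp.eval, hτk]
    refine (Run.for (c := 60) (fun m υ => (∀ i < k,
        (0 < υ.idx 7 i 0 → υ.idx 7 i 0 * U < D.N * p i) ∧ D.N * p i ≤ (υ.idx 7 i 0 + 1) * U) ∧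
        υ.idx 7 k 0 ≤ m ∧ (0 < υ.idx 7 k 0 → υ.idx 7 k 0 * U < D.N * p k) ∧
        (υ.idx 7 k 0 = m ∨ D.N * p k ≤ (υ.idx 7 k 0 + 1) * U))
      D.N (by simp [IExp.cost]) rfl ?_ ?_ ?_ ?_).mono (by omega) ?_
    · intro υ hυ
      have e1 := hυ.1 3 rfl
      have e2 := hA.1 3 rfl
      have e3 := τ.setI_idx_ne (show 3 ≠ 7 by norm_num) k 0 0
      simp only [IExp.eval, e1, e2, e3]
      exact hσ.N
    · intro m υ y h; exact h
    · refine ⟨fun i hi => ?_, by simp, by simp, by simp⟩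
      simpa [hi.ne] using hI i hi
    · rintro m υ hm hυ hυm ⟨b1, b2, b3, b4⟩
      have eN : υ.idx 3 0 0 = D.N := by
        rw [hυ.1 3 rfl, Mem.setI_idx_ne _ (by norm_num), hA.1 3 rfl]; exact hσ.N
      have ek : υ.idx 4 0 0 = k := by
        rw [hυ.1 4 rfl, Mem.setI_idx_ne _ (by norm_num), hτk]
      have ep : υ.num 14 k 0 = p k := by
        rw [hυ.2 14 rfl, Mem.setI_num, hA.2 14 rfl]; exact hσp k hk
      have eU : υ.num 15 0 0 = U := by
        rw [hυ.2 15 rfl, Mem.setI_num, hA.2 15 rfl]; exact hσU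
      set π := υ.idx 7 k 0 with hπ
      have s1 := hZ.small_nat (m := π + 1) (by have := hZ.N_lt; omega)
      have q1 := hQ' s1 (by norm_num)
      have q2 := hQ' (s1.mul hU) (by norm_num)
      have q3 := hQ' sN (by norm_num)
      have q4 := hQ' (sN.mul (hp k hk)) (by norm_num)
      push_cast at q1 q2
      refine Run.ite (c₁ := 20) (by simp [Test.cost, NExp.cost, IExp.cost]) ?_ ?_ ?_
      · simp [Test.Ok, NExp.Ok, NExp.eval, IExp.eval, ek, eN, ep, eU, ← hπ, q1, q2, q3, q4]
      · intro hb
        simp only [Test.Holds, NExp.eval, IExp.eval, ek, eN, ep, eU, ← hπ] at hb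
        refine Run.setI (by simp [IExp.cost]) ?_
        have hother : ∀ i < k, (υ.setI 7 (IExp.eval υ (ivar 4)) (IExp.eval υ (.const 0))
            (IExp.eval υ (.succ (.read 7 (ivar 4) (.const 0))))).idx 7 i 0 = υ.idx 7 i 0 := by
          intro i hi
          simp [IExp.eval, ek, hi.ne]
        have hself : (υ.setI 7 (IExp.eval υ (ivar 4)) (IExp.eval υ (.const 0))
            (IExp.eval υ (.succ (.read 7 (ivar 4) (.const 0))))).idx 7 k 0 = π + 1 := by
          simp [IExp.eval, ek, ← hπ]
        refine ⟨fun i hi => by rw [hother i hi]; exact b1 i hi, ?_⟩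
        rw [hself]
        refine ⟨by omega, fun _ => hb, ?_⟩
        rcases b4 with b4 | b4
        · exact .inl (by omega)
        · push_cast at hb
          linarith
      · intro hb
        simp only [Test.Holds, NExp.eval, IExp.eval, ek, eN, ep, eU, ← hπ, not_lt] at hb
        push_cast at hb
        exact Run.skip (by norm_num) ⟨b1, by omega, b3, .inr hb⟩
    · rintro υ - ⟨b1, b2, b3, b4⟩ i hi
      rcases Nat.lt_succ_iff_lt_or_eq.1 hi with hi | rfl
      · exact b1 i hi
      · refine ⟨b3, ?_⟩
        rcases b4 with b4 | b4
        -- If all N rounds incremented, the level is N, and p ≤ U supplies the upper estimate.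
        · rw [b4]
          have := mul_le_mul_of_nonneg_left (hpU i hk) hN.le
          linarith
        · exact b4

/-- The truncated difference of indices is exactly the subtraction in the recursion, so requested
profits below π i fall to column 0. -/
theorem run_progTable (hZ : D.Sized Z) (hQ : ∀ y, Small Z 20 y → Q y) (hσ : Ready D σ)
    {π : ℕ → ℕ} (hπ : ∀ i < D.n, σ.idx 7 i 0 = π i) :
    Run Q progTable σ (D.n * ((D.N + 1) * 100 + 50) + (D.N + 1) * 50 + 100) (fun τ =>
      ∀ i ≤ D.n, ∀ v ≤ D.N, τ.num 17 i v = minWeight D.w D.W π i v) := by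
  have h1 := hZ.one_le
  have hQ' : ∀ {k : ℕ} {y : ℝ}, Small Z k y → k ≤ 20 → Q y := fun h hk => hQ _ (h.mono h1 hk)
  have hQ0 : Q 0 := by simpa using hQ' (hZ.small_nat (Nat.zero_le Z)) (by norm_num)
  have hQ1 : Q 1 := by simpa using hQ' (hZ.small_nat h1) (by norm_num)
  refine Run.seq (c₁ := (D.N + 1) * 50 + 16) (c₂ := D.n * ((D.N + 1) * 100 + 50) + 50) (by omega)
    (Run.for (c := 34) (fun k τ => ∀ v < k, τ.num 17 0 v = D.W + 1) (D.N + 1)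
      (by simp [IExp.cost]) rfl ?_ ?_ ?_ ?_) ?_
  · intro τ hA
    have := hA.1 3 rfl
    simp only [IExp.eval, this]
    exact congrArg (· + 1) hσ.N
  · intro k τ y h; exact h
  · simp
  · intro k τ hk hA hτk hI
    have eW : τ.num 3 0 0 = D.W := by rw [hA.2 3 rfl]; exact hσ.W
    have q1 := hQ' (hZ.small_nat (m := D.W + 1) hZ.W_lt) (by norm_num)
    push_cast at q1
    refine Run.setN (by simp [IExp.cost, NExp.cost]) ?_ ?_
    · simp [NExp.Ok, NExp.eval, IExp.eval, eW, hQ1, q1]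
    · intro v hv
      simp only [NExp.eval, IExp.eval, Mem.setN_num, hτk, eW, Int.cast_one, true_and]
      by_cases hvk : v = k
      · simp [hvk]
      · simp only [hvk, ↓reduceIte]
        exact hI v (by omega)
  intro σ₁ hA₁ hI₁
  have hσ₁ : Ready D σ₁ := hσ.of_agree hA₁ rfl
  refine Run.seq_setN (c₂ := D.n * ((D.N + 1) * 100 + 50) + 40)
    (by simp [IExp.cost, NExp.cost]; omega)
    (by simpa [NExp.Ok] using hQ0) ?_
  simp only [IExp.eval, NExp.eval, Int.cast_zero]
  refine (Run.for (c := (D.N + 1) * 100 + 30) (fun k τ => ∀ i ≤ k, ∀ v ≤ D.N,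
      τ.num 17 i v = minWeight D.w D.W π i v) D.n (by simp [IExp.cost]) rfl ?_ ?_ ?_ ?_).mono ?_
      (fun τ _ h => h)
  · intro τ hA
    have := hA.1 0 rfl
    simp only [IExp.eval, this]
    exact hσ₁.n
  · intro k τ y h; exact h
  -- Row 0 was filled with W + 1, after which its column 0 was reset to 0.
  · intro i hi v hv
    obtain rfl : i = 0 := by omega
    by_cases hv0 : v = 0
    · simp [hv0, minWeight]
    · simpa [hv0, minWeight] using hI₁ v (by omega)
  · intro k τ hk hA hτk hI
    have hτ : Ready D τ := by
      refine Ready.of_agree (p := _) ?_ hA rfl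
      exact ⟨hσ₁.n, hσ₁.N, hσ₁.w, hσ₁.W, hσ₁.a, hσ₁.b, hσ₁.bound⟩
    have hτπ : τ.idx 7 k 0 = π k := by
      rw [hA.1 7 rfl, Mem.setN_idx, hA₁.1 7 rfl, hπ k hk]
    refine (Run.for (c := 84) (fun m υ => (∀ i ≤ k, ∀ v ≤ D.N,
      υ.num 17 i v = minWeight D.w D.W π i v) ∧
      ∀ v < m, υ.num 17 (k + 1) v = minWeight D.w D.W π (k + 1) v) (D.N + 1)
      (by simp [IExp.cost]) rfl ?_ ?_ ?_ ?_).mono (by omega) ?_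
    · intro υ hυ
      have := hυ.1 3 rfl
      simp only [IExp.eval, this]
      exact congrArg (· + 1) hτ.N
    · intro m υ y h; exact h
    · exact ⟨hI, by simp⟩
    · rintro m υ hm hυ hυm ⟨b1, b2⟩
      have hυR := hτ.of_agree hυ rfl
      have ek : υ.idx 4 0 0 = k := by rw [hυ.1 4 rfl, hτk]
      have eπ : υ.idx 7 k 0 = π k := by rw [hυ.1 7 rfl, hτπ]
      have e1 := b1 k le_rfl m (by omega)
      have e2 := b1 k le_rfl (m - π k) (by omega)
      have ew := hυR.w k hk
      set x := minWeight D.w D.W π k m with hx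
      set y := minWeight D.w D.W π k (m - π k) with hy
      have hnew : minWeight D.w D.W π (k + 1) m = min x (y + D.w k) := rfl
      have sxy : Small Z 2 ((y : ℝ) + D.w k) := by
        have b1 := minWeight_le_bound D.w D.W π k (m - π k)
        have b2 := hZ.w_le k
        have b3 := hZ.W_lt
        have b4 := hZ.two_le
        have : y + D.w k ≤ Z ^ 2 := by nlinarith
        have := Small.of_nat h1 this
        push_cast at this
        exact this
      have q1 := hQ' sxy (by norm_num)
      have hgoal : ∀ z : ℝ, z = (min x (y + D.w k) : ℕ) →
          (∀ i ≤ k, ∀ v ≤ D.N, (υ.setN 17 (k + 1) m z).num 17 i v = minWeight D.w D.W π i v) ∧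
          ∀ v < m + 1, (υ.setN 17 (k + 1) m z).num 17 (k + 1) v =
            minWeight D.w D.W π (k + 1) v := by
        intro z hz
        constructor
        · intro i hi v hv
          simpa [show i ≠ k + 1 by omega] using b1 i hi v hv
        · intro v hv
          by_cases hvm : v = m
          · rw [hvm, hnew, Mem.setN_num, if_pos ⟨rfl, rfl, rfl⟩, hz]
          · simpa [hvm] using b2 v (by omega)
      have hexp : NExp.eval υ expTake = y + D.w k := by
        simp only [NExp.eval, IExp.eval, ek, hυm, eπ, e2, ew]
      have hread : NExp.eval υ (.read 17 (ivar 4) (ivar 5)) = x := by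
        simp only [NExp.eval, IExp.eval, ek, hυm, e1]
      have hok : NExp.Ok Q υ expTake := by
        refine ⟨trivial, trivial, ?_⟩
        have : Q (NExp.eval υ expTake) := by rw [hexp]; exact q1
        exact this
      refine Run.ite (c₁ := 40) (by simp [Test.cost, NExp.cost, IExp.cost]) ⟨hok, trivial⟩ ?_ ?_
      · intro hb
        have hb' : NExp.eval υ expTake < NExp.eval υ (.read 17 (ivar 4) (ivar 5)) := hb
        rw [hexp, hread] at hb'
        refine Run.setN (by simp [IExp.cost, NExp.cost]) hok ?_
        rw [hexp]
        simp only [IExp.eval, ek, hυm]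
        exact hgoal _ (by push_cast; exact (min_eq_right hb'.le).symm)
      · intro hb
        have hb' : ¬ NExp.eval υ expTake < NExp.eval υ (.read 17 (ivar 4) (ivar 5)) := hb
        rw [hexp, hread, not_lt] at hb'
        refine Run.setN (by simp [IExp.cost, NExp.cost]) trivial ?_
        rw [hread]
        simp only [IExp.eval, ek, hυm]
        exact hgoal _ (by push_cast; exact (min_eq_left hb').symm)
    · rintro υ - ⟨b1, b2⟩ i hi v hv
      rcases Nat.lt_or_eq_of_le hi with hi | rfl
      · exact b1 i (by omega) v hv
      · exact b2 v (by omega)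
  · have : D.n * ((D.N + 1) * 100 + 30 + 16) ≤ D.n * ((D.N + 1) * 100 + 50) :=
      Nat.mul_le_mul_left _ (by omega)
    exact Nat.add_le_add this (by norm_num)

/-- Column 0 always fits, by the empty set; as the scan is increasing, the last success is the
maximum. -/
theorem run_progOpt (hσ : Ready D σ) {π : ℕ → ℕ}
    (hT : ∀ i ≤ D.n, ∀ v ≤ D.N, σ.num 17 i v = minWeight D.w D.W π i v) :
    Run Q progOpt σ ((D.N + 1) * 60 + 50) (fun τ => τ.idx 8 0 0 ≤ D.N ∧
      minWeight D.w D.W π D.n (τ.idx 8 0 0) ≤ D.W ∧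
      ∀ u ≤ D.N, minWeight D.w D.W π D.n u ≤ D.W → u ≤ τ.idx 8 0 0) := by
  refine Run.seq_setI (c₂ := (D.N + 1) * 60 + 40) (by simp [IExp.cost]; omega) ?_
  refine (Run.for (c := 44) (fun k τ => τ.idx 8 0 0 ≤ D.N ∧
      minWeight D.w D.W π D.n (τ.idx 8 0 0) ≤ D.W ∧
      ∀ u < k, minWeight D.w D.W π D.n u ≤ D.W → u ≤ τ.idx 8 0 0) (D.N + 1)
      (by simp [IExp.cost]) rfl ?_ ?_ ?_ ?_).mono (by omega) ?_
  · intro τ hA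
    have := hA.1 3 rfl
    simp only [IExp.eval, this]
    exact congrArg (· + 1) hσ.N
  · intro k τ y h; exact h
  · have := minWeight_le_sum D.w D.W π D.n 0 ∅ (by simp) (by simp)
    simp only [sum_empty, Nat.le_zero] at this
    simp [IExp.eval, this]
  · rintro k τ hk hA hτk ⟨b1, b2, b3⟩
    have hR : Ready D τ := by
      refine Ready.of_agree (p := _) ?_ hA rfl
      exact ⟨hσ.n, hσ.N, hσ.w, hσ.W, hσ.a, hσ.b, hσ.bound⟩
    have eT : τ.num 17 D.n k = minWeight D.w D.W π D.n k := by
      rw [hA.2 17 rfl]; exact hT D.n le_rfl k (by omega)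
    refine Run.ite (c₁ := 10) (by simp [Test.cost, NExp.cost, IExp.cost]) ⟨trivial, trivial⟩ ?_ ?_
    · intro hb
      simp only [Test.Holds, NExp.eval, IExp.eval, hR.W, hR.n, hτk, eT, Nat.cast_lt] at hb
      refine Run.skip (by norm_num) ⟨b1, b2, fun u hu huW => ?_⟩
      rcases Nat.lt_succ_iff_lt_or_eq.1 hu with hu | rfl
      · exact b3 u hu huW
      · omega
    · intro hb
      simp only [Test.Holds, NExp.eval, IExp.eval, hR.W, hR.n, hτk, eT, Nat.cast_lt, not_lt] at hb
      refine Run.setI (by simp [IExp.cost]) ?_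
      simp only [IExp.eval, hτk, Mem.setI_idx, and_self, ↓reduceIte]
      exact ⟨by omega, hb, fun u hu _ => by omega⟩
  · rintro τ - ⟨b1, b2, b3⟩
    exact ⟨b1, b2, fun u hu => b3 u (by omega)⟩

/-- Items are visited from last to first. The weight already chosen plus the table entry still to be
realised stays equal to the original entry; the profits satisfy only an inequality, since the
remaining demand is truncated at 0. -/
theorem run_progBack (hσ : Ready D σ) {π : ℕ → ℕ} (hπ : ∀ i < D.n, σ.idx 7 i 0 = π i)
    (hT : ∀ i ≤ D.n, ∀ v ≤ D.N, σ.num 17 i v = minWeight D.w D.W π i v)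
    (hv : σ.idx 8 0 0 ≤ D.N) (hvW : minWeight D.w D.W π D.n (σ.idx 8 0 0) ≤ D.W) :
    Run Q progBack σ (D.n * 100 + 50) (fun τ => ∃ S, Fits D.n D.w D.W S ∧
      (∀ i ∈ S, 0 < π i) ∧ σ.idx 8 0 0 ≤ ∑ i ∈ S, π i ∧
      (∀ i < D.n, τ.idx 2 (σ.idx 6 0 0) i = if i ∈ S then 1 else 0) ∧
      ∀ j, j ≠ σ.idx 6 0 0 → τ.idx 2 j = σ.idx 2 j) := by
  set v₀ := σ.idx 8 0 0 with hv₀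
  set c := σ.idx 6 0 0 with hc
  refine (Run.for (c := 84) (fun k τ => ∃ S, S ⊆ range D.n ∧ (∀ i ∈ S, D.n - k ≤ i) ∧
      (∀ i ∈ S, 0 < π i) ∧ τ.idx 8 0 0 ≤ D.N ∧ v₀ ≤ ∑ i ∈ S, π i + τ.idx 8 0 0 ∧
      ∑ i ∈ S, D.w i + minWeight D.w D.W π (D.n - k) (τ.idx 8 0 0) =
        minWeight D.w D.W π D.n v₀ ∧
      (∀ i < D.n, D.n - k ≤ i → τ.idx 2 c i = if i ∈ S then 1 else 0) ∧
      ∀ j, j ≠ c → τ.idx 2 j = σ.idx 2 j) D.n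
      (by simp [IExp.cost]) rfl ?_ ?_ ?_ ?_).mono (by omega) ?_
  · intro τ hA
    have := hA.1 0 rfl
    simp only [IExp.eval, this]
    exact hσ.n
  · rintro k τ y ⟨S, a1, a2, a3, a4, a5, a6, a7, a8⟩
    refine ⟨S, a1, a2, a3, a4, a5, a6, a7, fun j hj => ?_⟩
    rw [Mem.setI_idx_ne _ (by norm_num)]
    exact a8 j hj
  · refine ⟨∅, by simp, by simp, by simp, hv, by simp [hv₀], by simp [hv₀], ?_, by simp⟩
    intro i hi hi'
    omega
  · rintro k τ hk hA hτk ⟨S, a1, a2, a3, a4, a5, a6, a7, a8⟩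
    have hR := hσ.of_agree hA rfl
    obtain ⟨i, hi⟩ : ∃ i, i = D.n - (k + 1) := ⟨_, rfl⟩
    have hin : i < D.n := by omega
    have hik : D.n - k = i + 1 := by omega
    have eT : τ.num 17 = σ.num 17 := hA.2 17 rfl
    have e7 : τ.idx 7 i 0 = π i := by rw [hA.1 7 rfl]; exact hπ i hin
    have e6 : τ.idx 6 0 0 = c := by rw [hA.1 6 rfl]
    set v := τ.idx 8 0 0 with hvdef
    have t1 := hT (i + 1) (by omega) v a4
    have t0 := hT i (by omega) v a4
    have hrec : minWeight D.w D.W π (i + 1) v =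
      min (minWeight D.w D.W π i v) (minWeight D.w D.W π i (v - π i) + D.w i) := rfl
    rw [hik] at a2 a6 a7
    refine Run.seq_setI (c₂ := 70) (by simp [IExp.cost]) ?_
    have ei : IExp.eval τ (.sub (ivar 0) (.succ (ivar 5))) = i := by
      simp only [IExp.eval, hR.n, hτk, hi]
    rw [ei]
    refine Run.ite (c₁ := 30) (by simp [Test.cost, NExp.cost, IExp.cost]) ⟨trivial, trivial⟩ ?_ ?_
    · intro hb
      simp [Test.Holds, NExp.eval, IExp.eval, ← hvdef, eT, t0, t1] at hb
      -- An item is taken only if it strictly lowers the entry, which is impossible when its rounded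
      -- profit is 0.
      have hπi : 0 < π i := by
        by_contra hcon
        have : π i = 0 := by omega
        rw [hrec, this] at hb
        simp at hb
      have hmin : minWeight D.w D.W π (i + 1) v = minWeight D.w D.W π i (v - π i) + D.w i := by
        rw [hrec] at hb ⊢
        omega
      have hiS : i ∉ S := fun h => by have := a2 i h; omega
      refine Run.seq_setI (c₂ := 15) (by simp [IExp.cost]) ?_
      refine Run.setI (by simp [IExp.cost]) ?_
      refine ⟨insert i S, ?_, ?_, ?_, ?_, ?_, ?_, ?_, ?_⟩
      · intro j hj
        rcases mem_insert.1 hj with rfl | hj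
        · exact mem_range.2 hin
        · exact a1 hj
      · intro j hj
        rcases mem_insert.1 hj with rfl | hj
        · omega
        · have := a2 j hj
          omega
      · intro j hj
        rcases mem_insert.1 hj with rfl | hj
        · exact hπi
        · exact a3 j hj
      · simp [IExp.eval, ← hvdef, e7]
        omega
      · simp [IExp.eval, ← hvdef, e7, sum_insert hiS]
        omega
      · simp [IExp.eval, ← hvdef, e7, sum_insert hiS, ← hi]
        omega
      · intro j hj hj'
        simp [IExp.eval, e6]
        by_cases hji : j = i
        · simp [hji]
        · simpa [hji] using a7 j hj (by omega)
      · intro j hj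
        funext x
        simp [IExp.eval, e6, hj, a8 j hj]
    · intro hb
      simp [Test.Holds, NExp.eval, IExp.eval, ← hvdef, eT, t0, t1] at hb
      have hmin : minWeight D.w D.W π (i + 1) v = minWeight D.w D.W π i v := by
        rw [hrec] at hb ⊢
        omega
      have hiS : i ∉ S := fun h => by have := a2 i h; omega
      refine Run.setI (by simp [IExp.cost]) ?_
      refine ⟨S, a1, fun j hj => by have := a2 j hj; omega, a3, ?_, ?_, ?_, ?_, ?_⟩
      · simpa [IExp.eval] using a4
      · simpa [IExp.eval] using a5
      · rw [← hi, ← a6, hmin]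
        simp [IExp.eval, ← hvdef]
      · intro j hj hj'
        simp [IExp.eval, e6]
        by_cases hji : j = i
        · simp [hji, hiS]
        · simpa [hji] using a7 j hj (by omega)
      · intro j hj
        funext x
        simp [IExp.eval, e6, hj, a8 j hj]
  · rintro τ - ⟨S, a1, a2, a3, a4, a5, a6, a7, a8⟩
    rw [Nat.sub_self] at a6 a7
    -- A positive remaining demand would leave the entry W + 1 of row 0, which exceeds the capacity.
    have h0 : τ.idx 8 0 0 = 0 := by
      by_contra hcon
      simp only [minWeight, hcon, ↓reduceIte] at a6
      omega
    refine ⟨S, ⟨a1, by omega⟩, a3, by omega, fun i hi => a7 i hi (Nat.zero_le _), a8⟩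

end Specs

/-! ## The program: the sweep over the parameter line -/

/-- Solve the knapsack problem at the midpoint of the current interval. -/
def progSolve : Prog :=
  .seq progProfits <| .seq progGreedy <| .seq progScale <| .seq progTable <| .seq progOpt progBack

/-- Treat one interval. -/
def progCell : Prog :=
  .seq progLine <| .seq progNext <| .seq progSolve <|
  .seq (.setNum 5 (ivar 6) (.const 0) (nvar 9)) <|
  .seq (.letN 8 (nvar 9)) (.letI 6 (.succ (ivar 6)))

/-- Treat all intervals from left to right. -/
def progSweep : Prog := .while (.numLt (nvar 8) (nvar 12)) progCell

/-- The left end of the `j`-th interval. -/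
def Data.left (D : Data) (c : ℕ → ℝ) (j : ℕ) : ℝ := if j = 0 then -D.bound else c (j - 1)

/-- The memory holds the results for the first `k` intervals. -/
structure SweepInv (D : Data) (Z k : ℕ) (τ : Mem) : Prop where
  ready : Ready D τ
  count : τ.idx 6 0 0 = k
  cur : τ.num 8 0 0 = D.left τ.outBreak k
  small : Small Z 4 (τ.num 8 0 0)
  le_bound : τ.num 8 0 0 ≤ D.bound
  lt : ∀ j < k, D.left τ.outBreak j < τ.outBreak j
  event : ∀ j < k, τ.outBreak j = D.bound ∨ D.IsEvent (D.left τ.outBreak j) (τ.outBreak j)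
  approx : ∀ j < k, ∃ S, Fits D.n D.w D.W S ∧ (∀ i < D.n, τ.idx 2 j i = if i ∈ S then 1 else 0) ∧
    ∀ t ∈ cell D.bound (D.left τ.outBreak j) (τ.outBreak j), ∀ T, Fits D.n D.w D.W T →
      ((D.N : ℝ) - 4 * D.n) * ∑ i ∈ T, D.p t i ≤ D.N * ∑ i ∈ S, D.p t i

/-! ### Correctness of the sweep -/

section Specs

variable {D : Data} {Z : ℕ} {Q : ℝ → Prop} {σ : Mem}

theorem run_progSolve (hZ : D.Sized Z) (hQ : ∀ y, Small Z 20 y → Q y) (hσ : Ready D σ)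
    (hl : Small Z 4 (σ.num 8 0 0)) (hr : Small Z 4 (σ.num 9 0 0)) :
    Run Q progSolve σ (2000 * (D.n * D.N)) (fun τ => ∃ S, Fits D.n D.w D.W S ∧
      (∀ i ∈ S, 0 < D.p ((σ.num 8 0 0 + σ.num 9 0 0) / 2) i) ∧
      (∀ T, Fits D.n D.w D.W T →
        ((D.N : ℝ) - 2 * D.n) * ∑ i ∈ T, D.p ((σ.num 8 0 0 + σ.num 9 0 0) / 2) i ≤
          D.N * ∑ i ∈ S, D.p ((σ.num 8 0 0 + σ.num 9 0 0) / 2) i) ∧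
      (∀ i < D.n, τ.idx 2 (σ.idx 6 0 0) i = if i ∈ S then 1 else 0) ∧
      ∀ j, j ≠ σ.idx 6 0 0 → τ.idx 2 j = σ.idx 2 j) := by
  set s := (σ.num 8 0 0 + σ.num 9 0 0) / 2 with hs
  -- The costs of the six stages are added; n ≤ N absorbs the quadratic cost of the greedy stage
  -- into n·N.
  have hcost : ∃ c : ℕ, c = (D.n * 100 + 100) + ((D.n * (D.n * 100 + 140) + 100) +
      ((D.n * (D.N * 80 + 100) + 16) + ((D.n * ((D.N + 1) * 100 + 50) + (D.N + 1) * 50 + 100) +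
      (((D.N + 1) * 60 + 50) + (D.n * 100 + 50))))) ∧ c ≤ 2000 * (D.n * D.N) := by
    refine ⟨_, rfl, ?_⟩
    have h1 := D.n_pos
    have h2 := D.le_N
    have a1 : D.n ≤ D.n * D.N := Nat.le_mul_of_pos_right _ (by omega)
    have a2 : D.N ≤ D.n * D.N := Nat.le_mul_of_pos_left _ h1
    have a3 : D.n * D.n ≤ D.n * D.N := Nat.mul_le_mul_left _ (by omega)
    ring_nf at a1 a2 a3 ⊢
    omega
  obtain ⟨c, hc, hc'⟩ := hcost
  suffices H : Run Q progSolve σ c (fun τ => ∃ S, Fits D.n D.w D.W S ∧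
      (∀ i ∈ S, 0 < D.p s i) ∧
      (∀ T, Fits D.n D.w D.W T →
        ((D.N : ℝ) - 2 * D.n) * ∑ i ∈ T, D.p s i ≤ D.N * ∑ i ∈ S, D.p s i) ∧
      (∀ i < D.n, τ.idx 2 (σ.idx 6 0 0) i = if i ∈ S then 1 else 0) ∧
      ∀ j, j ≠ σ.idx 6 0 0 → τ.idx 2 j = σ.idx 2 j) from H.mono hc' fun _ _ h => h
  rw [hc]
  refine Run.seq le_rfl (run_progProfits hZ hQ hσ hl hr) ?_
  rintro σ₁ hA₁ ⟨ss, hI₁⟩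
  rw [← hs] at ss hI₁
  have hσ₁ := hσ.of_agree hA₁ rfl
  have hsum : ∀ S ⊆ range D.n, Small Z 13 (∑ i ∈ S, D.p s i) := fun S hS => hZ.small_sum ss hS
  have hclean : ∀ i, D.W < D.w i → D.p s i ≤ 0 := by
    intro i hi
    simp [Data.p, D.a_eq_zero i hi, D.b_eq_zero i hi]
  have hp1 : ∀ i < D.n, Small Z 13 (D.p s i) := fun i hi => by
    simpa using hsum {i} (by simpa using hi)
  refine Run.seq le_rfl (run_progGreedy hZ hQ hσ₁ hsum hclean (fun i hi => (hI₁ i hi).1)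
    (fun i hi => (hI₁ i hi).2)) ?_
  rintro σ₂ hA₂ ⟨sU, hU, S₁, S₂, hS₁, hS₂, hU₂⟩
  have hσ₂ := hσ₁.of_agree hA₂ rfl
  set U := σ₂.num 15 0 0 with hUdef
  have hU0 : 0 ≤ U := by simpa using hU ∅ (Fits.empty _ _ _)
  have hpU : ∀ i < D.n, D.p s i ≤ U := by
    intro i hi
    by_cases hw : D.w i ≤ D.W
    · simpa using hU {i} ⟨by simpa using hi, by simpa using hw⟩
    · exact (hclean i (not_le.1 hw)).trans hU0
  refine Run.seq le_rfl (run_progScale hZ hQ hσ₂ hp1 sU hU0 hpU ?_ rfl) ?_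
  · rw [hA₂.2 14 rfl]
    exact fun i hi => (hI₁ i hi).1
  intro σ₃ hA₃ hI₃
  have hσ₃ := hσ₂.of_agree hA₃ rfl
  obtain ⟨π, hπ⟩ : ∃ π : ℕ → ℕ, π = fun i => σ₃.idx 7 i 0 := ⟨_, rfl⟩
  have hπ₃ : ∀ i < D.n, σ₃.idx 7 i 0 = π i := fun i _ => by rw [hπ]
  refine Run.seq le_rfl (run_progTable hZ hQ hσ₃ hπ₃) ?_
  intro σ₄ hA₄ hI₄
  have hσ₄ := hσ₃.of_agree hA₄ rfl
  refine Run.seq le_rfl (run_progOpt hσ₄ hI₄) ?_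
  rintro σ₅ hA₅ ⟨hv1, hv2, hv3⟩
  have hσ₅ := hσ₄.of_agree hA₅ rfl
  refine (run_progBack (π := π) hσ₅ ?_ ?_ hv1 hv2).mono le_rfl ?_
  · rw [hA₅.1 7 rfl, hA₄.1 7 rfl]
    exact hπ₃
  · rw [hA₅.2 17 rfl]
    exact hI₄
  rintro τ - ⟨S, hS, hSπ, hSv, hrow, hrest⟩
  have e6 : σ₅.idx 6 0 0 = σ.idx 6 0 0 := by
    rw [hA₅.1 6 rfl, hA₄.1 6 rfl, hA₃.1 6 rfl, hA₂.1 6 rfl, hA₁.1 6 rfl]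
  have e2 : σ₅.idx 2 = σ.idx 2 := by
    rw [hA₅.1 2 rfl, hA₄.1 2 rfl, hA₃.1 2 rfl, hA₂.1 2 rfl, hA₁.1 2 rfl]
  rw [e6] at hrow hrest
  rw [e2] at hrest
  have hI₃' : ∀ i < D.n, (0 < π i → π i * U < D.N * D.p s i) ∧
      D.N * D.p s i ≤ (π i + 1) * U := by
    rw [hπ]
    exact hI₃
  refine ⟨S, hS, ?_, ?_, hrow, hrest⟩
  · intro i hi
    have h1 := (hI₃' i (mem_range.1 (hS.1 hi))).1 (hSπ i hi)
    have h2 : (0 : ℝ) ≤ π i * U := by positivity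
    exact pos_of_mul_pos_right (h2.trans_lt h1) D.N_pos.le
  · intro T hT
    have h2 := D.le_N
    exact rounded_approx (by omega) hU hS₁ hS₂ hU₂ (fun i hi h => ((hI₃' i hi).1 h).le)
      (fun i hi => (hI₃' i hi).2) hS.1 hSπ hSv hv3 hT

theorem SweepInv.mono_break {k : ℕ} {τ : Mem} (h : SweepInv D Z k τ) {i j : ℕ} (hij : i ≤ j)
    (hj : j < k) : τ.outBreak i ≤ τ.outBreak j := by
  induction j, hij using Nat.le_induction with
  | base => exact le_rfl
  | succ j hij ih =>
    refine (ih (by omega)).trans ?_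
    simpa [Data.left] using (h.lt (j + 1) hj).le

theorem SweepInv.le_left {k : ℕ} {τ : Mem} (h : SweepInv D Z k τ) {i j : ℕ} (hij : i < j)
    (hj : j ≤ k) : τ.outBreak i ≤ D.left τ.outBreak j := by
  have : j ≠ 0 := by omega
  simp only [Data.left, this, ↓reduceIte]
  exact h.mono_break (by omega) (by omega)

/-- The number of intervals is bounded. -/
theorem SweepInv.events_le {k m : ℕ} {τ : Mem} (h : SweepInv D Z k τ) (hm : m ≤ k)
    (hne : ∀ j < m, τ.outBreak j ≠ D.bound) : m ≤ 2 * (D.n * (D.N + 1)) :=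
  Data.count_events (c := τ.outBreak) (l := D.left τ.outBreak) (fun j hj => h.lt j (hj.trans_le hm))
    (fun _ _ hij hj => h.le_left hij (hj.le.trans hm))
    (fun j hj => (h.event j (hj.trans_le hm)).resolve_left (hne j hj))

/-- As long as the sweep has not reached `bound`, all its breakpoints are genuine events. -/
theorem SweepInv.count_le {k : ℕ} {τ : Mem} (h : SweepInv D Z k τ)
    (hlt : τ.num 8 0 0 < D.bound) : k ≤ 2 * (D.n * (D.N + 1)) := by
  refine h.events_le le_rfl fun j hj => ?_
  have := h.le_left hj le_rfl
  rw [← h.cur] at this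
  exact (this.trans_lt hlt).ne

theorem run_progCell (hZ : D.Sized Z) (hQ : ∀ y, Small Z 20 y → Q y) {k : ℕ}
    (h : SweepInv D Z k σ) (hlt : σ.num 8 0 0 < D.bound) :
    Run Q progCell σ (3000 * (D.n * D.N)) (SweepInv D Z (k + 1)) := by
  have hcost : ∃ c : ℕ, c = (D.n * 120 + 100) + ((D.n * ((D.N + 1) * 150 + 100) + 100) +
      (2000 * (D.n * D.N) + 30)) ∧ c ≤ 3000 * (D.n * D.N) := by
    refine ⟨_, rfl, ?_⟩
    have h1 := D.n_pos
    have h2 := D.le_N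
    have a1 : D.n ≤ D.n * D.N := Nat.le_mul_of_pos_right _ (by omega)
    ring_nf at a1 ⊢
    omega
  obtain ⟨c, hc, hc'⟩ := hcost
  suffices H : Run Q progCell σ c (SweepInv D Z (k + 1)) from H.mono hc' fun _ _ h => h
  rw [hc]
  refine Run.seq le_rfl (run_progLine hZ hQ h.ready h.small) ?_
  rintro σ₁ hA₁ ⟨A, B, hA, hB, hline, hgerm⟩
  have hσ₁ := h.ready.of_agree hA₁ rfl
  have e8 : σ₁.num 8 = σ.num 8 := hA₁.2 8 rfl
  refine Run.seq le_rfl (run_progNext hZ hQ hσ₁ hA hB hline (by rw [e8]; exact hlt)) ?_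
  intro σ₂ hA₂ hI₂
  have hσ₂ := hσ₁.of_agree hA₂ rfl
  rw [e8] at hI₂
  have e8₂ : σ₂.num 8 = σ.num 8 := (hA₂.2 8 rfl).trans e8
  have e6 : σ₂.idx 6 0 0 = k := by rw [hA₂.1 6 rfl, hA₁.1 6 rfl, h.count]
  have e2 : σ₂.idx 2 = σ.idx 2 := by rw [hA₂.1 2 rfl, hA₁.1 2 rfl]
  set l := σ.num 8 0 0 with hl
  set r := σ₂.num 9 0 0 with hr
  obtain ⟨hlr, hrb, hrs, hrev, hnc⟩ := hI₂
  have hcross : D.NoCross A B l r := fun i hi j hj ρ => hnc i j ⟨hi, hj⟩ ρ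
  refine Run.seq le_rfl (run_progSolve hZ hQ hσ₂ (by rw [e8₂]; exact h.small) hrs) ?_
  rintro σ₃ hA₃ ⟨S, hS, hSpos, hSopt, hrow, hrest⟩
  have hσ₃ := hσ₂.of_agree hA₃ rfl
  rw [e8₂] at hSpos hSopt
  rw [e6] at hrow hrest
  rw [e2] at hrest
  have e9 : σ₃.num 9 0 0 = r := by rw [hA₃.2 9 rfl]
  have e6₃ : σ₃.idx 6 0 0 = k := by rw [hA₃.1 6 rfl, e6]
  have e5 : σ₃.num 5 = σ.num 5 := by rw [hA₃.2 5 rfl, hA₂.2 5 rfl, hA₁.2 5 rfl]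
  refine Run.seq_setN (c₂ := 20) (by simp [IExp.cost, NExp.cost]) trivial ?_
  refine Run.seq_setN (c₂ := 10) (by simp [IExp.cost, NExp.cost]) trivial ?_
  refine Run.setI (by simp [IExp.cost]) ?_
  simp only [NExp.eval, IExp.eval, Mem.setN_idx, Mem.setN_num, e9, e6₃]
  set τ := (((σ₃.setN 5 k 0 r).setN 8 0 0 _).setI 6 0 0 _) with hτ
  have hτk : τ.outBreak k = r := by simp [hτ, Mem.outBreak]
  have hτj : ∀ j, j ≠ k → τ.outBreak j = σ.outBreak j := by
    intro j hj
    simp [hτ, Mem.outBreak, hj, e5]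
  have hleft : ∀ j ≤ k, D.left τ.outBreak j = D.left σ.outBreak j := by
    intro j hj
    unfold Data.left
    split_ifs with h0
    · rfl
    · exact hτj _ (by omega)
  have hleftk : D.left τ.outBreak k = l := by rw [hleft k le_rfl, ← h.cur]
  have hτ2 : τ.idx 2 = σ₃.idx 2 := by
    funext i j
    simp [hτ]
  have hτ8 : τ.num 8 0 0 = r := by simp [hτ]
  have hmid : l < (l + r) / 2 ∧ (l + r) / 2 < r := by constructor <;> linarith
  refine ⟨⟨hσ₃.n, hσ₃.N, hσ₃.w, hσ₃.W, hσ₃.a, hσ₃.b, hσ₃.bound⟩, by simp [hτ], ?_, ?_, ?_, ?_, ?_,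
    ?_⟩
  · rw [hτ8]
    simp [Data.left, hτk]
  · rw [hτ8]; exact hrs
  · rw [hτ8]; exact hrb
  · intro j hj
    rcases Nat.lt_succ_iff_lt_or_eq.1 hj with hj | rfl
    · rw [hleft j hj.le, hτj j hj.ne]
      exact h.lt j hj
    · rw [hleftk, hτk]
      exact hlr
  · intro j hj
    rcases Nat.lt_succ_iff_lt_or_eq.1 hj with hj | rfl
    · rw [hleft j hj.le, hτj j hj.ne]
      exact h.event j hj
    · rw [hleftk, hτk]
      rcases hrev with hrev | ⟨i, hi, q, hq, hc⟩
      · exact .inl hrev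
      · refine .inr ⟨i, hi, q, hq, A, B, hline, fun t ht1 ht2 => ?_, hc⟩
        -- The line is top on the closed interval, both ends included, which is what counting events
        -- requires.
        exact Data.isTop_of_germ hline hgerm hcross hmid.1 hmid.2 ⟨.inr ht1, .inr ht2⟩
  · intro j hj
    rcases Nat.lt_succ_iff_lt_or_eq.1 hj with hj | rfl
    · rw [hleft j hj.le, hτj j hj.ne, hτ2, hrest j hj.ne]
      exact h.approx j hj
    · rw [hleftk, hτk, hτ2]
      exact ⟨S, hS, hrow, fun t ht T hT =>
        Data.cell_approx hline hgerm hcross hmid.1 hmid.2 hS.1 hSpos hSopt ht hT⟩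

/-- One round more than the number of events, for the last cell, which ends at `bound`. -/
theorem run_progSweep (hZ : D.Sized Z) (hQ : ∀ y, Small Z 20 y → Q y)
    (h : SweepInv D Z 0 σ) :
    Run Q progSweep σ ((2 * (D.n * (D.N + 1)) + 1) * (3000 * (D.n * D.N) + 8) + 8) (fun τ =>
      ∃ k, SweepInv D Z k τ ∧ τ.num 8 0 0 = D.bound) := by
  refine (Run.while_count (I := SweepInv D Z) (c := 3000 * (D.n * D.N))
    (2 * (D.n * (D.N + 1)) + 1) ?_ ?_ h).mono ?_ ?_
  · intro k τ _
    exact ⟨trivial, trivial⟩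
  · intro k τ hI hb
    simp only [Test.Holds, NExp.eval, IExp.eval, hI.ready.bound] at hb
    exact ⟨Nat.lt_succ_of_le (hI.count_le hb), run_progCell hZ hQ hI hb⟩
  · simp [Test.cost, NExp.cost, IExp.cost]
  · rintro τ - ⟨k, hI, hb⟩
    simp only [Test.Holds, NExp.eval, IExp.eval, hI.ready.bound, not_lt] at hb
    exact ⟨k, hI, le_antisymm hI.le_bound hb⟩

end Specs

/-! ## The program: preprocessing -/

/-- Compute the number of levels. -/
def progLevels : Prog :=
  .while (.numLt (.mul (.ofIdx (ivar 3)) (nvar 4)) (.mul (.const 4) (.ofIdx (ivar 0))))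
    (.letI 3 (.succ (ivar 3)))

/-- Remove the items that do not fit and compute the bound for the breakpoints. -/
def progClean : Prog :=
  .seq (.letN 12 (.const 1)) <|
  .seq (.for 4 (ivar 0) <|
    .seq (.ite (.numLt (nvar 3) (narr 2 (ivar 4)))
      (.seq (.setNum 6 (ivar 4) (.const 0) (.const 0)) (.setNum 7 (ivar 4) (.const 0) (.const 0)))
      (.seq (.setNum 6 (ivar 4) (.const 0) (narr 0 (ivar 4)))
        (.setNum 7 (ivar 4) (.const 0) (narr 1 (ivar 4)))))
    (.letN 12 (.add (nvar 12)
      (.mul (.mul (.const 2) (.ofIdx (ivar 3)))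
        (.mul (narr 6 (ivar 4)) (narr 6 (ivar 4))))))) <|
  .letN 8 (.sub (.const 0) (nvar 12))

/-- The approximation scheme for the parametric knapsack problem. -/
def progMain : Prog :=
  .seq progLevels <| .seq progClean <| .seq progSweep (.letI 1 (.sub (ivar 6) (.const 1)))

/-- The preprocessed data of an instance. -/
def Input.data {n : ℕ} (K : Input n) (N : ℕ) (hn : 0 < n) (hN : 4 * n ≤ N) : Data where
  n := n
  N := N
  W := K.W
  a i := if h : i < n then (if K.W < K.w ⟨i, h⟩ then 0 else K.a ⟨i, h⟩) else 0
  b i := if h : i < n then (if K.W < K.w ⟨i, h⟩ then 0 else K.b ⟨i, h⟩) else 0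
  w i := if h : i < n then K.w ⟨i, h⟩ else 1
  w_pos i := by
    split_ifs
    · exact K.w_pos _
    · exact one_pos
  a_eq_zero i := by
    intro h
    split_ifs at h ⊢ <;> simp_all
  b_eq_zero i := by
    intro h
    split_ifs at h ⊢ <;> simp_all
  n_pos := hn
  le_N := hN

/-- A bound for all integers in the preprocessed data. -/
def Input.magnitude {n : ℕ} (K : Input n) (N : ℕ) : ℕ :=
  3 + 2 * (n + N + K.W + ∑ i, ((K.a i).natAbs + (K.b i).natAbs + K.w i))

/-! ### Correctness of the preprocessing -/

section Preprocessing

variable {n : ℕ} (K : Input n) {N : ℕ} (hn : 0 < n) (hN : 4 * n ≤ N)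

theorem Input.sized : (K.data N hn hN).Sized (K.magnitude N) := by
  have hsum : ∀ i : Fin n, (K.a i).natAbs + (K.b i).natAbs + K.w i ≤
      ∑ i, ((K.a i).natAbs + (K.b i).natAbs + K.w i) := fun i =>
    single_le_sum (f := fun i => (K.a i).natAbs + (K.b i).natAbs + K.w i)
      (fun _ _ => Nat.zero_le _) (mem_univ i)
  have ha : ∀ i, |(K.data N hn hN).a i| ≤ K.magnitude N := by
    intro i
    simp only [Input.data, Input.magnitude]
    split_ifs with h1 h2
    · simp; positivity
    · have := hsum ⟨i, h1⟩
      rw [Int.abs_eq_natAbs]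
      omega
    · simp; positivity
  have hb : ∀ i, |(K.data N hn hN).b i| ≤ K.magnitude N := by
    intro i
    simp only [Input.data, Input.magnitude]
    split_ifs with h1 h2
    · simp; positivity
    · have := hsum ⟨i, h1⟩
      rw [Int.abs_eq_natAbs]
      omega
    · simp; positivity
  refine ⟨?_, ?_, ?_, ?_, ha, hb, ?_, ?_⟩
  · simp [Input.magnitude]
  · simp only [Input.data, Input.magnitude]; omega
  · simp only [Input.data, Input.magnitude]; omega
  · simp only [Input.data, Input.magnitude]; omega
  · intro i
    simp only [Input.data, Input.magnitude]
    split_ifs with h1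
    · have := hsum ⟨i, h1⟩
      omega
    · omega
  · set Z := K.magnitude N with hZ
    have hnZ : 2 * (n : ℤ) + 3 ≤ Z := by
      have : 2 * n + 3 ≤ Z := by simp only [hZ, Input.magnitude]; omega
      exact_mod_cast this
    have hNZ : (N : ℤ) ≤ Z := by
      have : N ≤ Z := by simp only [hZ, Input.magnitude]; omega
      exact_mod_cast this
    have hsq : ∀ i, (K.data N hn hN).a i ^ 2 ≤ (Z : ℤ) ^ 2 := fun i =>
      sq_le_sq.2 (by rw [Nat.abs_cast]; exact ha i)
    have h1 : (K.data N hn hN).bound ≤ 1 + n * (2 * N * (Z : ℤ) ^ 2) := by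
      unfold Data.bound
      refine add_le_add le_rfl ?_
      calc ∑ i ∈ range n, 2 * (N : ℤ) * (K.data N hn hN).a i ^ 2
          ≤ ∑ _i ∈ range n, 2 * (N : ℤ) * (Z : ℤ) ^ 2 :=
            sum_le_sum fun i _ => mul_le_mul_of_nonneg_left (hsq i) (by positivity)
        _ = n * (2 * N * (Z : ℤ) ^ 2) := by simp
    -- The shape of `magnitude` gives 2n ≤ Z − 3, so that 1 + 2nN·Z² ≤ 3Z³ + (Z − 3)Z³ = Z⁴.
    have h2 : (2 * (n : ℤ)) * (N * (Z : ℤ) ^ 2) ≤ (Z - 3) * (Z * (Z : ℤ) ^ 2) := by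
      refine mul_le_mul (by linarith) ?_ (by positivity) (by linarith)
      exact mul_le_mul_of_nonneg_right hNZ (by positivity)
    have h3 : (1 : ℤ) ≤ 3 * (Z * (Z : ℤ) ^ 2) := by
      have : (0 : ℤ) < Z * (Z : ℤ) ^ 2 := by
        have : (0 : ℤ) < Z := by omega
        positivity
      omega
    calc _ ≤ _ := h1
      _ = 1 + (2 * (n : ℤ)) * (N * (Z : ℤ) ^ 2) := by ring
      _ ≤ 3 * (Z * (Z : ℤ) ^ 2) + (Z - 3) * (Z * (Z : ℤ) ^ 2) := add_le_add h3 h2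
      _ = (Z : ℤ) ^ 4 := by ring

/-- The ceiling is found by counting. This is the only place where ε enters a computation; the
products m·ε are not bounded in terms of Z, hence the separate hypothesis on them. -/
theorem run_progLevels {Q : ℝ → Prop} {σ : Mem} {ε : ℝ} (hε : 0 < ε) (hσn : σ.idx 0 0 0 = n)
    (hσN : σ.idx 3 0 0 = 0) (hσε : σ.num 4 0 0 = ε) (hNε : N = ⌈4 * n / ε⌉₊)
    (hQN : ∀ m ≤ N, Q m ∧ Q (m * ε)) (hQn : Q 4 ∧ Q n ∧ Q (4 * n)) :
    Run Q progLevels σ (N * 40 + 40)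
      (fun τ => τ.idx 3 0 0 = N ∧ τ.idx 0 = σ.idx 0 ∧ τ.idx 6 = σ.idx 6 ∧ τ.num = σ.num) := by
  refine (Run.while_count (c := 10) (I := fun k τ => τ.idx 3 0 0 = k ∧ k ≤ N ∧
    τ.idx 0 = σ.idx 0 ∧ τ.idx 6 = σ.idx 6 ∧ τ.num = σ.num) N ?_ ?_ ?_).mono ?_ ?_
  · rintro k τ ⟨e3, hk, e0, e6, en⟩
    obtain ⟨q1, q2⟩ := hQN k hk
    obtain ⟨q3, q4, q5⟩ := hQn
    simp [Test.Ok, NExp.Ok, NExp.eval, IExp.eval, e3, e0, en, hσε, hσn, q1, q2, q3, q4, q5]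
  · rintro k τ ⟨e3, hk, e0, e6, en⟩ hb
    simp only [Test.Holds, NExp.eval, IExp.eval, e3, e0, en, hσε, hσn] at hb
    push_cast at hb
    have hlt : k < N := by
      rw [hNε, Nat.lt_ceil, lt_div_iff₀ hε]
      exact hb
    refine ⟨hlt, Run.setI (by simp [IExp.cost]) ⟨by simp [IExp.eval, e3], hlt, ?_, ?_, en⟩⟩
    · rw [Mem.setI_idx_ne _ (by norm_num), e0]
    · rw [Mem.setI_idx_ne _ (by norm_num), e6]
  · exact ⟨hσN, Nat.zero_le _, rfl, rfl, rfl⟩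
  · simp [Test.cost, NExp.cost, IExp.cost]; omega
  · rintro τ - ⟨k, ⟨e3, hk, e0, e6, en⟩, hb⟩
    refine ⟨?_, e0, e6, en⟩
    simp only [Test.Holds, NExp.eval, IExp.eval, e3, e0, en, hσε, hσn, not_lt] at hb
    push_cast at hb
    rw [e3]
    refine le_antisymm hk ?_
    rw [hNε, Nat.ceil_le, div_le_iff₀ hε]
    exact hb

theorem run_progClean {Q : ℝ → Prop} {σ : Mem} {D : Data} {Z : ℕ} (hZ : D.Sized Z)
    (hQ : ∀ y, Small Z 20 y → Q y) {a b : ℕ → ℝ} (hn : σ.idx 0 0 0 = D.n)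
    (hN : σ.idx 3 0 0 = D.N) (h6 : σ.idx 6 0 0 = 0)
    (hw : ∀ i < D.n, σ.num 2 i 0 = D.w i) (hW : σ.num 3 0 0 = D.W)
    (ha : ∀ i < D.n, σ.num 0 i 0 = a i) (hb : ∀ i < D.n, σ.num 1 i 0 = b i)
    (haD : ∀ i < D.n, D.w i ≤ D.W → a i = D.a i) (hbD : ∀ i < D.n, D.w i ≤ D.W → b i = D.b i) :
    Run Q progClean σ (D.n * 150 + 100) (SweepInv D Z 0) := by
  have h1 := hZ.one_le
  have hQ' : ∀ {k : ℕ} {y : ℝ}, Small Z k y → k ≤ 20 → Q y := fun h hk => hQ _ (h.mono h1 hk)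
  have hQ0 : Q 0 := by simpa using hQ' (hZ.small_nat (Nat.zero_le Z)) (by norm_num)
  have hQ1 : Q 1 := by simpa using hQ' (hZ.small_nat h1) (by norm_num)
  have s2 := hZ.small_nat hZ.two_le
  have sN := hZ.small_nat hZ.N_lt.le
  push_cast at s2
  -- All summands are nonnegative, so the intermediate values of the sum are bounded by its final
  -- value.
  have hpart : ∀ k ≤ D.n, Small Z 4 (1 + ∑ i ∈ range k, 2 * (D.N : ℝ) * (D.a i : ℝ) ^ 2) := by
    intro k hk
    have hnn : ∀ m, 0 ≤ ∑ i ∈ range m, 2 * (D.N : ℤ) * D.a i ^ 2 := fun m =>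
      sum_nonneg fun i _ => by positivity
    have hle : ∑ i ∈ range k, 2 * (D.N : ℤ) * D.a i ^ 2 ≤
        ∑ i ∈ range D.n, 2 * (D.N : ℤ) * D.a i ^ 2 :=
      sum_le_sum_of_subset_of_nonneg (range_mono hk) fun i _ _ => by positivity
    have := Small.of_int (k := 4) h1 (z := 1 + ∑ i ∈ range k, 2 * (D.N : ℤ) * D.a i ^ 2) (by
      rw [abs_of_nonneg (by have := hnn k; omega)]
      have := hZ.bound_le
      unfold Data.bound at this
      omega)
    push_cast at this
    exact this
  refine Run.seq_setN (c₂ := D.n * 150 + 80) (by simp [IExp.cost, NExp.cost]; omega)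
    (by simpa [NExp.Ok] using hQ1) ?_
  refine Run.seq (c₁ := D.n * 150 + 16) (c₂ := 50) (by omega)
    (Run.for (c := 134) (fun k τ => (∀ i < k, τ.num 6 i 0 = D.a i ∧ τ.num 7 i 0 = D.b i) ∧
      τ.num 12 0 0 = 1 + ∑ i ∈ range k, 2 * (D.N : ℝ) * (D.a i : ℝ) ^ 2) D.n
      (by simp [IExp.cost]) rfl ?_ ?_ ?_ ?_) ?_
  · intro τ hA
    have := hA.1 0 rfl
    simp only [IExp.eval, this]
    exact hn
  · intro k τ y h; exact h
  · simp [NExp.eval, IExp.eval]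
  · rintro k τ hk hA hτk ⟨hI, hI12⟩
    have eN : τ.idx 3 0 0 = D.N := by rw [hA.1 3 rfl]; exact hN
    have ew : τ.num 2 k 0 = D.w k := by rw [hA.2 2 rfl]; exact hw k hk
    have eW : τ.num 3 0 0 = D.W := by rw [hA.2 3 rfl]; exact hW
    have ea : τ.num 0 k 0 = a k := by rw [hA.2 0 rfl]; exact ha k hk
    have eb : τ.num 1 k 0 = b k := by rw [hA.2 1 rfl]; exact hb k hk
    refine Run.seq (c₁ := 60) (c₂ := 60) (R' := fun υ => (∀ i < k + 1,
      υ.num 6 i 0 = D.a i ∧ υ.num 7 i 0 = D.b i) ∧ υ.num 12 = τ.num 12 ∧ υ.idx = τ.idx)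
      (by norm_num) ?_ ?_
    · have hgoal : ∀ x y : ℝ, x = D.a k → y = D.b k →
          ∀ i < k + 1, ((τ.setN 6 k 0 x).setN 7 k 0 y).num 6 i 0 = D.a i ∧
            ((τ.setN 6 k 0 x).setN 7 k 0 y).num 7 i 0 = D.b i := by
        rintro x y rfl rfl i hi
        by_cases hik : i = k
        · simp [hik]
        · simpa [hik] using hI i (by omega)
      refine Run.ite (c₁ := 40) (by simp [Test.cost, NExp.cost, IExp.cost]) ⟨trivial, trivial⟩ ?_ ?_
      · intro hb'
        simp only [Test.Holds, NExp.eval, IExp.eval, hτk, eW, ew, Nat.cast_lt] at hb'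
        refine Run.seq_setN (c₂ := 20) (by simp [IExp.cost, NExp.cost])
          (by simpa [NExp.Ok] using hQ0) ?_
        refine Run.setN (by simp [IExp.cost, NExp.cost]) (by simpa [NExp.Ok] using hQ0) ?_
        refine ⟨?_, ?_, rfl⟩
        · simp only [NExp.eval, IExp.eval, Mem.setN_idx, hτk]
          exact hgoal _ _ (by simp [D.a_eq_zero k hb']) (by simp [D.b_eq_zero k hb'])
        · rw [Mem.setN_num_ne _ (by norm_num), Mem.setN_num_ne _ (by norm_num)]
      · intro hb'
        simp only [Test.Holds, NExp.eval, IExp.eval, hτk, eW, ew, Nat.cast_lt, not_lt] at hb'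
        refine Run.seq_setN (c₂ := 20) (by simp [IExp.cost, NExp.cost]) trivial ?_
        refine Run.setN (by simp [IExp.cost, NExp.cost]) trivial ?_
        refine ⟨?_, ?_, rfl⟩
        · have e1 : (τ.setN 6 k 0 (a k)).num 1 k 0 = b k := by simpa using eb
          simp only [NExp.eval, IExp.eval, Mem.setN_idx, hτk, ea, e1]
          exact hgoal _ _ (haD k hk hb') (hbD k hk hb')
        · rw [Mem.setN_num_ne _ (by norm_num), Mem.setN_num_ne _ (by norm_num)]
    · rintro υ - ⟨hυ, e12, eidx⟩
      have e6 := (hυ k (Nat.lt_succ_self k)).1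
      have sa2 := (hZ.small_a k).mul (hZ.small_a k)
      have q1 := hQ' (s2.mul sN) (by norm_num)
      have q2 := hQ' sa2 (by norm_num)
      have q3 := hQ' ((s2.mul sN).mul sa2) (by norm_num)
      have q4 := hQ' (hpart (k + 1) hk) (by norm_num)
      have hnew : (1 + ∑ i ∈ range k, 2 * (D.N : ℝ) * (D.a i : ℝ) ^ 2) +
          2 * D.N * ((D.a k : ℝ) * D.a k) =
          1 + ∑ i ∈ range (k + 1), 2 * (D.N : ℝ) * (D.a i : ℝ) ^ 2 := by
        rw [sum_range_succ]; ring
      refine Run.setN (by simp [IExp.cost, NExp.cost]) ?_ ?_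
      · simp [NExp.Ok, NExp.eval, IExp.eval, eidx, hτk, eN, e6, e12, hI12, hnew, q1, q2, q3, q4,
          hQ' s2, hQ' sN]
      · refine ⟨fun i hi => by simpa using hυ i hi, ?_⟩
        simp [NExp.eval, IExp.eval, eidx, hτk, eN, e6, e12, hI12, hnew]
  · rintro τ hA ⟨hI, hI12⟩
    have hbd : (D.bound : ℝ) = 1 + ∑ i ∈ range D.n, 2 * (D.N : ℝ) * (D.a i : ℝ) ^ 2 := by
      unfold Data.bound
      push_cast
      rfl
    rw [← hbd] at hI12
    have hbp : (0 : ℝ) < D.bound := by exact_mod_cast D.bound_pos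
    have sneg : Small Z 4 (-(D.bound : ℝ)) := hZ.small_bound.neg
    refine Run.setN (by simp [IExp.cost, NExp.cost]) ?_ ?_
    · simp [NExp.Ok, NExp.eval, IExp.eval, hI12, hQ0, hQ' sneg]
    · have e8 : ∀ υ : Mem, υ = τ.setN 8 (IExp.eval τ (.const 0)) (IExp.eval τ (.const 0))
          (NExp.eval τ (.sub (.const 0) (nvar 12))) → υ.num 8 0 0 = -(D.bound : ℝ) := by
        rintro _ rfl
        simp [NExp.eval, IExp.eval, hI12]
      have e0 : τ.idx 0 0 0 = D.n := by rw [hA.1 0 rfl]; exact hn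
      have e3 : τ.idx 3 0 0 = D.N := by rw [hA.1 3 rfl]; exact hN
      have e6 : τ.idx 6 0 0 = 0 := by rw [hA.1 6 rfl]; exact h6
      have en2 : ∀ i < D.n, τ.num 2 i 0 = D.w i := by rw [hA.2 2 rfl]; exact hw
      have en3 : τ.num 3 0 0 = D.W := by rw [hA.2 3 rfl]; exact hW
      refine ⟨⟨e0, e3, en2, en3, fun i hi => (hI i hi).1, fun i hi => (hI i hi).2, hI12⟩, e6, ?_,
        ?_, ?_, by simp, by simp, by simp⟩
      · rw [e8 _ rfl]; simp [Data.left]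
      · rw [e8 _ rfl]; exact sneg
      · rw [e8 _ rfl]; linarith

end Preprocessing

/-! ## Encoding lengths -/

theorem size_add_le (x y : ℕ) : (x + y).size ≤ x.size + y.size := by
  rw [Nat.size_le, pow_add]
  have hx := Nat.lt_size_self x
  have hy := Nat.lt_size_self y
  nlinarith

theorem size_mul_le (x y : ℕ) : (x * y).size ≤ x.size + y.size := by
  rw [Nat.size_le, pow_add]
  exact Nat.mul_lt_mul'' (Nat.lt_size_self x) (Nat.lt_size_self y)

theorem size_pow_le (x k : ℕ) : (x ^ k).size ≤ k * x.size + 1 := by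
  induction k with
  | zero => simp
  | succ k ih =>
    rw [pow_succ, Nat.succ_mul]
    exact (size_mul_le _ _).trans (by omega)

theorem size_sum_le {ι : Type*} (s : Finset ι) (f : ι → ℕ) :
    (∑ i ∈ s, f i).size ≤ ∑ i ∈ s, (f i).size := by
  classical
  induction s using Finset.induction_on with
  | empty => simp
  | insert i s hi ih =>
    rw [sum_insert hi, sum_insert hi]
    exact (size_add_le _ _).trans (by omega)

theorem size_le_self (x : ℕ) : x.size ≤ x := by
  rw [Nat.size_le]
  exact Nat.lt_two_pow_self

theorem ratSize_div_le (p : ℤ) {q : ℕ} (hq : 0 < q) :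
    ratSize ((p : ℚ) / q) ≤ p.natAbs.size + 1 + q.size := by
  have hq' : (q : ℤ) ≠ 0 := by exact_mod_cast hq.ne'
  have e : (p : ℚ) / q = Rat.divInt p q := by
    rw [Rat.divInt_eq_div]; simp
  unfold ratSize intSize
  rw [e]
  have h1 : (Rat.divInt p q).num.natAbs ≤ p.natAbs := by
    rcases eq_or_ne p 0 with rfl | hp
    · simp
    · exact Nat.le_of_dvd (Int.natAbs_pos.2 hp) (Int.natAbs_dvd_natAbs.2 (Rat.num_dvd p hq'))
  have h2 : (Rat.divInt p q).den ≤ q :=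
    Nat.le_of_dvd hq (by exact_mod_cast Rat.den_dvd p q)
  have := Nat.size_le_size h1
  have := Nat.size_le_size h2
  omega

theorem Small.fitsIn {Z k B : ℕ} {x : ℝ} (h : Small Z k x) (hB : 2 * (k * Z.size + 1) + 1 ≤ B) :
    FitsIn B x := by
  obtain ⟨p, q, hq, hp, hq', rfl⟩ := h
  refine ⟨(p : ℚ) / q, by push_cast; rfl, (ratSize_div_le p hq).trans ?_⟩
  have h1 : p.natAbs ≤ Z ^ k := by
    rw [Int.abs_eq_natAbs] at hp
    exact_mod_cast hp
  have := Nat.size_le_size h1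
  have := Nat.size_le_size hq'
  have := size_pow_le Z k
  omega

section

variable {n : ℕ} (K : Input n)

theorem Input.n_le_size : n ≤ K.size := by
  unfold Input.size
  have : ∑ _i : Fin n, 1 ≤ ∑ i, (intSize (K.a i) + intSize (K.b i) + intSize (K.w i)) :=
    sum_le_sum fun i _ => by unfold intSize; omega
  simp only [sum_const, card_univ, Fintype.card_fin, smul_eq_mul, mul_one] at this
  omega

theorem Input.size_magnitude_le (N : ℕ) : (K.magnitude N).size ≤ 3 + n + N.size + K.size := by
  unfold Input.magnitude Input.size
  have h1 := size_add_le 3 (2 * (n + N + K.W + ∑ i, ((K.a i).natAbs + (K.b i).natAbs + K.w i)))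
  have h2 := size_mul_le 2 (n + N + K.W + ∑ i, ((K.a i).natAbs + (K.b i).natAbs + K.w i))
  have h3 := size_add_le (n + N + K.W) (∑ i, ((K.a i).natAbs + (K.b i).natAbs + K.w i))
  have h4 := size_add_le (n + N) K.W
  have h5 := size_add_le n N
  have h6 := size_le_self n
  have h7 := size_sum_le univ fun i => (K.a i).natAbs + (K.b i).natAbs + K.w i
  have h8 : ∑ i, ((K.a i).natAbs + (K.b i).natAbs + K.w i).size ≤
      ∑ i, (intSize (K.a i) + intSize (K.b i) + intSize (K.w i)) := by
    refine sum_le_sum fun i _ => ?_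
    have a1 := size_add_le ((K.a i).natAbs + (K.b i).natAbs) (K.w i)
    have a2 := size_add_le (K.a i).natAbs (K.b i).natAbs
    simp only [intSize, Int.natAbs_natCast]
    omega
  have h9 : K.W.size + 1 = intSize K.W := by simp [intSize]
  have e3 : Nat.size 3 = 2 := by decide
  have e2 : Nat.size 2 = 2 := by decide
  omega

/-- A positive fraction is at least the reciprocal of its denominator, so N ≤ 4n·den: N may be
exponential in the encoding length, but its bit size is not. -/
theorem size_levels_le {ε : ℝ} (hε : 0 < ε) {q : ℚ} (hq : (q : ℝ) = ε) :
    (⌈4 * n / ε⌉₊).size ≤ 3 + n + q.den.size := by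
  have hle : ⌈4 * n / ε⌉₊ ≤ 4 * n * q.den := by
    rw [Nat.ceil_le, div_le_iff₀ hε]
    push_cast
    have h1 : (1 : ℝ) ≤ q.den * ε := by
      have h2 : q.den * q = q.num := by
        rw [mul_comm]; exact Rat.mul_den_eq_num q
      have h3 : (q.den : ℝ) * ε = q.num := by
        rw [← hq]; exact_mod_cast h2
      have hq0 : 0 < q := by rw [← hq] at hε; exact_mod_cast hε
      have h4 : 0 < q.num := Rat.num_pos.2 hq0
      rw [h3]
      exact_mod_cast h4
    have h5 : (0 : ℝ) ≤ 4 * n := by positivity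
    nlinarith
  have h1 := Nat.size_le_size hle
  have h2 := size_mul_le (4 * n) q.den
  have h3 := size_mul_le 4 n
  have h4 := size_le_self n
  have e4 : Nat.size 4 = 3 := by decide
  omega

/-! ## Translation to the original problem -/

variable {N : ℕ} (hn : 0 < n) (hN : 4 * n ≤ N)

/-- Profits agree only on sets that fit, since preprocessing changes the items that are too heavy,
and no such item belongs to a set that fits. -/
theorem Input.translate {x : Fin n → ℕ} {S : Finset ℕ} (hS : S ⊆ range n)
    (hx : ∀ i : Fin n, x i = if (i : ℕ) ∈ S then 1 else 0) :
    (K.Feasible x ↔ Fits n (K.data N hn hN).w K.W S) ∧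
    (Fits n (K.data N hn hN).w K.W S →
      ∀ t, K.profit t x = ∑ i ∈ S, (K.data N hn hN).p t i) := by
  have key : ∀ (M : Type) [AddCommMonoid M] (f : ℕ → M),
      ∑ i : Fin n, (if (i : ℕ) ∈ S then f i else 0) = ∑ i ∈ S, f i := by
    intro M _ f
    rw [← sum_range (fun i => if i ∈ S then f i else 0), ← sum_filter, filter_mem_eq_inter,
      inter_eq_right.2 hS]
  have hw : ∑ i, K.w i * x i = ∑ i ∈ S, (K.data N hn hN).w i := by
    rw [← key ℕ]
    refine sum_congr rfl fun i _ => ?_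
    rw [hx i]
    simp [Input.data]
  constructor
  · unfold Input.Feasible Fits
    rw [hw]
    refine ⟨fun h => ⟨hS, h.2⟩, fun h => ⟨fun i => ?_, h.2⟩⟩
    rw [hx i]
    split_ifs <;> simp
  · intro hfit t
    unfold Input.profit
    rw [← key ℝ]
    refine sum_congr rfl fun i _ => ?_
    rw [hx i]
    split_ifs with hi
    · have h1 : (K.data N hn hN).w i ≤ K.W :=
        (single_le_sum (fun _ _ => Nat.zero_le _) hi).trans hfit.2
      simp only [Input.data, i.2, ↓reduceDIte, Fin.eta] at h1
      simp [Data.p, Input.data, not_lt.2 h1]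
    · simp

theorem Input.isApprox_of_fits {ε t : ℝ} (hNε : 4 * n ≤ N * ε) {x : Fin n → ℕ} {S : Finset ℕ}
    (hS : Fits n (K.data N hn hN).w K.W S) (hx : ∀ i : Fin n, x i = if (i : ℕ) ∈ S then 1 else 0)
    (hopt : ∀ T, Fits n (K.data N hn hN).w K.W T →
      ((N : ℝ) - 4 * n) * ∑ i ∈ T, (K.data N hn hN).p t i ≤
        N * ∑ i ∈ S, (K.data N hn hN).p t i) :
    K.IsApprox ε t x := by
  obtain ⟨h1, h2⟩ := K.translate hn hN hS.1 hx
  refine ⟨h1.2 hS, ?_⟩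
  rw [h2 hS t]
  obtain ⟨⟨y, hy, hyopt⟩, hub⟩ := K.optProfit_isGreatest t
  have h0 : 0 ≤ K.optProfit t :=
    hub ⟨fun _ => 0, by simp [Input.Feasible], by simp [Input.profit]⟩
  obtain ⟨T, hT, hyT⟩ : ∃ T ⊆ range n, ∀ i : Fin n, y i = if (i : ℕ) ∈ T then 1 else 0 := by
    refine ⟨(range n).filter fun i => ∃ h : i < n, y ⟨i, h⟩ = 1, filter_subset _ _, fun i => ?_⟩
    rcases hy.1 i with h | h <;> simp [h]
  obtain ⟨g1, g2⟩ := K.translate hn hN hT hyT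
  have hTf := g1.1 hy
  have := hopt T hTf
  rw [← g2 hTf t, hyopt] at this
  have hN0 : (0 : ℝ) < N := by exact_mod_cast (by omega : 0 < N)
  refine le_of_mul_le_mul_left ?_ hN0
  nlinarith

/-- Take the first breakpoint that is at least t; no ordering of the breakpoints is used. -/
theorem exists_mem_piece (k : ℕ) (c : ℕ → ℝ) (t : ℝ) : ∃ j ≤ k, t ∈ piece k c j := by
  classical
  have hex : ∃ j, k ≤ j ∨ t ≤ c j := ⟨k, .inl le_rfl⟩
  have hspec := Nat.find_spec hex
  have hmin := fun m => Nat.find_min hex (m := m)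
  set j := Nat.find hex
  have hjk : j ≤ k := Nat.find_min' hex (.inl le_rfl)
  refine ⟨j, hjk, fun h0 => ?_, fun hlt => hspec.resolve_left (by omega)⟩
  have := hmin (j - 1) (by omega)
  push Not at this
  exact this.2.le

/-- The k + 1 cells have k inner breakpoints. The first cell starts at −bound and the last ends at
bound, where `cell` is unbounded; the stored value bound is not part of the output. -/
theorem SweepInv.isParametricApprox {Z k : ℕ} {τ υ : Mem} {ε : ℝ} (hNε : 4 * n ≤ N * ε)
    (h : SweepInv (K.data N hn hN) Z (k + 1) τ) (hend : τ.num 8 0 0 = (K.data N hn hN).bound)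
    (hbreak : υ.outBreak = τ.outBreak) (hsol : υ.idx 2 = τ.idx 2) :
    K.IsParametricApprox ε k υ.outBreak (υ.outSol n) := by
  rw [hbreak]
  refine ⟨fun j hj => ?_, exists_mem_piece k _, fun j hj t ht => ?_⟩
  · have := h.lt (j + 1) (by omega)
    simpa [Data.left] using this
  · obtain ⟨S, hS, hrow, hopt⟩ := h.approx j (by omega)
    refine K.isApprox_of_fits hn hN hNε hS (fun i => ?_) (hopt t ?_)
    · unfold Mem.outSol
      rw [hsol]
      exact hrow i i.2
    · constructor
      · rcases Nat.eq_zero_or_pos j with rfl | hj0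
        · simp [Data.left]
        · right
          simpa [Data.left, hj0.ne'] using ht.1 hj0
      · rcases hj.eq_or_lt with rfl | hlt
        · left
          rw [← hend, h.cur]
          simp [Data.left]
        · exact .inr (ht.2 hlt)

end

theorem run_progMain {n : ℕ} (K : Input n) {N : ℕ} (hn : 0 < n) (hN : 4 * n ≤ N) {ε : ℝ}
    (hε : 0 < ε) (hNdef : N = ⌈4 * n / ε⌉₊) {Q : ℝ → Prop}
    (hQ : ∀ y, Small (K.magnitude N) 20 y → Q y) (hQN : ∀ m ≤ N, Q (m * ε)) :
    Run Q progMain (K.toMem ε) (30000 * (n * N) ^ 2) (fun τ =>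
      τ.outCount + 1 ≤ 2 * (n * (N + 1)) + 1 ∧
      K.IsParametricApprox ε τ.outCount τ.outBreak (τ.outSol n)) := by
  obtain ⟨D, hD⟩ : ∃ D, D = K.data N hn hN := ⟨_, rfl⟩
  have eDn : D.n = n := by rw [hD]; rfl
  have eDN : D.N = N := by rw [hD]; rfl
  have eDW : D.W = K.W := by rw [hD]; rfl
  have hcost : ∃ c : ℕ, c = (N * 40 + 40) + ((D.n * 150 + 100) +
      (((2 * (D.n * (D.N + 1)) + 1) * (3000 * (D.n * D.N) + 8) + 8) + 10)) ∧
      c ≤ 30000 * (n * N) ^ 2 := by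
    refine ⟨_, rfl, ?_⟩
    rw [eDn, eDN]
    obtain ⟨x, hx⟩ : ∃ x, x = n * N := ⟨_, rfl⟩
    have a1 : n ≤ x := hx ▸ Nat.le_mul_of_pos_right _ (by omega)
    have a2 : N ≤ x := hx ▸ Nat.le_mul_of_pos_left _ hn
    have a3 : 1 ≤ x := by omega
    have a4 : n * (N + 1) = x + n := by rw [hx]; ring
    rw [a4, ← hx]
    nlinarith
  obtain ⟨c, hc, hc'⟩ := hcost
  suffices H : Run Q progMain (K.toMem ε) c (fun τ =>
      τ.outCount + 1 ≤ 2 * (n * (N + 1)) + 1 ∧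
      K.IsParametricApprox ε τ.outCount τ.outBreak (τ.outSol n)) from H.mono hc' fun _ _ h => h
  rw [hc]
  have hZ : D.Sized (K.magnitude N) := by rw [hD]; exact K.sized hn hN
  have hQ1 : ∀ m : ℕ, m ≤ K.magnitude N → Q m := fun m hm =>
    hQ _ ((hZ.small_nat hm).mono hZ.one_le (by norm_num))
  have hNZ : N ≤ K.magnitude N := by unfold Input.magnitude; omega
  have hnZ : n ≤ K.magnitude N := by unfold Input.magnitude; omega
  have s4 : Small (K.magnitude N) 2 (4 : ℕ) := Small.of_nat hZ.one_le (by
    have := hZ.three_le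
    nlinarith)
  have sn := hZ.small_nat hnZ
  refine Run.seq le_rfl (run_progLevels (n := n) (N := N) (ε := ε) hε ?_ ?_ ?_ hNdef
    (fun m hm => ⟨hQ1 m (hm.trans hNZ), hQN m hm⟩) ⟨?_, hQ1 n hnZ, ?_⟩) ?_
  · simp [Input.toMem]
  · simp [Input.toMem]
  · simp [Input.toMem]
  · have := hQ _ (s4.mono hZ.one_le (by norm_num))
    simpa using this
  · have := hQ _ ((s4.mul sn).mono hZ.one_le (by norm_num))
    simpa using this
  rintro σ₁ - ⟨e3, e0, e6, en⟩
  refine Run.seq le_rfl (run_progClean (D := D) hZ hQ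
    (a := fun i => if h : i < n then (K.a ⟨i, h⟩ : ℝ) else 0)
    (b := fun i => if h : i < n then (K.b ⟨i, h⟩ : ℝ) else 0)
    ?_ (by rw [e3, eDN]) ?_ ?_ ?_ ?_ ?_ ?_ ?_) ?_
  · rw [e0, eDn]; simp [Input.toMem]
  · rw [e6]; simp [Input.toMem]
  · intro i hi
    rw [eDn] at hi
    rw [en, hD]; simp [Input.toMem, Input.data, hi]
  · rw [en, eDW]; simp [Input.toMem]
  · intro i hi
    rw [en]; simp [Input.toMem]
  · intro i hi
    rw [en]; simp [Input.toMem]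
  · intro i hi hw
    rw [eDn] at hi
    rw [hD] at hw ⊢
    simp only [Input.data, hi, ↓reduceDIte] at hw ⊢
    simp [not_lt.2 hw]
  · intro i hi hw
    rw [eDn] at hi
    rw [hD] at hw ⊢
    simp only [Input.data, hi, ↓reduceDIte] at hw ⊢
    simp [not_lt.2 hw]
  intro σ₂ _ hσ₂
  refine Run.seq le_rfl (run_progSweep hZ hQ hσ₂) ?_
  rintro σ₃ - ⟨k, hI, hend⟩
  have hNε : 4 * n ≤ N * ε := by
    have := Nat.le_ceil (4 * n / ε)
    rwa [← hNdef, div_le_iff₀ hε] at this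
  have hbp : (0 : ℝ) < D.bound := by exact_mod_cast D.bound_pos
  -- At least one cell was treated, because the sweep starts at −bound < bound.
  obtain ⟨m, rfl⟩ : ∃ m, k = m + 1 := by
    refine Nat.exists_eq_succ_of_ne_zero ?_
    rintro rfl
    have := hI.cur
    rw [hend] at this
    simp only [Data.left, ↓reduceIte] at this
    linarith
  refine Run.setI (by simp [IExp.cost]) ?_
  have hcount : ∀ υ : Mem, υ = σ₃.setI 1 (IExp.eval σ₃ (.const 0)) (IExp.eval σ₃ (.const 0))
      (IExp.eval σ₃ (.sub (ivar 6) (.const 1))) → υ.outCount = m := by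
    rintro _ rfl
    simp [Mem.outCount, IExp.eval, hI.count]
  rw [hcount _ rfl]
  have hpar : K.IsParametricApprox ε m σ₃.outBreak (σ₃.outSol n) := by
    subst hD
    exact hI.isParametricApprox K hn hN hNε hend rfl rfl
  refine ⟨?_, ?_⟩
  -- All breakpoints except the last stored one lie strictly below `bound`, hence are events.
  · have := hI.events_le (m := m) (by omega) (fun j hj => by
      have h1 := hI.lt m (by omega)
      have h2 := hI.le_left (i := j) (j := m) hj (by omega)
      have h3 : σ₃.outBreak m = D.bound := by
        rw [← hend, hI.cur]
        simp [Data.left]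
      rw [h3] at h1
      exact (h2.trans_lt h1).ne)
    rw [eDn, eDN] at this
    exact Nat.succ_le_succ this
  · have e2 : ∀ j y, (σ₃.setI 1 (IExp.eval σ₃ (.const 0)) (IExp.eval σ₃ (.const 0)) y).outSol n j =
        σ₃.outSol n j := fun j y => by
      funext i
      simp [Mem.outSol]
    exact ⟨hpar.1, hpar.2.1, fun j hj t ht => by
      rw [e2]
      exact hpar.2.2 j hj t ht⟩

end ParamKnapsack

/-! ### The final estimates in terms of n and ε -/

theorem theorem2 :
    ∃ (prog : ParamKnapsack.Prog) (C : ℝ) (P : Polynomial ℕ),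
      ∀ (n : ℕ), 1 ≤ n → ∀ (K : ParamKnapsack.Input n) (ε : ℝ), 0 < ε → ε < 1 →
        ∃ (τ : ParamKnapsack.Mem) (s : ℕ),
          ParamKnapsack.Exec
            (fun y => ∀ q : ℚ, (q : ℝ) = ε →
              ParamKnapsack.FitsIn (P.eval (K.size + ParamKnapsack.ratSize q)) y)
            prog (K.toMem ε) τ s ∧
          (s : ℝ) ≤ C * ((n : ℝ) ^ 4 / ε ^ 2) ∧
          ((τ.outCount + 1 : ℕ) : ℝ) ≤ C * ((n : ℝ) ^ 2 / ε) ∧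
          K.IsParametricApprox ε τ.outCount τ.outBreak (τ.outSol n) := by
  -- Since nN ≤ 5n²/ε, the time 30000(nN)² gives 30000·25 = 750000. For the polynomial, a number
  -- with exponent 20 takes 40·size(Z) + 3 bits, and size(Z) ≤ 6 + 3·`K.size` + size of the
  -- denominator of ε.
  refine ⟨ParamKnapsack.progMain, 750000, 120 * Polynomial.X + 300, ?_⟩
  intro n hn K ε hε hε1
  obtain ⟨N, hN⟩ : ∃ N, N = ⌈4 * n / ε⌉₊ := ⟨_, rfl⟩
  have hn1 : (1 : ℝ) ≤ n := by exact_mod_cast hn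
  have hNε : 4 * n ≤ N * ε := by
    have := Nat.le_ceil (4 * n / ε)
    rwa [← hN, div_le_iff₀ hε] at this
  have hN4 : 4 * n ≤ N := by
    have hN0 : (0 : ℝ) ≤ N := by positivity
    have : (4 * n : ℝ) ≤ N := by nlinarith
    exact_mod_cast this
  -- Rounding up costs at most ε < 1 ≤ n beyond 4n.
  have hNup : N * ε ≤ 5 * n := by
    have h1 := Nat.ceil_lt_add_one (a := 4 * n / ε) (by positivity)
    rw [← hN] at h1
    have h2 : (N : ℝ) * ε < (4 * n / ε + 1) * ε := mul_lt_mul_of_pos_right h1 hε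
    have h3 : (4 * n / ε + 1) * ε = 4 * n + ε := by field_simp
    linarith
  have hnN : (n * N : ℝ) ≤ 5 * (n ^ 2 / ε) := by
    rw [← mul_div_assoc, le_div_iff₀ hε]
    nlinarith
  have hQ : ∀ y, ParamKnapsack.Small (K.magnitude N) 20 y → ∀ q : ℚ, (q : ℝ) = ε →
      ParamKnapsack.FitsIn
        ((120 * Polynomial.X + 300 : Polynomial ℕ).eval (K.size + ParamKnapsack.ratSize q)) y := by
    intro y hy q hq
    refine hy.fitsIn ?_
    have h1 := K.size_magnitude_le N
    have h2 := ParamKnapsack.size_levels_le (n := n) hε hq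
    have h3 := K.n_le_size
    have h4 : q.den.size ≤ ParamKnapsack.ratSize q := by unfold ParamKnapsack.ratSize; omega
    rw [← hN] at h2
    simp
    omega
  have hQN : ∀ m ≤ N, ∀ q : ℚ, (q : ℝ) = ε →
      ParamKnapsack.FitsIn
        ((120 * Polynomial.X + 300 : Polynomial ℕ).eval (K.size + ParamKnapsack.ratSize q))
        (m * ε) := by
    intro m hm q hq
    have h2 := ParamKnapsack.size_levels_le (n := n) hε hq
    have h3 := K.n_le_size
    rw [← hN] at h2
    refine ⟨((m * q.num : ℤ) : ℚ) / q.den, ?_, (ParamKnapsack.ratSize_div_le _ q.den_pos).trans ?_⟩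
    · rw [← hq]
      push_cast
      rw [mul_div_assoc]
      congr 1
      exact_mod_cast Rat.num_div_den q
    · have h5 := ParamKnapsack.size_mul_le m q.num.natAbs
      have h6 := Nat.size_le_size hm
      have h7 : ParamKnapsack.ratSize q = q.num.natAbs.size + 1 + q.den.size := rfl
      rw [Int.natAbs_mul, Int.natAbs_natCast]
      simp
      omega
  obtain ⟨τ, s, he, hs, hcount, happ⟩ := ParamKnapsack.run_progMain K hn hN4 hε hN hQ hQN
  refine ⟨τ, s, he, ?_, ?_, happ⟩
  · have h1 : (s : ℝ) ≤ 30000 * (n * N : ℝ) ^ 2 := by exact_mod_cast hs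
    have h2 : (n * N : ℝ) ^ 2 ≤ (5 * (n ^ 2 / ε)) ^ 2 :=
      pow_le_pow_left₀ (by positivity) hnN 2
    have h3 : (5 * ((n : ℝ) ^ 2 / ε)) ^ 2 = 25 * (n ^ 4 / ε ^ 2) := by
      rw [mul_pow, div_pow]; ring
    linarith
  · have h1 : ((τ.outCount + 1 : ℕ) : ℝ) ≤ 2 * (n * (N + 1)) + 1 := by exact_mod_cast hcount
    have h2 : (0 : ℝ) ≤ n ^ 2 / ε := by positivity
    have h3 : (4 * n : ℝ) ≤ N := by exact_mod_cast hN4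
    nlinarith
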